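/- **Setting.** Fix integers $D\ge 0$, $d\ge 1$. Consider the quantum spin system on $\mathbb Z^D$ with one copy of $M_d(\mathbb C)$ per site. Let $\mathcal O$ be the algebra of all local observables (the inductive limit of the algebras $\bigotimes_{x\in X}M_d(\mathbb C)$, $X\subset\mathbb Z^D$ finite, with the operator norm), or any translation-invariant unital $\star$-subalgebra of it. Let $\mathcal A$ be its norm completion, $\iota_x$ the translations, and $\mathcal O_X$ the set of elements of $\mathcal O$ supported in $X$. For $A\in\mathcal O$ let $\mathrm{supp}(A)$ be the smallest set supporting $A$ and $|A|$ its cardinality. Let $\mathrm{dist}(A,B)$ be the $\ell^1$-distance of the supports ($\infty$ if one of them is empty). *Clustering.* A family $S$ of translation-invariant states on $\mathcal A$ is *uniformly sizably $p$-clustering* if there are $\nu,a>0$ such that every $\omega\in S$ satisfies, for some $f\ge0$ with $f(k)\le k^{-p}$ for all integers $k>0$, $$|\omega(AB)-\omega(A)\omega(B)|\le \nu\,\ell^{a}\,\|A\|\,\|B\|\,f(\mathrm{dist}(A,B))$$ for all $\ell\in\mathbb N$ and $A,B\in\mathcal O$ with $|A|,|B|<\ell$. (If $A$ or $B$ is a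 scalar the left-hand side is $0$ and nothing is required.) A state $\omega$ is *sizably $p$-clustering* if $\{\omega\}$ is. *Forms.* For a functional $\omega$ put $$\langle A,B\rangle_\omega=\sum_{x\in\mathbb Z^D}\big(\omega(\iota_x(A)^\star B)-\omega(A^\star)\omega(B)\big),\qquad \langle\langle A,B\rangle\rangle_\omega=\tfrac12\big(\langle A,B\rangle_\omega+\langle B^\star,A^\star\rangle_\omega\big).$$ For $\omega$ sizably $p$-clustering with $p>D$ the second form is positive semi-definite; $\widehat{\mathcal H}_\omega$ is the Hilbert space obtained from $\mathcal O$ by dividing out its null space and completing. *Dynamics.* Let $h=h^\star\in\mathcal O$ and $\mathfrak LH(B)=\sum_x(\iota_x(h)B-B\,\iota_x(h))$ for $B\in\mathcal O$. The time evolution $(\tau_t)_{t\in\mathbb R}$ is the strongly continuous one-parameter group of bounded linear maps on $\mathcal A$ such that, for some $r>0$, $\tau_t(A)=\sum_n\frac{(it)^n}{n!}(\mathfrak LH)^n(A)$ for all $|t|<r$ and $A\in\mathcal O$. *Truncations.* For finite $X\subset\mathbb Z^D$ and $B\in\mathcal A$ let $(B)_X\in\mathcal O_X$ be the orthogonal projection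 of $B$ onto $\mathcal O_X$ for the inner product $\mathrm{Tr}(B^\star C)$, where $\mathrm{Tr}$ is the normalized trace (if $\mathcal O$ is the full local algebra, this is the normalized partial trace over the complement of $X$). For $A\in\mathcal O$ let $X_n^A=\bigcup_{\|x\|_1\le n}\mathrm{supp}(\iota_x(A))$. **Theorem.** The time evolution $\tau_t$ exists and is unique. Let $p>D$. (i) If $\omega$ is a sizably $p$-clustering state, then for every $q<p$ and every $t\in\mathbb R$, $\omega\circ\tau_t$ is a sizably $q$-clustering (translation-invariant) state. Moreover, if $S$ is uniformly sizably $p$-clustering and $K\subset\mathbb R$ is compact, then for every $q<p$ the family $\{\omega\circ\tau_t:\omega\in S,\ t\in K\}$ is uniformly sizably $q$-clustering. (ii) If $\omega$ is a sizably $p$-clustering state and $t\in\mathbb R$, then for every $A\in\mathcal O$ the classes of $(\tau_t(A))_{X_n^A}$ form a Cauchy sequence in $\widehat{\mathcal H}_\omega$; denote its limit by $\tau_t(A)\in\widehat{\mathcal H}_\omega$. For all $A,B\in\mathcal O$, $$\langle\langle \tau_t(A),\tau_t(B)\rangle\rangle_\omega=\langle\langle A,B\rangle\rangle_{\omega\circ\tau_t}.$$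 Moreover, if $S$ is uniformly sizably $p$-clustering and $K\subset\mathbb R$ is compact, then for every $A\in\mathcal O$ the norms $\|\tau_t(A)\|_{\widehat{\mathcal H}_\omega}$ are bounded uniformly in $\omega\in S$, $t\in K$, and $\|(\tau_t(A))_{X_n^A}\|_{\widehat{\mathcal H}_\omega}\to\|\tau_t(A)\|_{\widehat{\mathcal H}_\omega}$ as $n\to\infty$ uniformly in $\omega\in S$, $t\in K$. -/

import Mathlib

open Filter Topology
open scoped ComplexConjugate

noncomputable section

namespace QuantumLattice

/-! ### The lattice and the concrete quantum spin system -/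

/-- The hypercubic lattice `ℤ^D`. -/
abbrev Site (D : ℕ) := Fin D → ℤ

/-- The graph distance `∑ i, |x i - y i|` on the lattice. -/
def siteDist {D : ℕ} (x y : Site D) : ℕ := ∑ i, (x i - y i).natAbs

/-- A classical configuration: a basis label in `Fin d` at every site. -/
abbrev Config (D d : ℕ) := Site D → Fin d

/-- The Hilbert space `ℓ²` over all configurations, on which the observables act. -/
abbrev Hilb (D d : ℕ) := lp (fun _ : Config D d => ℂ) 2

/-- The `C⋆`-algebra of bounded operators on `Hilb D d`. -/
abbrev Op (D d : ℕ) := Hilb D d →L[ℂ] Hilb D d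

theorem sum_restrict_le {C : Type*} (P : C → Prop) [DecidablePred P] (g : C → C)
    (hg : Set.InjOn g {c | P c}) (ψ : lp (fun _ : C => ℂ) 2) (s : Finset C) :
    ∑ c ∈ s, ‖(if P c then ψ (g c) else 0 : ℂ)‖ ^ (2 : ENNReal).toReal
      ≤ ‖ψ‖ ^ (2 : ENNReal).toReal := by
  classical
  have h2 : 0 < (2 : ENNReal).toReal := by norm_num
  calc ∑ c ∈ s, ‖(if P c then ψ (g c) else 0 : ℂ)‖ ^ (2 : ENNReal).toReal
      = ∑ c ∈ s.filter P, ‖ψ (g c)‖ ^ (2 : ENNReal).toReal := by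
        rw [Finset.sum_filter]
        refine Finset.sum_congr rfl fun c _ => ?_
        split_ifs <;> simp
    _ = ∑ c ∈ (s.filter P).image g, ‖ψ c‖ ^ (2 : ENNReal).toReal := by
        rw [Finset.sum_image]
        intro a ha b hb hab
        exact hg (by simpa using (Finset.mem_filter.1 ha).2)
          (by simpa using (Finset.mem_filter.1 hb).2) hab
    _ ≤ _ := lp.sum_rpow_le_norm_rpow h2 ψ _

/-- For a map `g` that is injective on `{c | P c}`, the operator on `ℓ²(C)` given by
`(T ψ) c = ψ (g c)` if `P c`, and `0` otherwise. -/
def partialPullback {C : Type*} (P : C → Prop) [DecidablePred P] (g : C → C)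
    (hg : Set.InjOn g {c | P c}) :
    lp (fun _ : C => ℂ) 2 →L[ℂ] lp (fun _ : C => ℂ) 2 :=
  LinearMap.mkContinuous
    { toFun := fun ψ => ⟨fun c => if P c then ψ (g c) else 0,
        memℓp_gen' (fun s => sum_restrict_le P g hg ψ s)⟩
      map_add' := by
        intro ψ φ
        ext c
        change (if P c then (ψ + φ) (g c) else 0) =
          (if P c then ψ (g c) else 0) + (if P c then φ (g c) else 0)
        by_cases h : P c <;> simp [h]
      map_smul' := by
        intro r ψ
        ext c
        by_cases h : P c <;> simp [h] } 1
    (by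
      intro ψ
      rw [one_mul]
      exact lp.norm_le_of_forall_sum_le (by norm_num) (norm_nonneg _)
        (fun s => sum_restrict_le P g hg ψ s))

theorem partialPullback_apply {C : Type*} (P : C → Prop) [DecidablePred P] (g : C → C)
    (hg : Set.InjOn g {c | P c}) (ψ : lp (fun _ : C => ℂ) 2) (c : C) :
    partialPullback P g hg ψ c = if P c then ψ (g c) else 0 := rfl

/-- The matrix unit `|i⟩⟨j|` acting on the tensor factor at the site `x`:
`(E ψ)(σ) = ψ (σ with x ↦ j)` if `σ x = i`, and `0` otherwise. -/
def matrixUnit {D d : ℕ} (x : Site D) (i j : Fin d) : Op D d :=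
  partialPullback (fun σ : Config D d => σ x = i) (fun σ => Function.update σ x j) (by
    intro σ hσ σ' hσ' h
    funext y
    by_cases hy : y = x
    · subst hy
      exact (show σ y = i from hσ).trans (show σ' y = i from hσ').symm
    · have := congrFun h y
      simpa [hy] using this)

/-- The unitary that translates configurations by `x`: `(U ψ)(σ) = ψ (σ (· + x))`. -/
def translationUnitary {D d : ℕ} (x : Site D) : Op D d :=
  partialPullback (fun _ : Config D d => True) (fun σ y => σ (y + x)) (by
    intro σ _ σ' _ h
    funext y
    have := congrFun h (y - x)
    simpa using this)

/-- The translation `ι_x`, which moves an observable by `x`. -/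
def translate {D d : ℕ} (x : Site D) (a : Op D d) : Op D d :=
  translationUnitary x * a * translationUnitary (-x)

/-- The algebra of observables supported in `X`, generated by the matrix units at the sites of
`X`. For finite `X` it is a copy of `⨂_{x ∈ X} M_d(ℂ)` with the operator norm, and
`localAlg Set.univ` is the algebra of all local observables, the inductive limit of these. -/
def localAlg {D d : ℕ} (X : Set (Site D)) : StarSubalgebra ℂ (Op D d) :=
  StarAlgebra.adjoin ℂ {a | ∃ x ∈ X, ∃ i j : Fin d, a = matrixUnit x i j}

/-- The support of a local observable: the smallest set of sites in which it is supported. -/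
def supp {D d : ℕ} (a : Op D d) : Set (Site D) :=
  ⋂₀ {X | X.Finite ∧ a ∈ localAlg X}

/-- The size of a local observable: the number of sites in its support. -/
def size {D d : ℕ} (a : Op D d) : ℕ := (supp a).ncard

/-- The distance between (the supports of) two local observables. -/
def obsDist {D d : ℕ} (a b : Op D d) : ℕ :=
  sInf {n | ∃ x ∈ supp a, ∃ y ∈ supp b, n = siteDist x y}

/-- The neighbourhood `⋃_{x ∈ B(n)} supp (ι_x a)` of the support of `a`. -/
def neighbourhood {D d : ℕ} (a : Op D d) (n : ℕ) : Set (Site D) :=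
  ⋃ x ∈ {x : Site D | siteDist x 0 ≤ n}, supp (translate x a)

/-- The normalized trace. The average of the diagonal entries over the configurations
that vanish off the finite set `Λ` is taken to the limit `Λ → ℤ^D`; for an observable supported in
`X` it is constant for `Λ ⊇ X`, equal to the normalized trace of the corresponding matrix. -/
def trace {D d : ℕ} [NeZero d] (a : Op D d) : ℂ := by
  classical
  exact limUnder (atTop : Filter (Finset (Site D))) (fun Λ =>
    ((d : ℂ) ^ Λ.card)⁻¹ * ∑ s : (Λ → Fin d),
      (fun σ : Config D d => a (lp.single 2 σ (1 : ℂ)) σ)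
        (fun x => if hx : x ∈ Λ then s ⟨x, hx⟩ else 0))

/-! ### Algebras of local observables -/

/-- A translation invariant unital `⋆`-subalgebra of the algebra of all local observables. (It is
then also invariant under the commutators with its local sequences.) -/
structure LocalObservables (D d : ℕ) where
  /-- the underlying algebra of operators -/
  alg : StarSubalgebra ℂ (Op D d)
  le_localAlg : alg ≤ localAlg Set.univ
  translate_mem : ∀ (x : Site D), ∀ a ∈ alg, translate x a ∈ alg

namespace LocalObservables

variable {D d : ℕ} (𝒪 : LocalObservables D d)

/-- The local observables. -/
abbrev Loc : Type := 𝒪.alg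

/-- The quasi-local `C⋆`-algebra: the norm completion of the local observables. -/
abbrev Quasi : Type := 𝒪.alg.topologicalClosure

/-- A local observable as an element of the quasi-local algebra. -/
def toQuasi (A : 𝒪.Loc) : 𝒪.Quasi := ⟨A, 𝒪.alg.le_topologicalClosure A.2⟩

/-- Translation of local observables. -/
def shift (x : Site D) (A : 𝒪.Loc) : 𝒪.Loc := ⟨translate x A, 𝒪.translate_mem x A A.2⟩

theorem translate_mem_closure (x : Site D) (a : 𝒪.Quasi) :
    translate x (a : Op D d) ∈ 𝒪.alg.topologicalClosure := by
  have hc : Continuous (translate x : Op D d → Op D d) := by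
    unfold translate
    fun_prop
  exact map_mem_closure hc a.2 (fun b hb => 𝒪.translate_mem x b hb)

/-- Translation of quasi-local observables. -/
def shiftQuasi (x : Site D) (a : 𝒪.Quasi) : 𝒪.Quasi :=
  ⟨translate x a, 𝒪.translate_mem_closure x a⟩

/-- The natural projection onto the observables of `𝒪` supported in `X`: the orthogonal projection
with respect to the Hilbert-Schmidt inner product `trace (a⋆ b)`. If `𝒪` is the algebra of all
local observables, this is the normalized partial trace over the complement of `X`. -/
def proj [NeZero d] (X : Set (Site D)) (a : 𝒪.Quasi) : 𝒪.Loc :=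
  Classical.epsilon fun b : 𝒪.Loc => (b : Op D d) ∈ localAlg X ∧
    ∀ c : 𝒪.Loc, (c : Op D d) ∈ localAlg X →
      trace (star (c : Op D d) * (b : Op D d)) = trace (star (c : Op D d) * (a : Op D d))

/-! ### States and clustering -/

/-- Linear functionals on the quasi-local algebra. -/
abbrev Functional : Type := 𝒪.Quasi →ₗ[ℂ] ℂ

variable {𝒪}

/-- `ω` is a state: positive and normalized. -/
def IsState (ω : 𝒪.Functional) : Prop :=
  ω 1 = 1 ∧ ∀ a : 𝒪.Quasi, 0 ≤ (ω (star a * a)).re ∧ (ω (star a * a)).im = 0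

/-- `ω` is translation invariant. -/
def IsTranslationInvariant (ω : 𝒪.Functional) : Prop :=
  ∀ (x : Site D) (a : 𝒪.Quasi), ω (𝒪.shiftQuasi x a) = ω a

/-- The clustering inequality with power `p`, constant `ν` and size exponent `a`. When `A` or `B`
is a multiple of the identity (empty support, distance `∞`) the left-hand side vanishes and there
is nothing to ask. -/
def ClusteringBound (p ν a : ℝ) (ω : 𝒪.Functional) : Prop :=
  ∃ f : ℕ → ℝ, (∀ k, 0 ≤ f k) ∧ (∀ k : ℕ, 0 < k → f k ≤ (k : ℝ) ^ (-p)) ∧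
    ∀ (ℓ : ℕ) (A B : 𝒪.Loc), size (A : Op D d) < ℓ → size (B : Op D d) < ℓ →
      (supp (A : Op D d)).Nonempty → (supp (B : Op D d)).Nonempty →
      ‖ω (𝒪.toQuasi (A * B)) - ω (𝒪.toQuasi A) * ω (𝒪.toQuasi B)‖
        ≤ ν * (ℓ : ℝ) ^ a * ‖A‖ * ‖B‖ * f (obsDist (A : Op D d) (B : Op D d))

/-- A family of translation invariant states that is uniformly sizably clustering with power `p`:
one pair `ν, a > 0` serves all its members. (Powers are meant to exceed the dimension; this is
not part of the definition.) -/
def UniformlySizablyClustering (p : ℝ) (S : Set 𝒪.Functional) : Prop :=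
  ∃ ν a : ℝ, 0 < ν ∧ 0 < a ∧
    ∀ ω ∈ S, IsState ω ∧ IsTranslationInvariant ω ∧ ClusteringBound p ν a ω

/-- `ω` is a sizably clustering state with power `p`. -/
def SizablyClustering (p : ℝ) (ω : 𝒪.Functional) : Prop :=
  UniformlySizablyClustering p {ω}

/-! ### The sesquilinear forms and the Hilbert space -/

/-- `⟨A, B⟩_ω = ∑_x (ω(ι_x(A)⋆ B) - ω(A⋆) ω(B))`. -/
def form (ω : 𝒪.Functional) (A B : 𝒪.Loc) : ℂ :=
  ∑' x : Site D, (ω (𝒪.toQuasi (star (𝒪.shift x A) * B))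
    - ω (𝒪.toQuasi (star A)) * ω (𝒪.toQuasi B))

/-- `⟨⟨A, B⟩⟩_ω = (⟨A, B⟩_ω + ⟨B⋆, A⋆⟩_ω) / 2`. -/
def symForm (ω : 𝒪.Functional) (A B : 𝒪.Loc) : ℂ :=
  (form ω A B + form ω (star B) (star A)) / 2

/-- `F` is a positive semi-definite sesquilinear form. -/
def IsPosSemidefForm (F : 𝒪.Loc → 𝒪.Loc → ℂ) : Prop :=
  (∀ A B, conj (F B A) = F A B) ∧ (∀ A, 0 ≤ (F A A).re) ∧
    (∀ A B C, F (A + B) C = F A C + F B C) ∧ ∀ A B (r : ℂ), F (r • A) B = conj r * F A B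

variable (𝒪) in
/-- The space of local observables, to be endowed with the (degenerate) inner product
`⟨⟨·,·⟩⟩_ω`. -/
def PreHilb (_ω : 𝒪.Functional) : Type := 𝒪.Loc

variable (ω : 𝒪.Functional)

instance : AddCommGroup (𝒪.PreHilb ω) := inferInstanceAs (AddCommGroup 𝒪.Loc)

instance : Module ℂ (𝒪.PreHilb ω) := inferInstanceAs (Module ℂ 𝒪.Loc)

open Classical in
/-- The inner product `⟨⟨·,·⟩⟩_ω`, which is positive semi-definite when `ω` is a clustering state
(for other functionals, if it is not, the zero form is used instead). -/
instance preHilbCore : PreInnerProductSpace.Core ℂ (𝒪.PreHilb ω) where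
  inner A B := if IsPosSemidefForm (symForm ω) then symForm ω A B else 0
  conj_inner_symm A B := by
    split_ifs with h
    · exact h.1 A B
    · simp
  re_inner_nonneg A := by
    split_ifs with h
    · exact h.2.1 A
    · simp
  add_left A B C := by
    split_ifs with h
    · exact h.2.2.1 A B C
    · simp
  smul_left A B r := by
    split_ifs with h
    · exact h.2.2.2 A B r
    · simp

instance : SeminormedAddCommGroup (𝒪.PreHilb ω) :=
  InnerProductSpace.Core.toSeminormedAddCommGroup (𝕜 := ℂ)

instance : InnerProductSpace ℂ (𝒪.PreHilb ω) := InnerProductSpace.ofCore (preHilbCore ω)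

variable (𝒪) in
/-- The Hilbert space `Ĥ_ω`: the Hausdorff completion of the local observables, that is, the
completion of their quotient by the null space of `⟨⟨·,·⟩⟩_ω`. -/
abbrev HilbertSpace (ω : 𝒪.Functional) : Type := UniformSpace.Completion (𝒪.PreHilb ω)

/-- The coset map from the local observables to `Ĥ_ω`. -/
def coset (A : 𝒪.Loc) : 𝒪.HilbertSpace ω := ((show 𝒪.PreHilb ω from A : 𝒪.PreHilb ω) :
  UniformSpace.Completion (𝒪.PreHilb ω))

/-! ### Time evolution -/

/-- The derivation `𝔏H(B) = ∑_x (ι_x(h) B - B ι_x(h))` of the local sequence with density `h`;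
only finitely many terms are nonzero. -/
def lieAction (h B : 𝒪.Loc) : 𝒪.Loc :=
  ∑ᶠ x : Site D, (𝒪.shift x h * B - B * 𝒪.shift x h)

/-- `τ` is the time evolution generated by the local Hamiltonian with density `h`: the strongly
continuous one-parameter group on the quasi-local algebra that for small times is given on local
observables by the power series of `exp (i t 𝔏H)`. -/
structure IsTimeEvolution (h : 𝒪.Loc) (τ : ℝ → 𝒪.Quasi →L[ℂ] 𝒪.Quasi) : Prop where
  zero : τ 0 = ContinuousLinearMap.id ℂ 𝒪.Quasi
  add : ∀ s t : ℝ, τ (s + t) = (τ s).comp (τ t)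
  continuous : ∀ a : 𝒪.Quasi, Continuous fun t => τ t a
  series : ∃ r : ℝ, 0 < r ∧ ∀ t : ℝ, |t| < r → ∀ A : 𝒪.Loc,
    HasSum (fun n : ℕ => ((Complex.I * (t : ℂ)) ^ n / (n.factorial : ℂ)) •
      𝒪.toQuasi ((lieAction h)^[n] A)) (τ t (𝒪.toQuasi A))

/-- The time-evolved functional `ω ∘ τ_t`. -/
def evolve (τ : ℝ → 𝒪.Quasi →L[ℂ] 𝒪.Quasi) (t : ℝ) : 𝒪.Functional :=
  ω ∘ₗ (τ t : 𝒪.Quasi →ₗ[ℂ] 𝒪.Quasi)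

/-- The truncation `(τ_t(A))_{X_n}` to the neighbourhood `X_n` of the support of `A`. -/
def truncation [NeZero d] (τ : ℝ → 𝒪.Quasi →L[ℂ] 𝒪.Quasi) (t : ℝ) (A : 𝒪.Loc) (n : ℕ) : 𝒪.Loc :=
  𝒪.proj (neighbourhood (A : Op D d) n) (τ t (𝒪.toQuasi A))

/-- `τ_t(A)` as an element of `Ĥ_ω`: the limit of its local truncations. -/
def evolvedVector [NeZero d] (τ : ℝ → 𝒪.Quasi →L[ℂ] 𝒪.Quasi) (t : ℝ) (A : 𝒪.Loc) :
    𝒪.HilbertSpace ω :=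
  limUnder atTop fun n => coset ω (truncation τ t A n)

end LocalObservables

end QuantumLattice

end

open QuantumLattice QuantumLattice.LocalObservables

/-!
The proof rests on a Lieb–Robinson bound, in the form that an evolved local observable `τ_t(A)` is
approximated by observables of `𝒪` in the `n`-neighbourhood of the support of `A`, with an error
that is exponentially small in `n`, polynomial in the number of sites of `A`, and uniform for
bounded times.

*Dynamics.* The nested commutators of a local observable with the Hamiltonian of a finite volume
grow like `n! C ^ n`, uniformly in the volume, since each new term has to meet the support reached
so far (`Interaction.norm_iterate_bracket_le`). For small times this gives the power series of the
evolution, and an exponentially small commutator with distant terms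
(`Interaction.norm_bracket_term_evol_le`). By the interaction picture (`norm_evol_sub_evol_le`), the
finite-volume evolutions then converge to a group of automorphisms, and
`IsThermodynamicLimit.exists_approx` holds first for small times and then, by doubling, for all
bounded times. The dynamics generated by `h` is unique because the series determines it on a dense
set for small times (`IsTimeEvolution.unique`); hence it is this limit, and it commutes with
translations.

*Clustering.* For an observable pair at distance `k`, replace `τ_t(A)` and `τ_t(B)` by their local
approximations of radius `n ≈ k ^ θ` with small `θ > 0`. The sizes grow by a factor of order
`k ^ (θ D)`, which costs an arbitrarily small power of `k` in the clustering bound of `ω`, while the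
error `exp (-μ n)` is smaller than any power of `k` (`exists_clusteringBound_evolve`).

*The form.* If `ω` is clustering with power `p > D`, the terms of the form of two observables
supported in a ball of radius `m` are bounded by a power of `m` times the summable function
`(1 + |x|) ^ (-p)` of the translation (`exists_norm_cov_shift_le`). So the form converges; it is
positive because it is the limit of the variances of the sums of translates over boxes, divided by
the volume (`re_tsum_nonneg_of_positive_type`). The norm of `Ĥ_ω` is bounded by the operator norm
times a power of the radius of the support (`exists_norm_coset_le`).

*Truncations.* The projection onto the observables of a finite set is contractive in the operator
norm (`SameProducts.norm_le`), so the truncations of `τ_t(A)` inherit the exponential error of the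
Lieb–Robinson approximations. Their increments are exponentially small in operator norm, which beats
the polynomial factors: the truncations converge in `Ĥ_ω` geometrically fast, uniformly in the state
and in bounded times (`exists_dist_evolvedVector_le`). The same estimate on each term of the sum over
translations allows the limit to be exchanged with this sum (`ExpApprox.tendsto_form`), which
identifies the form of the limits with the form of the evolved state.
-/

namespace QuantumLattice

/-! ### Dynamics generated by a bounded Hamiltonian -/

section BoundedDynamics

variable {𝔸 : Type*} [CStarAlgebra 𝔸]

/-- The one-parameter group `exp (i t H)`. -/
noncomputable def expI (H : 𝔸) (t : ℝ) : 𝔸 := NormedSpace.exp (t • (Complex.I • H))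

theorem expI_zero (H : 𝔸) : expI H 0 = 1 := by simp [expI]

theorem expI_add (H : 𝔸) (s t : ℝ) : expI H (s + t) = expI H s * expI H t := by
  let _ : NormedAlgebra ℚ 𝔸 := NormedAlgebra.restrictScalars ℚ ℂ 𝔸
  unfold expI
  rw [add_smul, NormedSpace.exp_add_of_commute]
  exact ((Commute.refl _).smul_left _).smul_right _

theorem expI_mul_neg (H : 𝔸) (t : ℝ) : expI H t * expI H (-t) = 1 := by
  rw [← expI_add, add_neg_cancel, expI_zero]

theorem expI_neg_mul (H : 𝔸) (t : ℝ) : expI H (-t) * expI H t = 1 := by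
  rw [← expI_add, neg_add_cancel, expI_zero]

theorem star_expI {H : 𝔸} (hH : IsSelfAdjoint H) (t : ℝ) : star (expI H t) = expI H (-t) := by
  unfold expI
  rw [NormedSpace.star_exp]
  congr 1
  simp [star_smul, hH.star_eq]

theorem expI_mem_unitary {H : 𝔸} (hH : IsSelfAdjoint H) (t : ℝ) : expI H t ∈ unitary 𝔸 := by
  rw [Unitary.mem_iff, star_expI hH]
  exact ⟨expI_neg_mul H t, expI_mul_neg H t⟩

theorem hasDerivAt_expI (H : 𝔸) (t : ℝ) :
    HasDerivAt (expI H) (expI H t * (Complex.I • H)) t :=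
  hasDerivAt_exp_smul_const (𝕂 := ℝ) (Complex.I • H) t

theorem hasDerivAt_expI' (H : 𝔸) (t : ℝ) :
    HasDerivAt (expI H) ((Complex.I • H) * expI H t) t :=
  hasDerivAt_exp_smul_const' (𝕂 := ℝ) (Complex.I • H) t

/-- The Heisenberg evolution `a ↦ exp (i t H) a exp (-i t H)`. -/
noncomputable def evol (H : 𝔸) (t : ℝ) (a : 𝔸) : 𝔸 := expI H t * a * expI H (-t)

theorem evol_zero_time (H a : 𝔸) : evol H 0 a = a := by simp [evol, expI_zero]

theorem evol_zero_ham (t : ℝ) (a : 𝔸) : evol 0 t a = a := by simp [evol, expI]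

theorem evol_add_time (H : 𝔸) (s t : ℝ) (a : 𝔸) : evol H (s + t) a = evol H s (evol H t a) := by
  unfold evol
  rw [neg_add_rev, expI_add, expI_add]
  simp only [mul_assoc]

theorem evol_neg_evol (H : 𝔸) (t : ℝ) (a : 𝔸) : evol H (-t) (evol H t a) = a := by
  rw [← evol_add_time, neg_add_cancel, evol_zero_time]

theorem evol_mul (H : 𝔸) (t : ℝ) (a b : 𝔸) : evol H t (a * b) = evol H t a * evol H t b := by
  unfold evol
  calc expI H t * (a * b) * expI H (-t)
      = expI H t * a * 1 * b * expI H (-t) := by simp only [mul_assoc, one_mul]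
    _ = _ := by rw [← expI_neg_mul H t]; simp only [mul_assoc]

theorem evol_add (H : 𝔸) (t : ℝ) (a b : 𝔸) : evol H t (a + b) = evol H t a + evol H t b := by
  simp [evol, mul_add, add_mul]

theorem evol_sub (H : 𝔸) (t : ℝ) (a b : 𝔸) : evol H t (a - b) = evol H t a - evol H t b := by
  simp [evol, mul_sub, sub_mul]

theorem evol_smul (H : 𝔸) (t : ℝ) (r : ℂ) (a : 𝔸) : evol H t (r • a) = r • evol H t a := by
  simp [evol]

theorem evol_one (H : 𝔸) (t : ℝ) : evol H t 1 = 1 := by simp [evol, expI_mul_neg]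

theorem evol_star {H : 𝔸} (hH : IsSelfAdjoint H) (t : ℝ) (a : 𝔸) :
    evol H t (star a) = star (evol H t a) := by
  simp [evol, star_expI hH, mul_assoc]

theorem norm_evol {H : 𝔸} (hH : IsSelfAdjoint H) (t : ℝ) (a : 𝔸) : ‖evol H t a‖ = ‖a‖ := by
  unfold evol
  rw [CStarRing.norm_mul_mem_unitary _ (expI_mem_unitary hH _),
    CStarRing.norm_mem_unitary_mul _ (expI_mem_unitary hH _)]

/-- The interaction-picture estimate: two Heisenberg evolutions differ by at most `|s|` times the
largest commutator of the difference of the Hamiltonians with the first evolution. -/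
theorem norm_evol_sub_evol_le {P Q : 𝔸} (hQ : IsSelfAdjoint Q) (a : 𝔸)
    {s C : ℝ} (hC : ∀ u, |u| ≤ |s| → ‖(P - Q) * evol P u a - evol P u a * (P - Q)‖ ≤ C) :
    ‖evol P s a - evol Q s a‖ ≤ C * |s| := by
  have hn : ∀ (K : 𝔸) (u : ℝ),
      HasDerivAt (fun u => expI K (-u)) (-(expI K (-u) * (Complex.I • K))) u := fun K u => by
    have := (hasDerivAt_expI K (-u)).scomp u (hasDerivAt_neg u)
    rwa [neg_one_smul] at this
  -- the interaction picture: the derivative of `u ↦ evol Q (-u) (evol P u a)`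
  have hd : ∀ u : ℝ, HasDerivAt (fun u => evol Q (-u) (evol P u a))
      (evol Q (-u) (Complex.I • ((P - Q) * evol P u a - evol P u a * (P - Q)))) u := by
    intro u
    have h1 := (hn Q u).mul (hasDerivAt_expI' P u)
    have h2 := (hn P u).mul (hasDerivAt_expI' Q u)
    have h3 := (h1.mul_const a).mul h2
    have he : (fun u => evol Q (-u) (evol P u a)) =
        ((fun u => expI Q (-u)) * expI P) * (fun _ => a) * ((fun u => expI P (-u)) * expI Q) := by
      funext u
      simp [evol, mul_assoc]
    rw [he]
    refine h3.congr_deriv ?_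
    simp only [evol, Pi.mul_apply, neg_neg, smul_sub, mul_sub, sub_mul, smul_mul_assoc,
      mul_smul_comm, mul_add, add_mul, mul_neg, neg_mul, mul_assoc]
    abel
  have hmv := (convex_Icc (-|s|) |s|).norm_image_sub_le_of_norm_hasDerivWithin_le (C := C)
    (f := fun u => evol Q (-u) (evol P u a)) (fun u _ => (hd u).hasDerivWithinAt)
    (fun u hu => by
      rw [norm_evol hQ, norm_smul, Complex.norm_I, one_mul]
      exact hC u (abs_le.2 hu))
    (x := 0) (y := s) (by simp) ⟨neg_abs_le s, le_abs_self s⟩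
  have h0 : evol P s a - evol Q s a
      = evol Q s (evol Q (-s) (evol P s a) - a) := by
    rw [evol_sub, ← evol_add_time, add_neg_cancel, evol_zero_time]
  rw [h0, norm_evol hQ]
  simpa [evol_zero_time] using hmv

/-- The commutator with `H`. -/
def bracket (H a : 𝔸) : 𝔸 := H * a - a * H

theorem bracket_sum {ι : Type*} (H : 𝔸) (s : Finset ι) (a : ι → 𝔸) :
    bracket H (∑ i ∈ s, a i) = ∑ i ∈ s, bracket H (a i) := by
  simp [bracket, Finset.mul_sum, Finset.sum_mul]

theorem sum_bracket {ι : Type*} (a : 𝔸) (s : Finset ι) (H : ι → 𝔸) :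
    bracket (∑ i ∈ s, H i) a = ∑ i ∈ s, bracket (H i) a := by
  simp [bracket, Finset.mul_sum, Finset.sum_mul]

theorem bracket_iterate_sum {ι : Type*} (H : 𝔸) (n : ℕ) (s : Finset ι) (a : ι → 𝔸) :
    (bracket H)^[n] (∑ i ∈ s, a i) = ∑ i ∈ s, (bracket H)^[n] (a i) := by
  induction n generalizing a with
  | zero => simp
  | succ n ih => simp only [Function.iterate_succ_apply, bracket_sum, ih]

theorem norm_bracket_le (H a : 𝔸) : ‖bracket H a‖ ≤ 2 * ‖H‖ * ‖a‖ := by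
  calc ‖bracket H a‖ ≤ ‖H * a‖ + ‖a * H‖ := norm_sub_le _ _
    _ ≤ ‖H‖ * ‖a‖ + ‖a‖ * ‖H‖ := add_le_add (norm_mul_le _ _) (norm_mul_le _ _)
    _ = _ := by ring

theorem bracket_eq_zero {H a : 𝔸} (h : Commute H a) : bracket H a = 0 := by
  simp [bracket, h.eq]

/-- The Heisenberg evolution is the exponential of the commutator with `i t H`, which is the sum of
the commuting operators of left multiplication by `i t H` and right multiplication by `-i t H`. -/
theorem hasSum_evol (H a : 𝔸) (t : ℝ) :
    HasSum (fun n : ℕ => ((Complex.I * (t : ℂ)) ^ n / (n.factorial : ℂ)) • (bracket H)^[n] a)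
      (evol H t a) := by
  let _ : NormedAlgebra ℚ (𝔸 →L[ℂ] 𝔸) := NormedAlgebra.restrictScalars ℚ ℂ _
  set c : 𝔸 := t • (Complex.I • H) with hc
  let Lm : 𝔸 →L[ℂ] 𝔸 := ContinuousLinearMap.mul ℂ 𝔸 c
  let Rm : 𝔸 →L[ℂ] 𝔸 := (ContinuousLinearMap.mul ℂ 𝔸).flip (-c)
  have hLR : Commute Lm Rm := by
    ext b
    simp [Lm, Rm, mul_assoc]
  have hL : ∀ b, NormedSpace.exp Lm b = NormedSpace.exp c * b := fun b => by
    have h1 := (NormedSpace.exp_series_hasSum_exp' (𝕂 := ℂ) Lm).mapL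
      (ContinuousLinearMap.apply ℂ 𝔸 b)
    have h2 := (NormedSpace.exp_series_hasSum_exp' (𝕂 := ℂ) c).mul_right b
    have : ∀ n, (Lm ^ n) b = c ^ n * b := fun n => by
      induction n with
      | zero => simp
      | succ n ih => rw [pow_succ', mul_apply_eq_comp, ih, pow_succ', mul_assoc]; rfl
    refine h1.unique ?_
    simpa [this] using h2
  have hR : ∀ b, NormedSpace.exp Rm b = b * NormedSpace.exp (-c) := fun b => by
    have h1 := (NormedSpace.exp_series_hasSum_exp' (𝕂 := ℂ) Rm).mapL
      (ContinuousLinearMap.apply ℂ 𝔸 b)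
    have h2 := (NormedSpace.exp_series_hasSum_exp' (𝕂 := ℂ) (-c)).mul_left b
    have : ∀ n, (Rm ^ n) b = b * (-c) ^ n := fun n => by
      induction n with
      | zero => simp
      | succ n ih => rw [pow_succ', mul_apply_eq_comp, ih, pow_succ, ← mul_assoc]; rfl
    refine h1.unique ?_
    simpa [this] using h2
  have hev : evol H t a = NormedSpace.exp (Lm + Rm) a := by
    rw [NormedSpace.exp_add_of_commute hLR, mul_apply_eq_comp, hR, hL, ← mul_assoc]
    simp [evol, expI, hc]
  rw [hev]
  have h1 := (NormedSpace.exp_series_hasSum_exp' (𝕂 := ℂ) (Lm + Rm)).mapL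
    (ContinuousLinearMap.apply ℂ 𝔸 a)
  have key : ∀ n, ((Lm + Rm) ^ n) a = (Complex.I * (t : ℂ)) ^ n • (bracket H)^[n] a := fun n => by
    induction n with
    | zero => simp
    | succ n ih =>
      rw [pow_succ', mul_apply_eq_comp, ih, Function.iterate_succ_apply', pow_succ',
        mul_smul, smul_comm _ ((Complex.I * (t : ℂ)) ^ n), map_smul]
      congr 1
      have : c = (Complex.I * (t : ℂ)) • H := by
        rw [hc, ← Complex.coe_smul t, smul_smul, mul_comm]
      simp [Lm, Rm, bracket, this, sub_eq_add_neg]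
  have e : ∀ n : ℕ, ((Complex.I * (t : ℂ)) ^ n / (n.factorial : ℂ)) • (bracket H)^[n] a
      = ContinuousLinearMap.apply ℂ 𝔸 a ((n.factorial : ℂ)⁻¹ • (Lm + Rm) ^ n) := fun n => by
    simp only [ContinuousLinearMap.apply_apply, smul_apply, key, smul_smul]
    rw [div_eq_inv_mul]
  simp only [e]
  exact h1

end BoundedDynamics

/-! ### Geometry of the lattice -/

section Lattice

variable {D : ℕ}

theorem siteDist_self (x : Site D) : siteDist x x = 0 := by simp [siteDist]

theorem siteDist_comm (x y : Site D) : siteDist x y = siteDist y x := by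
  unfold siteDist
  exact Finset.sum_congr rfl fun i _ => by rw [← Int.natAbs_neg, neg_sub]

theorem siteDist_triangle (x y z : Site D) : siteDist x z ≤ siteDist x y + siteDist y z := by
  unfold siteDist
  rw [← Finset.sum_add_distrib]
  exact Finset.sum_le_sum fun i _ => by omega

theorem siteDist_sub_zero (x y : Site D) : siteDist (x - y) 0 = siteDist x y := by
  simp [siteDist]

theorem siteDist_sub_left (x z : Site D) : siteDist (x - z) x = siteDist z 0 := by
  simp [siteDist]

theorem siteDist_add_left (x z : Site D) : siteDist (z + x) x = siteDist z 0 := by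
  simp [siteDist]

/-- The `ℓ¹`-ball of radius `n` around the origin. -/
noncomputable def ball (D n : ℕ) : Finset (Site D) :=
  (Fintype.piFinset fun _ => Finset.Icc (-(n : ℤ)) n).filter fun x => siteDist x 0 ≤ n

theorem mem_ball {n : ℕ} {x : Site D} : x ∈ ball D n ↔ siteDist x 0 ≤ n := by
  simp only [ball, Finset.mem_filter, Fintype.mem_piFinset, Finset.mem_Icc, and_iff_right_iff_imp]
  intro h i
  have : (x i - 0).natAbs ≤ siteDist x 0 :=
    Finset.single_le_sum (f := fun i => (x i - (0 : Site D) i).natAbs) (fun _ _ => Nat.zero_le _)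
      (Finset.mem_univ i)
  omega

theorem card_ball_le (n : ℕ) : (ball D n).card ≤ (2 * n + 1) ^ D := by
  refine (Finset.card_filter_le _ _).trans ?_
  rw [Fintype.card_piFinset]
  simp only [Int.card_Icc, Finset.prod_const, Finset.card_univ, Fintype.card_fin]
  exact Nat.pow_le_pow_left (by omega) D

/-- The set of sites at distance at most `n` from `Y`. -/
noncomputable def nbhd (n : ℕ) (Y : Finset (Site D)) : Finset (Site D) :=
  Finset.image₂ (fun x y => x + y) Y (ball D n)

theorem mem_nbhd {n : ℕ} {Y : Finset (Site D)} {x : Site D} :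
    x ∈ nbhd n Y ↔ ∃ y ∈ Y, siteDist x y ≤ n := by
  simp only [nbhd, Finset.mem_image₂, mem_ball]
  constructor
  · rintro ⟨y, hy, z, hz, rfl⟩
    exact ⟨y, hy, by rwa [add_comm, siteDist_add_left]⟩
  · rintro ⟨y, hy, h⟩
    exact ⟨y, hy, x - y, by rwa [siteDist_sub_zero], by abel⟩

theorem card_nbhd_le (n : ℕ) (Y : Finset (Site D)) :
    (nbhd n Y).card ≤ Y.card * (2 * n + 1) ^ D :=
  (Finset.card_image₂_le _ _ _).trans (Nat.mul_le_mul_left _ (card_ball_le n))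

theorem subset_nbhd (n : ℕ) (Y : Finset (Site D)) : Y ⊆ nbhd n Y := fun y hy =>
  mem_nbhd.2 ⟨y, hy, by simp [siteDist_self]⟩

theorem nbhd_mono {m n : ℕ} (h : m ≤ n) (Y : Finset (Site D)) : nbhd m Y ⊆ nbhd n Y := fun x hx => by
  obtain ⟨y, hy, hxy⟩ := mem_nbhd.1 hx
  exact mem_nbhd.2 ⟨y, hy, hxy.trans h⟩

theorem nbhd_nbhd_subset (m n : ℕ) (Y : Finset (Site D)) : nbhd m (nbhd n Y) ⊆ nbhd (m + n) Y := by
  intro x hx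
  obtain ⟨y, hy, hxy⟩ := mem_nbhd.1 hx
  obtain ⟨z, hz, hyz⟩ := mem_nbhd.1 hy
  exact mem_nbhd.2 ⟨z, hz, (siteDist_triangle x y z).trans (by omega)⟩

/-- The integer points of `ℝ^D`, as the `ℤ`-span of the standard basis, are a lattice of rank `D`;
hence the powers of the distance are summable below the exponent `-D`. -/
theorem summable_siteDist_rpow {p : ℝ} (hp : (D : ℝ) < p) :
    Summable fun x : Site D => (1 + (siteDist x 0 : ℝ)) ^ (-p) := by
  have hp0 : 0 < p := (Nat.cast_nonneg D).trans_lt hp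
  rcases Nat.eq_zero_or_pos D with rfl | hD
  · exact Summable.of_finite
  let b := Pi.basisFun ℝ (Fin D)
  let L : Submodule ℤ (Fin D → ℝ) := Submodule.span ℤ (Set.range b)
  have hrank : Module.finrank ℤ L = D := by
    rw [ZLattice.rank ℝ L]; simp
  have h1 := ZLattice.summable_norm_rpow L (-p) (by rw [hrank]; linarith)
  let e : Site D → L := fun x => ⟨fun i => (x i : ℝ), by
    rw [b.mem_span_iff_repr_mem ℤ]
    intro i
    exact ⟨x i, by simp [b]⟩⟩
  have he : Function.Injective e := by
    intro x y hxy
    funext i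
    have : (x i : ℝ) = y i := congrFun (congrArg Subtype.val hxy) i
    exact_mod_cast this
  have h2 := h1.comp_injective he
  rw [← (Set.finite_singleton (0 : Site D)).summable_compl_iff]
  rw [← (Set.finite_singleton (0 : Site D)).summable_compl_iff] at h2
  refine h2.of_nonneg_of_le (fun x => by simp only [Function.comp]; positivity) fun ⟨x, hx⟩ => ?_
  have hn : ‖e x‖ ≤ siteDist x 0 := by
    change ‖(fun i => (x i : ℝ))‖ ≤ _
    refine (pi_norm_le_iff_of_nonneg (Nat.cast_nonneg _)).2 fun i => ?_
    have : (x i - 0).natAbs ≤ siteDist x 0 :=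
      Finset.single_le_sum (f := fun i => (x i - (0 : Site D) i).natAbs)
        (fun _ _ => Nat.zero_le _) (Finset.mem_univ i)
    rw [sub_zero] at this
    calc ‖(x i : ℝ)‖ = ((x i).natAbs : ℝ) := by
          rw [Real.norm_eq_abs, Nat.cast_natAbs, Int.cast_abs]
      _ ≤ _ := by exact_mod_cast this
  have hpos : 0 < ‖e x‖ := by
    rw [norm_pos_iff]
    intro h0
    apply hx
    apply he
    rw [h0]
    ext i
    simp [e]
  exact Real.rpow_le_rpow_of_nonpos hpos (by linarith) (by linarith)

theorem exists_rpow_mul_exp_le (s : ℝ) {μ : ℝ} (hμ : 0 < μ) :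
    ∃ C : ℝ, 0 ≤ C ∧ ∀ k : ℕ, (1 + (k : ℝ)) ^ s * Real.exp (-(μ * k)) ≤ C := by
  have h1 : Tendsto (fun x : ℝ => x ^ s * Real.exp (-μ * x)) atTop (𝓝 0) :=
    tendsto_rpow_mul_exp_neg_mul_atTop_nhds_zero _ _ hμ
  have h2 := (h1.comp (tendsto_natCast_atTop_atTop.comp (tendsto_add_atTop_nat 1))).mul_const
    (Real.exp μ)
  obtain ⟨C, hC⟩ := h2.bddAbove_range
  have h3 : ∀ k : ℕ, (1 + (k : ℝ)) ^ s * Real.exp (-(μ * k)) ≤ C := fun k => by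
    refine le_trans (le_of_eq ?_) (hC ⟨k, rfl⟩)
    simp only [Function.comp]
    rw [mul_assoc, ← Real.exp_add]
    push_cast
    congr 2 <;> ring
  exact ⟨C, (by positivity : (0 : ℝ) ≤ _).trans (h3 0), h3⟩

theorem summable_exp_siteDist {μ : ℝ} (hμ : 0 < μ) :
    Summable fun x : Site D => Real.exp (-(μ * siteDist x 0)) := by
  have hs := summable_siteDist_rpow (D := D) (p := D + 1) (by linarith)
  obtain ⟨C, -, hC⟩ := exists_rpow_mul_exp_le ((D : ℝ) + 1) hμ
  refine (hs.mul_left C).of_nonneg_of_le (fun x => (Real.exp_pos _).le) fun x => ?_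
  have hpos : (0 : ℝ) < 1 + (siteDist x 0 : ℝ) := by positivity
  rw [Real.rpow_neg hpos.le, ← div_eq_mul_inv, le_div_iff₀ (Real.rpow_pos_of_pos hpos _)]
  rw [mul_comm]
  exact hC _

theorem summable_exp_siteDist_sub {μ : ℝ} (hμ : 0 < μ) (y : Site D) :
    Summable fun x : Site D => Real.exp (-(μ * siteDist x y)) := by
  simp_rw [← siteDist_sub_zero _ y]
  exact (summable_exp_siteDist hμ).comp_injective (sub_left_injective (b := y))

theorem tsum_exp_siteDist_sub (μ : ℝ) (y : Site D) :
    ∑' x : Site D, Real.exp (-(μ * siteDist x y)) = ∑' x : Site D, Real.exp (-(μ * siteDist x 0)) := by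
  simp_rw [← siteDist_sub_zero _ y]
  exact (Equiv.subRight y).tsum_eq fun x => Real.exp (-(μ * siteDist x 0))

end Lattice

/-! ### Finite-volume dynamics of a short-range interaction -/

theorem sum_image₂_le {α β γ : Type*} [DecidableEq γ] (f : α → β → γ) (s : Finset α)
    (t : Finset β) {g : γ → ℝ} (hg : ∀ c, 0 ≤ g c) :
    ∑ c ∈ Finset.image₂ f s t, g c ≤ ∑ a ∈ s, ∑ b ∈ t, g (f a b) := by
  rw [← Finset.sum_product', Finset.image₂]
  rw [← Finset.sum_fiberwise_of_maps_to (s := s ×ˢ t) (g := Function.uncurry f)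
    (t := Finset.image (Function.uncurry f) (s ×ˢ t))
    (fun x hx => Finset.mem_image_of_mem _ hx)]
  refine Finset.sum_le_sum fun c hc => ?_
  obtain ⟨x, hx, rfl⟩ := Finset.mem_image.1 hc
  exact Finset.single_le_sum (f := fun x : α × β => g (f x.1 x.2)) (fun _ _ => hg _)
    (Finset.mem_filter.2 ⟨hx, rfl⟩)

/-- A net of local subalgebras of a `C⋆`-algebra, indexed by sets of sites, in which observables
of disjoint sets commute. -/
structure LocalNet (D : ℕ) (𝔸 : Type*) [CStarAlgebra 𝔸] where
  /-- the observables supported in a set of sites -/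
  loc : Set (Site D) → StarSubalgebra ℂ 𝔸
  mono : ∀ {X Y}, X ⊆ Y → loc X ≤ loc Y
  commute : ∀ {X Y}, Disjoint X Y → ∀ a ∈ loc X, ∀ b ∈ loc Y, Commute a b
  closed : ∀ X : Finset (Site D), IsClosed (loc X : Set 𝔸)
  dense : ∀ (a : 𝔸), ∀ ε > 0, ∃ X : Finset (Site D), ∃ b ∈ loc X, ‖a - b‖ < ε

/-- A uniformly bounded interaction of finite range on a local net: a self-adjoint term at
each site `x`, supported in the translate by `x` of a fixed finite set. -/
structure Interaction {D : ℕ} {𝔸 : Type*} [CStarAlgebra 𝔸] (N : LocalNet D 𝔸) where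
  /-- the terms of the Hamiltonian -/
  term : Site D → 𝔸
  /-- the shape of their supports -/
  shape : Finset (Site D)
  /-- the range -/
  range : ℕ
  /-- a bound on the norms of the terms -/
  bound : ℝ
  mem_loc : ∀ x, term x ∈ N.loc ↑(shape.image (· + x))
  shape_le : ∀ z ∈ shape, siteDist z 0 ≤ range
  selfAdjoint : ∀ x, IsSelfAdjoint (term x)
  norm_le : ∀ x, ‖term x‖ ≤ bound

namespace Interaction

variable {D : ℕ} {𝔸 : Type*} [CStarAlgebra 𝔸] {N : LocalNet D 𝔸} (Φ : Interaction N)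

/-- The Hamiltonian of the finite volume `Λ`. -/
def ham (Λ : Finset (Site D)) : 𝔸 := ∑ x ∈ Λ, Φ.term x

theorem isSelfAdjoint_ham (Λ : Finset (Site D)) : IsSelfAdjoint (Φ.ham Λ) :=
  isSelfAdjoint_sum _ fun x _ => Φ.selfAdjoint x

theorem bound_nonneg : 0 ≤ Φ.bound := (norm_nonneg _).trans (Φ.norm_le 0)

/-- The positions at which the term of the interaction meets `Y`. -/
def touch (Y : Finset (Site D)) : Finset (Site D) :=
  Finset.image₂ (fun y z => y - z) Y Φ.shape

theorem commute_of_notMem_touch {Y : Finset (Site D)} {a : 𝔸} (ha : a ∈ N.loc Y) {x : Site D}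
    (hx : x ∉ Φ.touch Y) : Commute (Φ.term x) a := by
  refine N.commute ?_ _ (Φ.mem_loc x) _ ha
  rw [Finset.disjoint_coe, Finset.disjoint_left]
  intro v hv hvY
  obtain ⟨z, hz, rfl⟩ := Finset.mem_image.1 hv
  exact hx (Finset.mem_image₂.2 ⟨z + x, hvY, z, hz, by abel⟩)

theorem bracket_ham {Y : Finset (Site D)} {a : 𝔸} (ha : a ∈ N.loc Y) (Λ : Finset (Site D)) :
    bracket (Φ.ham Λ) a = ∑ x ∈ Λ ∩ Φ.touch Y, bracket (Φ.term x) a := by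
  rw [ham, sum_bracket]
  symm
  refine Finset.sum_subset Finset.inter_subset_left fun x hx hx' => ?_
  exact bracket_eq_zero (Φ.commute_of_notMem_touch ha fun h => hx' (Finset.mem_inter.2 ⟨hx, h⟩))

theorem bracket_term_mem {Y : Finset (Site D)} {a : 𝔸} (ha : a ∈ N.loc Y) {x : Site D} :
    bracket (Φ.term x) a ∈ N.loc ↑(Y ∪ Φ.shape.image (· + x)) := by
  have h1 : Φ.term x ∈ N.loc ↑(Y ∪ Φ.shape.image (· + x)) :=
    N.mono (by exact_mod_cast Finset.subset_union_right) (Φ.mem_loc x)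
  have h2 : a ∈ N.loc ↑(Y ∪ Φ.shape.image (· + x)) :=
    N.mono (by exact_mod_cast Finset.subset_union_left) ha
  exact sub_mem (mul_mem h1 h2) (mul_mem h2 h1)

theorem union_shape_subset {Y : Finset (Site D)} {x : Site D} (hx : x ∈ Φ.touch Y) :
    Y ∪ Φ.shape.image (· + x) ⊆ nbhd (2 * Φ.range) Y := by
  refine Finset.union_subset (subset_nbhd _ _) fun v hv => ?_
  obtain ⟨z, hz, rfl⟩ := Finset.mem_image.1 hv
  obtain ⟨y, hy, z', hz', rfl⟩ := Finset.mem_image₂.1 hx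
  refine mem_nbhd.2 ⟨y, hy, ?_⟩
  calc siteDist (z + (y - z')) y ≤ siteDist (z + (y - z')) (y - z') + siteDist (y - z') y :=
        siteDist_triangle _ _ _
    _ ≤ Φ.range + Φ.range := by
        rw [siteDist_add_left, siteDist_sub_left]
        exact add_le_add (Φ.shape_le _ hz) (Φ.shape_le _ hz')
    _ = 2 * Φ.range := by ring

theorem bracket_ham_mem {Y : Finset (Site D)} {a : 𝔸} (ha : a ∈ N.loc Y) (Λ : Finset (Site D)) :
    bracket (Φ.ham Λ) a ∈ N.loc ↑(nbhd (2 * Φ.range) Y) := by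
  rw [Φ.bracket_ham ha]
  refine sum_mem fun x hx => N.mono ?_ (Φ.bracket_term_mem ha)
  exact_mod_cast Φ.union_shape_subset (Finset.mem_inter.1 hx).2

theorem iterate_bracket_mem (n : ℕ) {Y : Finset (Site D)} {a : 𝔸} (ha : a ∈ N.loc Y)
    (Λ : Finset (Site D)) :
    (bracket (Φ.ham Λ))^[n] a ∈ N.loc ↑(nbhd (2 * Φ.range * n) Y) := by
  induction n with
  | zero => exact N.mono (by exact_mod_cast subset_nbhd _ _) ha
  | succ n ih =>
    rw [Function.iterate_succ_apply']
    refine N.mono ?_ (Φ.bracket_ham_mem ih Λ)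
    have := nbhd_nbhd_subset (2 * Φ.range) (2 * Φ.range * n) Y
    rw [show 2 * Φ.range * (n + 1) = 2 * Φ.range + 2 * Φ.range * n by ring]
    exact_mod_cast this

/-- A positive bound on the number of sites of a term. -/
def width : ℕ := Φ.shape.card + 1

/-- Nested commutators: at each step the next term has to meet the support reached so far, which
grows by at most `Φ.width` sites. -/
theorem norm_iterate_bracket_le_prod (Λ : Finset (Site D)) (n : ℕ) :
    ∀ (m : ℕ) (Y : Finset (Site D)) (a : 𝔸), Y.card ≤ m → a ∈ N.loc Y →
      ‖(bracket (Φ.ham Λ))^[n] a‖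
        ≤ (2 * Φ.bound * Φ.width) ^ n * (∏ k ∈ Finset.range n, ((m : ℝ) + k * Φ.width)) * ‖a‖ := by
  have hb := Φ.bound_nonneg
  induction n with
  | zero => intro m Y a _ _; simp
  | succ n ih =>
    intro m Y a hm ha
    rw [Function.iterate_succ_apply, Φ.bracket_ham ha, bracket_iterate_sum]
    set P : ℝ := ∏ k ∈ Finset.range n, (((m + Φ.width : ℕ) : ℝ) + k * Φ.width) with hP
    have hP0 : 0 ≤ P := Finset.prod_nonneg fun k _ => by positivity
    have hterm : ∀ x ∈ Λ ∩ Φ.touch Y, ‖(bracket (Φ.ham Λ))^[n] (bracket (Φ.term x) a)‖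
        ≤ (2 * Φ.bound * Φ.width) ^ n * P * (2 * Φ.bound * ‖a‖) := by
      intro x hx
      refine (ih (m + Φ.width) _ _ ?_ (Φ.bracket_term_mem ha)).trans ?_
      · refine (Finset.card_union_le _ _).trans (add_le_add hm ?_)
        exact Finset.card_image_le.trans (Nat.le_succ _)
      · gcongr
        exact (norm_bracket_le _ _).trans (by gcongr; exact Φ.norm_le x)
    have hcard : ((Λ ∩ Φ.touch Y).card : ℝ) ≤ m * Φ.width := by
      have : (Λ ∩ Φ.touch Y).card ≤ m * Φ.width :=
        (Finset.card_le_card Finset.inter_subset_right).trans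
          ((Finset.card_image₂_le _ _ _).trans (Nat.mul_le_mul hm (Nat.le_succ _)))
      exact_mod_cast this
    calc _ ≤ ∑ x ∈ Λ ∩ Φ.touch Y, ‖(bracket (Φ.ham Λ))^[n] (bracket (Φ.term x) a)‖ :=
          norm_sum_le _ _
      _ ≤ (Λ ∩ Φ.touch Y).card • ((2 * Φ.bound * Φ.width) ^ n * P * (2 * Φ.bound * ‖a‖)) :=
          Finset.sum_le_card_nsmul _ _ _ hterm
      _ ≤ (m * Φ.width) * ((2 * Φ.bound * Φ.width) ^ n * P * (2 * Φ.bound * ‖a‖)) := by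
          rw [nsmul_eq_mul]
          gcongr
      _ = _ := by
          rw [Finset.prod_range_succ']
          have : ∏ k ∈ Finset.range n, ((m : ℝ) + ((k + 1 : ℕ) : ℝ) * Φ.width) = P := by
            rw [hP]
            refine Finset.prod_congr rfl fun k _ => ?_
            push_cast; ring
          rw [this]
          push_cast
          ring

/-- The growth rate of the nested commutators. -/
noncomputable def rate : ℝ := 4 * Φ.bound * Φ.width ^ 2

theorem rate_nonneg : 0 ≤ Φ.rate := by
  have := Φ.bound_nonneg
  unfold rate; positivity

/-- The product `m (m + w) ⋯ (m + (n - 1) w)` of the numbers of available terms is at most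
`w ^ n n! (m + n choose n)`: the factorial is compensated in the power series of the evolution. -/
theorem norm_iterate_bracket_le (Λ : Finset (Site D)) (n : ℕ) {Y : Finset (Site D)} {m : ℕ}
    (hm : Y.card ≤ m) {a : 𝔸} (ha : a ∈ N.loc Y) :
    ‖(bracket (Φ.ham Λ))^[n] a‖ ≤ n.factorial * 2 ^ m * Φ.rate ^ n * ‖a‖ := by
  have hb := Φ.bound_nonneg
  refine (Φ.norm_iterate_bracket_le_prod Λ n m Y a hm ha).trans ?_
  have hw : (1 : ℝ) ≤ Φ.width := by
    have : 1 ≤ Φ.width := Nat.succ_le_succ (Nat.zero_le _)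
    exact_mod_cast this
  have h1 : ∏ k ∈ Finset.range n, ((m : ℝ) + k * Φ.width)
      ≤ Φ.width ^ n * ((m + 1).ascFactorial n : ℝ) := by
    rw [Nat.ascFactorial_eq_prod_range]
    push_cast
    rw [← Finset.card_range n, ← Finset.prod_const, Finset.card_range, ← Finset.prod_mul_distrib]
    refine Finset.prod_le_prod (fun k _ => by positivity) fun k _ => ?_
    have : (0 : ℝ) ≤ m * (Φ.width - 1) := mul_nonneg (Nat.cast_nonneg _) (by linarith)
    nlinarith
  have h2 : ((m + 1).ascFactorial n : ℝ) ≤ n.factorial * 2 ^ (m + n) := by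
    rw [Nat.ascFactorial_eq_factorial_mul_choose]
    push_cast
    gcongr
    exact_mod_cast Nat.choose_le_two_pow (m + n) n
  calc (2 * Φ.bound * Φ.width) ^ n * (∏ k ∈ Finset.range n, ((m : ℝ) + k * Φ.width)) * ‖a‖
      ≤ (2 * Φ.bound * Φ.width) ^ n * (Φ.width ^ n * (n.factorial * 2 ^ (m + n))) * ‖a‖ := by
        gcongr
        exact h1.trans (by gcongr)
    _ = _ := by
        unfold rate
        rw [show (4 * Φ.bound * (Φ.width : ℝ) ^ 2) = 2 * Φ.bound * Φ.width * (Φ.width * 2) by ring]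
        simp only [mul_pow, pow_add]
        ring

end Interaction

/-! ### Short-time Lieb–Robinson bounds -/

namespace Interaction

variable {D : ℕ} {𝔸 : Type*} [CStarAlgebra 𝔸] {N : LocalNet D 𝔸} (Φ : Interaction N)

/-- A time up to which the power series of the evolution converges, with enough room to extract
exponential decay in the distance. -/
noncomputable def time : ℝ := (2 * (Φ.rate + 1) * Real.exp (2 * Φ.range))⁻¹

theorem time_pos : 0 < Φ.time := by
  have := Φ.rate_nonneg
  unfold time; positivity

theorem time_mul_le : Φ.time * Φ.rate * Real.exp (2 * Φ.range) ≤ 1 / 2 := by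
  have h := Φ.rate_nonneg
  have he := Real.exp_pos (2 * (Φ.range : ℝ))
  unfold time
  rw [inv_mul_eq_div, div_mul_eq_mul_div, div_le_iff₀ (by positivity)]
  nlinarith

theorem time_mul_rate_le : Φ.time * Φ.rate ≤ 1 / 2 := by
  refine le_trans ?_ Φ.time_mul_le
  have : (1 : ℝ) ≤ Real.exp (2 * Φ.range) := Real.one_le_exp (by positivity)
  exact le_mul_of_one_le_right (mul_nonneg Φ.time_pos.le Φ.rate_nonneg) this

/-- The terms of the power series of the evolution, uniformly in the volume. -/
theorem norm_series_term_le (Λ : Finset (Site D)) (n : ℕ) {Y : Finset (Site D)} {m : ℕ}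
    (hm : Y.card ≤ m) {a : 𝔸} (ha : a ∈ N.loc Y) {u : ℝ} (hu : |u| ≤ Φ.time) :
    ‖((Complex.I * (u : ℂ)) ^ n / (n.factorial : ℂ)) • (bracket (Φ.ham Λ))^[n] a‖
      ≤ 2 ^ m * ‖a‖ * (Φ.time * Φ.rate) ^ n := by
  have hr := Φ.rate_nonneg
  rw [norm_smul, norm_div, norm_pow, norm_mul, Complex.norm_I, one_mul, Complex.norm_real,
    Real.norm_eq_abs, Complex.norm_natCast]
  have hf : (0 : ℝ) < n.factorial := by exact_mod_cast n.factorial_pos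
  calc |u| ^ n / n.factorial * ‖(bracket (Φ.ham Λ))^[n] a‖
      ≤ Φ.time ^ n / n.factorial * (n.factorial * 2 ^ m * Φ.rate ^ n * ‖a‖) := by
        have := Φ.time_pos
        gcongr
        exact Φ.norm_iterate_bracket_le Λ n hm ha
    _ = _ := by
        rw [mul_pow]
        field_simp

/-- The `n`-th nested commutator of the term at `w` moves its support by at most `2 n` times the
range, so it only contributes to the commutator with the term at `x` once `n` is comparable to the
distance. -/
theorem norm_bracket_term_evol_term_le :
    ∃ C : ℝ, 0 ≤ C ∧ ∀ (Λ : Finset (Site D)) (x w : Site D) (u : ℝ), |u| ≤ Φ.time →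
      ‖bracket (Φ.term x) (evol (Φ.ham Λ) u (Φ.term w))‖
        ≤ C * Real.exp (-(siteDist x w : ℝ)) := by
  have hb := Φ.bound_nonneg
  have hr := Φ.rate_nonneg
  have ht := Φ.time_pos.le
  set C₀ : ℝ := 2 * Φ.bound * (2 ^ Φ.width * Φ.bound) * Real.exp (2 * Φ.range) with hC₀
  refine ⟨C₀ * 2, by positivity, fun Λ x w u hu => ?_⟩
  have hs := hasSum_evol (Φ.ham Λ) (Φ.term w) u
  have hs2 := (hs.mul_left (Φ.term x)).sub (hs.mul_right (Φ.term x))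
  have hg : HasSum (fun n : ℕ => C₀ * Real.exp (-(siteDist x w : ℝ)) * (1 / 2 : ℝ) ^ n)
      (C₀ * Real.exp (-(siteDist x w : ℝ)) * 2) := hasSum_geometric_two.mul_left _
  refine (hs2.norm_le_of_bounded hg fun n => ?_).trans (le_of_eq (by ring))
  change ‖bracket (Φ.term x) _‖ ≤ _
  have hcard : (Φ.shape.image (· + w)).card ≤ Φ.width :=
    Finset.card_image_le.trans (Nat.le_succ _)
  have hmem := Φ.iterate_bracket_mem n (Φ.mem_loc w) Λ
  by_cases hd : siteDist x w ≤ 2 * Φ.range * n + 2 * Φ.range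
  · have hexp : (1 : ℝ) ≤ Real.exp (2 * Φ.range) * Real.exp (-(siteDist x w : ℝ)) *
        Real.exp (2 * Φ.range) ^ n := by
      rw [← Real.exp_add, ← Real.exp_nat_mul, ← Real.exp_add]
      apply Real.one_le_exp
      have : (siteDist x w : ℝ) ≤ 2 * Φ.range * n + 2 * Φ.range := by exact_mod_cast hd
      nlinarith
    calc _ ≤ 2 * Φ.bound * (2 ^ Φ.width * Φ.bound * (Φ.time * Φ.rate) ^ n) := by
          refine (norm_bracket_le _ _).trans ?_
          gcongr
          · exact Φ.norm_le x
          · refine (Φ.norm_series_term_le Λ n hcard (Φ.mem_loc w) hu).trans ?_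
            gcongr
            exact Φ.norm_le w
      _ ≤ 2 * Φ.bound * (2 ^ Φ.width * Φ.bound * (Φ.time * Φ.rate) ^ n) *
            (Real.exp (2 * Φ.range) * Real.exp (-(siteDist x w : ℝ)) *
              Real.exp (2 * Φ.range) ^ n) := le_mul_of_one_le_right (by positivity) hexp
      _ = C₀ * Real.exp (-(siteDist x w : ℝ)) *
            (Φ.time * Φ.rate * Real.exp (2 * Φ.range)) ^ n := by
          rw [hC₀, mul_pow (Φ.time * Φ.rate)]; ring
      _ ≤ _ := by
          gcongr
          exact Φ.time_mul_le
  -- for small `n` the nested commutator is still supported away from the term at `x`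
  · have h0 : Commute (Φ.term x)
        (((Complex.I * (u : ℂ)) ^ n / (n.factorial : ℂ)) • (bracket (Φ.ham Λ))^[n] (Φ.term w)) := by
      refine (N.commute ?_ _ (Φ.mem_loc x) _ hmem).smul_right _
      rw [Finset.disjoint_coe, Finset.disjoint_left]
      intro v hv hv'
      obtain ⟨z, hz, rfl⟩ := Finset.mem_image.1 hv
      obtain ⟨y, hy, hzy⟩ := mem_nbhd.1 hv'
      obtain ⟨z', hz', rfl⟩ := Finset.mem_image.1 hy
      have h1 := siteDist_triangle x (z + x) w
      have h2 := siteDist_triangle (z + x) (z' + w) w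
      rw [siteDist_comm x (z + x), siteDist_add_left] at h1
      rw [siteDist_add_left] at h2
      have h3 := Φ.shape_le z hz
      have h4 := Φ.shape_le z' hz'
      omega
    rw [bracket_eq_zero h0, norm_zero]
    positivity

/-- The evolution in a commutator can be moved to the other argument. -/
theorem bracket_evol (H : 𝔸) (t : ℝ) (a b : 𝔸) :
    bracket a (evol H t b) = evol H t (bracket (evol H (-t) a) b) := by
  have : a = evol H t (evol H (-t) a) := by
    rw [← evol_add_time, add_neg_cancel, evol_zero_time]
  rw [bracket, bracket, evol_sub, evol_mul, evol_mul, ← this]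

/-- The Lieb–Robinson bound for small times. Linearity in the number of sites of `a` comes from the
interaction picture: dropping from the Hamiltonian the terms that meet the support of `a` leaves
an evolution that fixes `a`. -/
theorem norm_bracket_term_evol_le :
    ∃ C : ℝ, 0 ≤ C ∧ ∀ (Λ Y : Finset (Site D)) (x : Site D) (u : ℝ), |u| ≤ Φ.time →
      ∀ a ∈ N.loc Y, ‖bracket (Φ.term x) (evol (Φ.ham Λ) u a)‖
        ≤ C * ‖a‖ * ∑ y ∈ Y, Real.exp (-(siteDist x y : ℝ)) := by
  have hb := Φ.bound_nonneg
  have ht := Φ.time_pos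
  obtain ⟨C, hC0, hC⟩ := Φ.norm_bracket_term_evol_term_le
  set C₁ : ℝ := 2 * Φ.bound * Real.exp Φ.range with hC₁
  set C₂ : ℝ := 2 * (C * (Φ.width * Real.exp Φ.range) * Φ.time) with hC₂
  have hC₁0 : 0 ≤ C₁ := by positivity
  have hC₂0 : 0 ≤ C₂ := by positivity
  refine ⟨C₁ + C₂, by positivity, fun Λ Y x u hu a ha => ?_⟩
  have hsum0 : 0 ≤ ∑ y ∈ Y, Real.exp (-(siteDist x y : ℝ)) :=
    Finset.sum_nonneg fun _ _ => (Real.exp_pos _).le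
  by_cases hx : x ∈ Φ.touch Y
  · obtain ⟨y, hy, z, hz, rfl⟩ := Finset.mem_image₂.1 hx
    have h1 : (1 : ℝ) ≤ Real.exp Φ.range * ∑ y' ∈ Y, Real.exp (-(siteDist (y - z) y' : ℝ)) := by
      refine le_trans ?_ (mul_le_mul_of_nonneg_left (Finset.single_le_sum
        (f := fun y' => Real.exp (-(siteDist (y - z) y' : ℝ)))
        (fun _ _ => (Real.exp_pos _).le) hy) (Real.exp_pos _).le)
      rw [siteDist_sub_left, ← Real.exp_add]
      apply Real.one_le_exp
      have : (siteDist z 0 : ℝ) ≤ Φ.range := by exact_mod_cast Φ.shape_le z hz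
      linarith
    calc _ ≤ 2 * Φ.bound * ‖a‖ := by
          refine (norm_bracket_le _ _).trans ?_
          rw [norm_evol (Φ.isSelfAdjoint_ham Λ)]
          gcongr
          exact Φ.norm_le _
      _ ≤ 2 * Φ.bound * ‖a‖ *
          (Real.exp Φ.range * ∑ y' ∈ Y, Real.exp (-(siteDist (y - z) y' : ℝ))) :=
          le_mul_of_one_le_right (by positivity) h1
      _ = C₁ * ‖a‖ * ∑ y' ∈ Y, Real.exp (-(siteDist (y - z) y' : ℝ)) := by rw [hC₁]; ring
      _ ≤ _ := by
          gcongr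
          linarith
  · set H := Φ.ham Λ with hH
    -- the Hamiltonian without the terms that meet the support of `a`
    set Q := Φ.ham (Λ \ Φ.touch Y) with hQ
    have hQa : Commute Q a := Commute.sum_left _ _ _ fun w hw =>
      Φ.commute_of_notMem_touch ha (Finset.mem_sdiff.1 hw).2
    have hHQ : H - Q = ∑ w ∈ Λ ∩ Φ.touch Y, Φ.term w := by
      rw [hH, hQ, ham, ham, sub_eq_iff_eq_add, add_comm,
        ← Finset.sum_inter_add_sum_sdiff Λ (Φ.touch Y), add_comm]
    have hfix : ∀ s, evol Q s a = a := fun s => by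
      have h1 : Commute (expI Q s) a := ((hQa.smul_left _).smul_left _).exp_left
      rw [evol, h1.eq, mul_assoc, expI_mul_neg, mul_one]
    have hQx : bracket (evol Q (-u) (Φ.term x)) a = 0 := by
      have := bracket_evol Q u (Φ.term x) a
      rw [hfix, bracket_eq_zero (Φ.commute_of_notMem_touch ha hx)] at this
      have h2 := congrArg (evol Q (-u)) this
      rw [evol_neg_evol] at h2
      rw [← h2]
      simp [evol]
    have hdiff : ‖evol H (-u) (Φ.term x) - evol Q (-u) (Φ.term x)‖
        ≤ (C * (Φ.width * Real.exp Φ.range) * ∑ y ∈ Y, Real.exp (-(siteDist x y : ℝ))) * |(-u)| := by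
      refine norm_evol_sub_evol_le (Φ.isSelfAdjoint_ham _) _ fun v hv => ?_
      have hv' : |v| ≤ Φ.time := hv.trans (by rwa [abs_neg])
      change ‖bracket (H - Q) _‖ ≤ _
      rw [hHQ, sum_bracket]
      calc _ ≤ ∑ w ∈ Λ ∩ Φ.touch Y, ‖bracket (Φ.term w) (evol H v (Φ.term x))‖ := norm_sum_le _ _
        _ ≤ ∑ w ∈ Λ ∩ Φ.touch Y, C * Real.exp (-(siteDist w x : ℝ)) :=
            Finset.sum_le_sum fun w _ => hC Λ w x v hv'
        _ ≤ ∑ w ∈ Φ.touch Y, C * Real.exp (-(siteDist w x : ℝ)) :=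
            Finset.sum_le_sum_of_subset_of_nonneg Finset.inter_subset_right
              fun _ _ _ => by positivity
        _ ≤ ∑ y ∈ Y, ∑ z ∈ Φ.shape, C * Real.exp (-(siteDist (y - z) x : ℝ)) :=
            sum_image₂_le _ _ _ fun _ => by positivity
        _ ≤ ∑ y ∈ Y, ∑ z ∈ Φ.shape, C * (Real.exp Φ.range * Real.exp (-(siteDist x y : ℝ))) := by
            gcongr with y hy z hz
            rw [← Real.exp_add, Real.exp_le_exp]
            have h1 := siteDist_triangle x (y - z) y
            rw [siteDist_sub_left, siteDist_comm x (y - z)] at h1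
            have h2 := Φ.shape_le z hz
            have h3 : (siteDist x y : ℝ) ≤ siteDist (y - z) x + Φ.range := by
              exact_mod_cast h1.trans (by omega)
            linarith
        _ = (Φ.shape.card * Real.exp Φ.range) * C * ∑ y ∈ Y, Real.exp (-(siteDist x y : ℝ)) := by
            simp only [Finset.sum_const, nsmul_eq_mul, Finset.mul_sum]
            exact Finset.sum_congr rfl fun _ _ => by ring
        _ ≤ (Φ.width * Real.exp Φ.range) * C * ∑ y ∈ Y, Real.exp (-(siteDist x y : ℝ)) := by
            gcongr
            exact Nat.le_succ _
        _ = _ := by ring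
    have hsplit : bracket (evol H (-u) (Φ.term x)) a
        = bracket (evol H (-u) (Φ.term x) - evol Q (-u) (Φ.term x)) a := by
      rw [← sub_zero (bracket (evol H (-u) (Φ.term x)) a), ← hQx]
      simp only [bracket, sub_mul, mul_sub]
      abel
    rw [bracket_evol, norm_evol (Φ.isSelfAdjoint_ham Λ), hsplit]
    calc _ ≤ 2 * ‖evol H (-u) (Φ.term x) - evol Q (-u) (Φ.term x)‖ * ‖a‖ := norm_bracket_le _ _
      _ ≤ 2 * ((C * (Φ.width * Real.exp Φ.range) *
            ∑ y ∈ Y, Real.exp (-(siteDist x y : ℝ))) * Φ.time) * ‖a‖ := by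
          gcongr
          refine hdiff.trans ?_
          rw [abs_neg]
          gcongr
      _ = C₂ * ‖a‖ * ∑ y ∈ Y, Real.exp (-(siteDist x y : ℝ)) := by rw [hC₂]; ring
      _ ≤ _ := by
          gcongr
          linarith

/-- Enlarging the volume changes the small-time evolution of a local observable by the
contributions of the added sites, which decay exponentially with the distance. -/
theorem norm_evol_ham_sub_le :
    ∃ C : ℝ, 0 ≤ C ∧ ∀ (Λ Λ' Y : Finset (Site D)) (u : ℝ), Λ ⊆ Λ' → |u| ≤ Φ.time →
      ∀ a ∈ N.loc Y, ‖evol (Φ.ham Λ') u a - evol (Φ.ham Λ) u a‖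
        ≤ C * ‖a‖ * ∑ x ∈ Λ' \ Λ, ∑ y ∈ Y, Real.exp (-(siteDist x y : ℝ)) := by
  have ht := Φ.time_pos
  obtain ⟨C, hC0, hC⟩ := Φ.norm_bracket_term_evol_le
  refine ⟨C * Φ.time, by positivity, fun Λ Λ' Y u hΛ hu a ha => ?_⟩
  have hdiff : Φ.ham Λ' - Φ.ham Λ = ∑ x ∈ Λ' \ Λ, Φ.term x := by
    rw [ham, ham, sub_eq_iff_eq_add, Finset.sum_sdiff hΛ]
  have h := norm_evol_sub_evol_le (P := Φ.ham Λ) (Φ.isSelfAdjoint_ham Λ') a (s := u)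
    (C := C * ‖a‖ * ∑ x ∈ Λ' \ Λ, ∑ y ∈ Y, Real.exp (-(siteDist x y : ℝ))) fun v hv => by
      change ‖bracket (Φ.ham Λ - Φ.ham Λ') _‖ ≤ _
      have : bracket (Φ.ham Λ - Φ.ham Λ') (evol (Φ.ham Λ) v a)
          = -bracket (Φ.ham Λ' - Φ.ham Λ) (evol (Φ.ham Λ) v a) := by
        simp only [bracket, sub_mul, mul_sub]; abel
      rw [this, norm_neg, hdiff, sum_bracket, Finset.mul_sum]
      exact (norm_sum_le _ _).trans (Finset.sum_le_sum fun x _ => hC Λ Y x v (hv.trans hu) a ha)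
  rw [norm_sub_rev]
  refine h.trans ?_
  calc _ ≤ C * ‖a‖ * (∑ x ∈ Λ' \ Λ, ∑ y ∈ Y, Real.exp (-(siteDist x y : ℝ))) * Φ.time := by
        gcongr
    _ = _ := by ring

end Interaction

/-! ### The infinite-volume dynamics -/

/-- Induction on doublings: a property of real numbers near `0` that is preserved by doubling holds
everywhere. -/
theorem forall_of_doubling {P : ℝ → Prop} {r : ℝ} (hr : 0 < r) (h0 : ∀ t, |t| ≤ r → P t)
    (h2 : ∀ t, P t → P (t + t)) (t : ℝ) : P t := by
  have h : ∀ (k : ℕ) (t : ℝ), |t| ≤ 2 ^ k * r → P t := by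
    intro k
    induction k with
    | zero => intro t ht; exact h0 t (by simpa using ht)
    | succ k ih =>
      intro t ht
      have := h2 (t / 2) (ih _ (by rw [abs_div, abs_two, div_le_iff₀ two_pos]; rw [pow_succ] at ht; linarith))
      rwa [add_halves] at this
  obtain ⟨k, hk⟩ := pow_unbounded_of_one_lt (|t| / r) one_lt_two
  exact h k t ((div_le_iff₀ hr).1 hk.le)

namespace Interaction

variable {D : ℕ} {𝔸 : Type*} [CStarAlgebra 𝔸] {N : LocalNet D 𝔸} (Φ : Interaction N)

theorem cauchySeq_evol_of_mem_loc {t : ℝ} (ht : |t| ≤ Φ.time) {Y : Finset (Site D)} {a : 𝔸}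
    (ha : a ∈ N.loc Y) : CauchySeq fun Λ : Finset (Site D) => evol (Φ.ham Λ) t a := by
  obtain ⟨C, hC0, hC⟩ := Φ.norm_evol_ham_sub_le
  have hs : Summable fun x : Site D => C * ‖a‖ * ∑ y ∈ Y, Real.exp (-(siteDist x y : ℝ)) := by
    refine (summable_sum fun y _ => ?_).mul_left _
    simpa using summable_exp_siteDist_sub one_pos y
  rw [Metric.cauchySeq_iff']
  intro ε hε
  obtain ⟨Λ, hΛ⟩ := summable_iff_vanishing_norm.1 hs ε hε
  refine ⟨Λ, fun Λ' hΛ' => ?_⟩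
  rw [dist_eq_norm]
  refine (hC Λ Λ' Y t hΛ' ht a ha).trans_lt ?_
  rw [Finset.mul_sum]
  exact (le_abs_self _).trans_lt (hΛ _ Finset.sdiff_disjoint)

/-- The finite-volume evolutions converge strongly: near time `0` by the Lieb–Robinson bound and
density, and for all times because limits of isometries compose. -/
theorem exists_tendsto_evol (t : ℝ) :
    ∀ a : 𝔸, ∃ b, Tendsto (fun Λ : Finset (Site D) => evol (Φ.ham Λ) t a) atTop (𝓝 b) := by
  refine forall_of_doubling (P := fun t => ∀ a : 𝔸, ∃ b,
    Tendsto (fun Λ : Finset (Site D) => evol (Φ.ham Λ) t a) atTop (𝓝 b)) Φ.time_pos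
    (fun t ht a => cauchySeq_tendsto_of_complete ?_) (fun t ih a => ?_) t
  · rw [Metric.cauchySeq_iff']
    intro ε hε
    obtain ⟨X, b, hb, hab⟩ := N.dense a (ε / 3) (by positivity)
    obtain ⟨Λ, hΛ⟩ := Metric.cauchySeq_iff'.1 (Φ.cauchySeq_evol_of_mem_loc ht hb) (ε / 3)
      (by positivity)
    refine ⟨Λ, fun Λ' h => ?_⟩
    have h1 := hΛ Λ' h
    rw [dist_eq_norm] at h1 ⊢
    calc ‖evol (Φ.ham Λ') t a - evol (Φ.ham Λ) t a‖
        = ‖evol (Φ.ham Λ') t (a - b) + (evol (Φ.ham Λ') t b - evol (Φ.ham Λ) t b)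
            - evol (Φ.ham Λ) t (a - b)‖ := by
          simp only [evol_sub]; congr 1; abel
      _ ≤ ‖evol (Φ.ham Λ') t (a - b)‖ + ‖evol (Φ.ham Λ') t b - evol (Φ.ham Λ) t b‖
            + ‖evol (Φ.ham Λ) t (a - b)‖ :=
          (norm_sub_le _ _).trans (by gcongr; exact norm_add_le _ _)
      _ < ε := by
          rw [norm_evol (Φ.isSelfAdjoint_ham _), norm_evol (Φ.isSelfAdjoint_ham _)]
          linarith
  · obtain ⟨b, hb⟩ := ih a
    obtain ⟨c, hc⟩ := ih b
    refine ⟨c, ?_⟩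
    have h1 : Tendsto (fun Λ : Finset (Site D) => evol (Φ.ham Λ) t (evol (Φ.ham Λ) t a - b))
        atTop (𝓝 0) := by
      rw [tendsto_zero_iff_norm_tendsto_zero]
      simp only [norm_evol (Φ.isSelfAdjoint_ham _)]
      exact tendsto_iff_norm_sub_tendsto_zero.1 hb
    have h2 := h1.add hc
    rw [zero_add] at h2
    refine h2.congr fun Λ => ?_
    rw [evol_sub, evol_add_time]
    abel

theorem expI_ham_mem {X Λ : Finset (Site D)}
    (h : ∀ x ∈ Λ, Φ.shape.image (· + x) ⊆ X) (t : ℝ) : expI (Φ.ham Λ) t ∈ N.loc X := by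
  have h1 : Φ.ham Λ ∈ N.loc X := sum_mem fun x hx =>
    N.mono (by exact_mod_cast h x hx) (Φ.mem_loc x)
  let _ : NormedAlgebra ℚ 𝔸 := NormedAlgebra.restrictScalars ℚ ℂ 𝔸
  refine NormedSpace.exp_mem (R := ℂ) (N.closed X) ?_
  rw [← Complex.coe_smul t, smul_smul]
  exact SMulMemClass.smul_mem _ h1

/-- `τ` is the limit of the finite-volume evolutions. -/
def IsThermodynamicLimit (τ : ℝ → 𝔸 →L[ℂ] 𝔸) : Prop :=
  ∀ t a, Tendsto (fun Λ : Finset (Site D) => evol (Φ.ham Λ) t a) atTop (𝓝 (τ t a))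

theorem exists_isThermodynamicLimit : ∃ τ, Φ.IsThermodynamicLimit τ := by
  choose f hf using Φ.exists_tendsto_evol
  refine ⟨fun t => LinearMap.mkContinuous
    { toFun := f t
      map_add' := fun a b => tendsto_nhds_unique (hf t (a + b)) (by
        simpa only [evol_add] using (hf t a).add (hf t b))
      map_smul' := fun r a => tendsto_nhds_unique (hf t (r • a)) (by
        simpa only [evol_smul, RingHom.id_apply] using (hf t a).const_smul r) } 1 fun a => ?_,
    fun t a => hf t a⟩
  rw [one_mul]
  exact le_of_tendsto (hf t a).norm (.of_forall fun Λ => (norm_evol (Φ.isSelfAdjoint_ham _) _ _).le)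

namespace IsThermodynamicLimit

variable {Φ} {τ : ℝ → 𝔸 →L[ℂ] 𝔸}

theorem norm_apply (hτ : Φ.IsThermodynamicLimit τ) (t : ℝ) (a : 𝔸) : ‖τ t a‖ = ‖a‖ :=
  tendsto_nhds_unique (hτ t a).norm (by
    simp only [norm_evol (Φ.isSelfAdjoint_ham _)]; exact tendsto_const_nhds)

theorem map_mul (hτ : Φ.IsThermodynamicLimit τ) (t : ℝ) (a b : 𝔸) : τ t (a * b) = τ t a * τ t b :=
  tendsto_nhds_unique (hτ t _) (by simpa only [evol_mul] using (hτ t a).mul (hτ t b))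

theorem map_one (hτ : Φ.IsThermodynamicLimit τ) (t : ℝ) : τ t 1 = 1 :=
  tendsto_nhds_unique (hτ t _) (by simp only [evol_one]; exact tendsto_const_nhds)

theorem map_star (hτ : Φ.IsThermodynamicLimit τ) (t : ℝ) (a : 𝔸) : τ t (star a) = star (τ t a) :=
  tendsto_nhds_unique (hτ t _) (by
    simp only [evol_star (Φ.isSelfAdjoint_ham _)]; exact (hτ t a).star)

theorem apply_zero (hτ : Φ.IsThermodynamicLimit τ) (a : 𝔸) : τ 0 a = a :=
  tendsto_nhds_unique (hτ 0 _) (by simp only [evol_zero_time]; exact tendsto_const_nhds)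

theorem apply_add (hτ : Φ.IsThermodynamicLimit τ) (s t : ℝ) (a : 𝔸) : τ (s + t) a = τ s (τ t a) := by
  refine tendsto_nhds_unique (hτ (s + t) a) ?_
  have h1 : Tendsto (fun Λ : Finset (Site D) => evol (Φ.ham Λ) s (evol (Φ.ham Λ) t a - τ t a))
      atTop (𝓝 0) := by
    rw [tendsto_zero_iff_norm_tendsto_zero]
    simp only [norm_evol (Φ.isSelfAdjoint_ham _)]
    exact tendsto_iff_norm_sub_tendsto_zero.1 (hτ t a)
  have h2 := h1.add (hτ s (τ t a))
  rw [zero_add] at h2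
  refine h2.congr fun Λ => ?_
  rw [evol_sub, evol_add_time]
  abel

theorem norm_apply_sub_le (hτ : Φ.IsThermodynamicLimit τ) (t : ℝ) {Y : Finset (Site D)} {a : 𝔸}
    (ha : a ∈ N.loc Y) :
    ‖τ t a - a‖ ≤ (Φ.touch Y).card * (2 * Φ.bound * ‖a‖) * |t| := by
  have hb := Φ.bound_nonneg
  refine le_of_tendsto ((hτ t a).sub_const a).norm (.of_forall fun Λ => ?_)
  rw [norm_sub_rev]
  have := norm_evol_sub_evol_le (P := 0) (Φ.isSelfAdjoint_ham Λ) a (s := t)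
    (C := (Φ.touch Y).card * (2 * Φ.bound * ‖a‖)) fun u _ => by
      rw [evol_zero_ham]
      have h1 : (0 - Φ.ham Λ) * a - a * (0 - Φ.ham Λ) = -bracket (Φ.ham Λ) a := by
        simp [bracket]; abel
      rw [h1, norm_neg, Φ.bracket_ham ha]
      refine (norm_sum_le _ _).trans ?_
      calc ∑ x ∈ Λ ∩ Φ.touch Y, ‖bracket (Φ.term x) a‖
          ≤ (Λ ∩ Φ.touch Y).card • (2 * Φ.bound * ‖a‖) :=
            Finset.sum_le_card_nsmul _ _ _ fun x _ =>
              (norm_bracket_le _ _).trans (by gcongr; exact Φ.norm_le x)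
        _ ≤ _ := by
            rw [nsmul_eq_mul]
            gcongr
            exact Finset.inter_subset_right
  rwa [evol_zero_ham] at this

theorem continuous_apply (hτ : Φ.IsThermodynamicLimit τ) (a : 𝔸) : Continuous fun t => τ t a := by
  have hloc : ∀ (Y : Finset (Site D)), ∀ b ∈ N.loc Y, Continuous fun t => τ t b := by
    intro Y b hb
    have hbd := Φ.bound_nonneg
    refine (LipschitzWith.of_dist_le_mul (K := ((Φ.touch Y).card * (2 * Φ.bound * ‖b‖)).toNNReal)
      fun s t => ?_).continuous
    rw [dist_eq_norm, dist_eq_norm, Real.coe_toNNReal _ (by positivity), Real.norm_eq_abs]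
    have : τ s b - τ t b = τ t (τ (s - t) b - b) := by
      rw [map_sub, ← hτ.apply_add, add_sub_cancel]
    rw [this, hτ.norm_apply]
    exact hτ.norm_apply_sub_le _ hb
  refine continuous_of_uniform_approx_of_continuous fun u hu => ?_
  obtain ⟨ε, hε, hu⟩ := Metric.mem_uniformity_dist.1 hu
  obtain ⟨X, b, hb, hab⟩ := N.dense a ε hε
  refine ⟨fun t => τ t b, hloc X b hb, fun t => hu ?_⟩
  rwa [dist_eq_norm, ← map_sub, hτ.norm_apply]

/-- The power series of the infinite-volume evolution: on local observables each nested commutator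
is eventually constant in the volume, and the series is dominated uniformly in the volume. -/
theorem hasSum_apply (hτ : Φ.IsThermodynamicLimit τ) {t : ℝ} (ht : |t| ≤ Φ.time)
    {Y : Finset (Site D)} {a : 𝔸} (ha : a ∈ N.loc Y)
    {δ : ℕ → 𝔸} (hδ : ∀ n, ∀ᶠ Λ : Finset (Site D) in atTop, (bracket (Φ.ham Λ))^[n] a = δ n) :
    HasSum (fun n : ℕ => ((Complex.I * (t : ℂ)) ^ n / (n.factorial : ℂ)) • δ n) (τ t a) := by
  have hsum : Summable fun n : ℕ => 2 ^ Y.card * ‖a‖ * (Φ.time * Φ.rate) ^ n :=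
    (summable_geometric_of_lt_one (mul_nonneg Φ.time_pos.le Φ.rate_nonneg)
      (Φ.time_mul_rate_le.trans_lt (by norm_num))).mul_left _
  have hbd : ∀ n, ‖((Complex.I * (t : ℂ)) ^ n / (n.factorial : ℂ)) • δ n‖
      ≤ 2 ^ Y.card * ‖a‖ * (Φ.time * Φ.rate) ^ n := fun n => by
    obtain ⟨Λ, hΛ⟩ := (hδ n).exists
    rw [← hΛ]
    exact Φ.norm_series_term_le Λ n le_rfl ha ht
  have hs : Summable fun n : ℕ => ((Complex.I * (t : ℂ)) ^ n / (n.factorial : ℂ)) • δ n :=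
    hsum.of_norm_bounded hbd
  have hlim := tendsto_tsum_of_dominated_convergence (𝓕 := (atTop : Filter (Finset (Site D))))
    (f := fun Λ n => ((Complex.I * (t : ℂ)) ^ n / (n.factorial : ℂ)) • (bracket (Φ.ham Λ))^[n] a)
    (g := fun n => ((Complex.I * (t : ℂ)) ^ n / (n.factorial : ℂ)) • δ n) hsum
    (fun n => tendsto_const_nhds.congr' ((hδ n).mono fun Λ h => by simp only [h]))
    (.of_forall fun Λ n => Φ.norm_series_term_le Λ n le_rfl ha ht)
  have h1 : (fun Λ : Finset (Site D) => ∑' n : ℕ,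
      ((Complex.I * (t : ℂ)) ^ n / (n.factorial : ℂ)) • (bracket (Φ.ham Λ))^[n] a)
      = fun Λ => evol (Φ.ham Λ) t a := funext fun Λ => (hasSum_evol _ _ _).tsum_eq
  rw [h1] at hlim
  rw [tendsto_nhds_unique (hτ t a) hlim]
  exact hs.hasSum

/-- Local approximation of the evolution for small times: the evolution generated by the terms
supported in the `n`-neighbourhood stays in the algebra of that neighbourhood. -/
theorem exists_approx_of_le_time (hτ : Φ.IsThermodynamicLimit τ) :
    ∃ C : ℝ, 0 ≤ C ∧ ∀ t, |t| ≤ Φ.time → ∀ (Y : Finset (Site D)), ∀ a ∈ N.loc Y, ∀ n : ℕ,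
      ∃ a' ∈ N.loc ↑(nbhd n Y), ‖a'‖ ≤ ‖a‖ ∧
        ‖τ t a - a'‖ ≤ C * Y.card * ‖a‖ * Real.exp (-(1 / 2 * (n : ℝ))) := by
  obtain ⟨C, hC0, hC⟩ := Φ.norm_evol_ham_sub_le
  set Z : ℝ := ∑' x : Site D, Real.exp (-(1 / 2 * siteDist x 0)) with hZ
  have hZ0 : 0 ≤ Z := tsum_nonneg fun _ => (Real.exp_pos _).le
  refine ⟨C * (Real.exp (1 / 2 * Φ.range) * Z), by positivity, fun t ht Y a ha n => ?_⟩
  -- the positions of the terms supported in the neighbourhood; all other positions are far from `Y`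
  set Λ : Finset (Site D) := (nbhd (n + Φ.range) Y).filter
    fun x => Φ.shape.image (· + x) ⊆ nbhd n Y with hΛ
  have hfar : ∀ x ∉ Λ, ∀ y ∈ Y, n ≤ siteDist x y + Φ.range := by
    intro x hx y hy
    by_contra! hlt
    refine hx (Finset.mem_filter.2 ⟨mem_nbhd.2 ⟨y, hy, by omega⟩, fun v hv => ?_⟩)
    obtain ⟨z, hz, rfl⟩ := Finset.mem_image.1 hv
    refine mem_nbhd.2 ⟨y, hy, ?_⟩
    have h1 := siteDist_triangle (z + x) x y
    rw [siteDist_add_left] at h1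
    have := Φ.shape_le z hz
    omega
  refine ⟨evol (Φ.ham Λ) t a, ?_, (norm_evol (Φ.isSelfAdjoint_ham _) _ _).le, ?_⟩
  · have h1 : ∀ x ∈ Λ, Φ.shape.image (· + x) ⊆ nbhd n Y := fun x hx => (Finset.mem_filter.1 hx).2
    exact mul_mem (mul_mem (Φ.expI_ham_mem h1 _) (N.mono (by exact_mod_cast subset_nbhd n Y) ha))
      (Φ.expI_ham_mem h1 _)
  refine le_of_tendsto ((hτ t a).sub_const _).norm ?_
  filter_upwards [eventually_ge_atTop Λ] with Λ' hΛ'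
  refine (hC Λ Λ' Y t hΛ' ht a ha).trans ?_
  have hsum : ∑ x ∈ Λ' \ Λ, ∑ y ∈ Y, Real.exp (-(siteDist x y : ℝ))
      ≤ Real.exp (1 / 2 * Φ.range) * Z * Y.card * Real.exp (-(1 / 2 * (n : ℝ))) := by
    rw [Finset.sum_comm]
    have : ∀ y ∈ Y, ∑ x ∈ Λ' \ Λ, Real.exp (-(siteDist x y : ℝ))
        ≤ Real.exp (1 / 2 * Φ.range) * Real.exp (-(1 / 2 * (n : ℝ))) * Z := by
      intro y hy
      calc ∑ x ∈ Λ' \ Λ, Real.exp (-(siteDist x y : ℝ))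
          ≤ ∑ x ∈ Λ' \ Λ, Real.exp (1 / 2 * Φ.range) * Real.exp (-(1 / 2 * (n : ℝ)))
              * Real.exp (-(1 / 2 * siteDist x y)) := by
            refine Finset.sum_le_sum fun x hx => ?_
            rw [← Real.exp_add, ← Real.exp_add, Real.exp_le_exp]
            have : (n : ℝ) ≤ siteDist x y + Φ.range := by
              exact_mod_cast hfar x (Finset.mem_sdiff.1 hx).2 y hy
            linarith
        _ ≤ Real.exp (1 / 2 * Φ.range) * Real.exp (-(1 / 2 * (n : ℝ))) * Z := by
            rw [← Finset.mul_sum, hZ, ← tsum_exp_siteDist_sub _ y]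
            gcongr
            exact (summable_exp_siteDist_sub (by norm_num) y).sum_le_tsum _
              fun _ _ => (Real.exp_pos _).le
    refine (Finset.sum_le_card_nsmul _ _ _ this).trans (le_of_eq ?_)
    rw [nsmul_eq_mul]; ring
  calc _ ≤ C * ‖a‖ * (Real.exp (1 / 2 * Φ.range) * Z * Y.card * Real.exp (-(1 / 2 * (n : ℝ)))) := by
        gcongr
    _ = _ := by ring

/-- Local approximation of the evolution, uniformly for bounded times, with an error that is
exponentially small in the distance and polynomial in the number of sites. The small-time bound is
iterated by doubling the time. -/
theorem exists_approx (hτ : Φ.IsThermodynamicLimit τ) (T : ℝ) :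
    ∃ (C μ : ℝ) (c : ℕ), 0 ≤ C ∧ 0 < μ ∧ ∀ t, |t| ≤ |T| → ∀ (Y : Finset (Site D)), ∀ a ∈ N.loc Y,
      ∀ n : ℕ, ∃ a' ∈ N.loc ↑(nbhd n Y), ‖a'‖ ≤ ‖a‖ ∧
        ‖τ t a - a'‖ ≤ C * ((Y.card : ℝ) + 1) ^ c * ‖a‖ * Real.exp (-(μ * n)) := by
  refine forall_of_doubling (P := fun T => ∃ (C μ : ℝ) (c : ℕ), 0 ≤ C ∧ 0 < μ ∧
    ∀ t, |t| ≤ |T| → ∀ (Y : Finset (Site D)), ∀ a ∈ N.loc Y,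
      ∀ n : ℕ, ∃ a' ∈ N.loc ↑(nbhd n Y), ‖a'‖ ≤ ‖a‖ ∧
        ‖τ t a - a'‖ ≤ C * ((Y.card : ℝ) + 1) ^ c * ‖a‖ * Real.exp (-(μ * n))) Φ.time_pos
    (fun T hT => ?_) (fun T ih => ?_) T
  · obtain ⟨C, hC0, hC⟩ := hτ.exists_approx_of_le_time
    refine ⟨C, 1 / 2, 1, hC0, by norm_num, fun t ht Y a ha n => ?_⟩
    obtain ⟨a', h1, h2, h3⟩ := hC t (ht.trans hT) Y a ha n
    refine ⟨a', h1, h2, h3.trans ?_⟩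
    rw [pow_one]
    gcongr
    linarith
  · obtain ⟨C, μ, c, hC0, hμ, h⟩ := ih
    obtain ⟨K, hK0, hK⟩ := exists_rpow_mul_exp_le ((D * c : ℕ) : ℝ) (μ := μ / 4) (by positivity)
    refine ⟨C * (2 * Real.exp μ * K), μ / 4, c, by positivity, by positivity,
      fun t ht Y a ha n => ?_⟩
    have ht2 : |t / 2| ≤ |T| := by
      rw [abs_div, abs_two, div_le_iff₀ two_pos]
      rwa [← two_mul, abs_mul, abs_two, mul_comm] at ht
    -- two steps of radius `n / 2`; the growth of the support in the first one costs a polynomial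
    -- factor, which is absorbed by halving the rate of decay
    obtain ⟨a₁, h1, h2, h3⟩ := h (t / 2) ht2 Y a ha (n / 2)
    obtain ⟨a₂, h4, h5, h6⟩ := h (t / 2) ht2 _ a₁ h1 (n / 2)
    refine ⟨a₂, N.mono ?_ h4, h5.trans h2, ?_⟩
    · have := (nbhd_nbhd_subset (n / 2) (n / 2) Y).trans
        (nbhd_mono (show n / 2 + n / 2 ≤ n by omega) Y)
      exact_mod_cast this
    have hcard : ((nbhd (n / 2) Y).card : ℝ) + 1 ≤ ((Y.card : ℝ) + 1) * (1 + (n : ℝ)) ^ D := by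
      have h7 : ((nbhd (n / 2) Y).card : ℝ) ≤ Y.card * (1 + (n : ℝ)) ^ D := by
        have h8 : (nbhd (n / 2) Y).card ≤ Y.card * (1 + n) ^ D :=
          (card_nbhd_le _ _).trans (Nat.mul_le_mul_left _ (Nat.pow_le_pow_left (by omega) _))
        exact_mod_cast h8
      have h9 : (1 : ℝ) ≤ (1 + (n : ℝ)) ^ D := one_le_pow₀ (by linarith [n.cast_nonneg (α := ℝ)])
      linarith
    have hexp : Real.exp (-(μ * ((n / 2 : ℕ) : ℝ)))
        ≤ Real.exp μ * (Real.exp (-(μ / 4 * n)) * Real.exp (-(μ / 4 * n))) := by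
      rw [← Real.exp_add, ← Real.exp_add, Real.exp_le_exp]
      have : (n : ℝ) ≤ 2 * ((n / 2 : ℕ) : ℝ) + 2 := by
        exact_mod_cast (show n ≤ 2 * (n / 2) + 2 by omega)
      nlinarith
    have hpow : ((nbhd (n / 2) Y).card + 1 : ℝ) ^ c * Real.exp (-(μ * ((n / 2 : ℕ) : ℝ)))
        ≤ ((Y.card : ℝ) + 1) ^ c * (Real.exp μ * K * Real.exp (-(μ / 4 * n))) := by
      calc _ ≤ (((Y.card : ℝ) + 1) * (1 + (n : ℝ)) ^ D) ^ c *
            (Real.exp μ * (Real.exp (-(μ / 4 * n)) * Real.exp (-(μ / 4 * n)))) := by gcongr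
        _ = ((Y.card : ℝ) + 1) ^ c * (Real.exp μ *
            ((1 + (n : ℝ)) ^ (D * c) * Real.exp (-(μ / 4 * n))) * Real.exp (-(μ / 4 * n))) := by
            rw [mul_pow, ← pow_mul]; ring
        _ ≤ _ := by
            gcongr
            have := hK n
            rwa [Real.rpow_natCast] at this
    have hY : ((Y.card : ℝ) + 1) ^ c ≤ ((nbhd (n / 2) Y).card + 1 : ℝ) ^ c := by
      gcongr
      exact subset_nbhd _ _
    have hsplit : τ t a - a₂ = τ (t / 2) (τ (t / 2) a - a₁) + (τ (t / 2) a₁ - a₂) := by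
      rw [map_sub, ← hτ.apply_add, add_halves]; abel
    rw [hsplit]
    calc _ ≤ ‖τ (t / 2) a - a₁‖ + ‖τ (t / 2) a₁ - a₂‖ := by
          refine (norm_add_le _ _).trans ?_
          rw [hτ.norm_apply]
      _ ≤ C * ((nbhd (n / 2) Y).card + 1 : ℝ) ^ c * ‖a‖ * Real.exp (-(μ * ((n / 2 : ℕ) : ℝ)))
          + C * ((nbhd (n / 2) Y).card + 1 : ℝ) ^ c * ‖a‖ *
            Real.exp (-(μ * ((n / 2 : ℕ) : ℝ))) := by
          refine add_le_add (h3.trans ?_) (h6.trans ?_) <;> gcongr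
      _ = 2 * C * ‖a‖ * (((nbhd (n / 2) Y).card + 1 : ℝ) ^ c *
            Real.exp (-(μ * ((n / 2 : ℕ) : ℝ)))) := by ring
      _ ≤ 2 * C * ‖a‖ * (((Y.card : ℝ) + 1) ^ c * (Real.exp μ * K * Real.exp (-(μ / 4 * n)))) := by
          gcongr
      _ = _ := by ring

end IsThermodynamicLimit

end Interaction

/-! ### Matrix units, partial traces and supports -/

section MatrixUnits

variable {D d : ℕ}

theorem matrixUnit_apply (x : Site D) (i j : Fin d) (ψ : Hilb D d) (σ : Config D d) :
    matrixUnit x i j ψ σ = if σ x = i then ψ (Function.update σ x j) else 0 := rfl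

theorem matrixUnit_mul (x : Site D) (i j k l : Fin d) :
    (matrixUnit x i j * matrixUnit x k l : Op D d) = if j = k then matrixUnit x i l else 0 := by
  ext ψ σ
  change matrixUnit x i j (matrixUnit x k l ψ) σ = _
  rw [matrixUnit_apply, matrixUnit_apply]
  by_cases hi : σ x = i <;> by_cases hj : j = k <;> simp [hi, hj, matrixUnit_apply]

theorem matrixUnit_commute {x y : Site D} (hxy : x ≠ y) (i j k l : Fin d) :
    Commute (matrixUnit x i j : Op D d) (matrixUnit y k l) := by
  ext ψ σ
  change (matrixUnit x i j (matrixUnit y k l ψ)) σ = (matrixUnit y k l (matrixUnit x i j ψ)) σ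
  simp only [matrixUnit_apply, Function.update_of_ne hxy, Function.update_of_ne hxy.symm]
  rw [Function.update_comm hxy]
  by_cases hi : σ x = i <;> by_cases hj : σ y = k <;> simp [hi, hj]

theorem sum_matrixUnit (x : Site D) : ∑ i : Fin d, (matrixUnit x i i : Op D d) = 1 := by
  ext ψ σ
  have : (∑ i : Fin d, (matrixUnit x i i : Op D d)) ψ = ∑ i, matrixUnit x i i ψ := by
    simp
  rw [this, lp.coeFn_sum, Finset.sum_apply]
  simp only [matrixUnit_apply]
  rw [Finset.sum_ite_eq]
  simp

/-- Exchange of the values `i` and `j` at the coordinate `x`. -/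
def swapAt {ι α : Type*} [DecidableEq ι] [DecidableEq α] (x : ι) (i j : α) :
    (ι → α) ≃ (ι → α) where
  toFun σ := Function.update σ x (Equiv.swap i j (σ x))
  invFun σ := Function.update σ x (Equiv.swap i j (σ x))
  left_inv σ := by simp
  right_inv σ := by simp

theorem swapAt_of_eq {ι α : Type*} [DecidableEq ι] [DecidableEq α] {x : ι} {i : α} (j : α)
    {σ : ι → α} (h : σ x = i) : swapAt x i j σ = Function.update σ x j := by
  simp [swapAt, h]

theorem swapAt_apply_eq {ι α : Type*} [DecidableEq ι] [DecidableEq α] (x : ι) (i j : α)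
    (σ : ι → α) : swapAt x i j σ x = j ↔ σ x = i := by
  simp only [swapAt, Equiv.coe_fn_mk, Function.update_self]
  rw [Equiv.swap_apply_eq_iff, Equiv.swap_apply_right]

theorem star_matrixUnit (x : Site D) (i j : Fin d) :
    star (matrixUnit x i j : Op D d) = matrixUnit x j i := by
  rw [ContinuousLinearMap.star_eq_adjoint]
  symm
  rw [ContinuousLinearMap.eq_adjoint_iff]
  intro ψ φ
  rw [lp.inner_eq_tsum, lp.inner_eq_tsum]
  rw [← (swapAt x i j).tsum_eq]
  refine tsum_congr fun σ => ?_
  simp only [matrixUnit_apply, swapAt_apply_eq]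
  by_cases h : σ x = i
  · rw [if_pos h, if_pos h, swapAt_of_eq j h, Function.update_idem, ← h, Function.update_eq_self]
  · simp [h]

theorem norm_matrixUnit_le (x : Site D) (i j : Fin d) : ‖(matrixUnit x i j : Op D d)‖ ≤ 1 := by
  unfold matrixUnit partialPullback
  exact LinearMap.mkContinuous_norm_le _ zero_le_one _

theorem matrixUnit_mem {X : Set (Site D)} {x : Site D} (hx : x ∈ X) (i j : Fin d) :
    (matrixUnit x i j : Op D d) ∈ localAlg X :=
  StarAlgebra.subset_adjoin ℂ _ ⟨x, hx, i, j, rfl⟩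

theorem localAlg_mono {X Y : Set (Site D)} (h : X ⊆ Y) :
    (localAlg X : StarSubalgebra ℂ (Op D d)) ≤ localAlg Y :=
  StarAlgebra.adjoin_mono fun _ ⟨x, hx, i, j, e⟩ => ⟨x, h hx, i, j, e⟩

theorem commute_matrixUnit_of_mem {X : Set (Site D)} {a : Op D d} (ha : a ∈ localAlg X)
    {x : Site D} (hx : x ∉ X) : ∀ i j, Commute (matrixUnit x i j) a := by
  refine StarAlgebra.adjoin_induction (p := fun a _ => ∀ i j, Commute (matrixUnit x i j) a)
    ?_ ?_ ?_ ?_ ?_ ha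
  · rintro a ⟨y, hy, k, l, rfl⟩ i j
    exact matrixUnit_commute (x := x) (y := y) (fun h => hx (by rw [h]; exact hy)) i j k l
  · exact fun r i j => (Algebra.commutes r _).symm
  · exact fun a b _ _ ha hb i j => (ha i j).add_right (hb i j)
  · exact fun a b _ _ ha hb i j => (ha i j).mul_right (hb i j)
  · intro a _ ha i j
    have := (ha j i).star_star
    rwa [star_matrixUnit] at this

theorem localAlg_commute {X Y : Set (Site D)} (h : Disjoint X Y) {a b : Op D d}
    (ha : a ∈ localAlg X) (hb : b ∈ localAlg Y) : Commute a b := by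
  have key : ∀ c ∈ localAlg X, Commute c b ∧ Commute (star c) b := by
    intro c hc
    refine StarAlgebra.adjoin_induction (p := fun c _ => Commute c b ∧ Commute (star c) b)
      ?_ ?_ ?_ ?_ ?_ hc
    · rintro _ ⟨x, hx, k, l, rfl⟩
      rw [star_matrixUnit]
      have := commute_matrixUnit_of_mem hb (Set.disjoint_left.1 h hx)
      exact ⟨this _ _, this _ _⟩
    · exact fun r => ⟨Algebra.commutes r _, by
        rw [← algebraMap_star_comm]; exact Algebra.commutes _ _⟩
    · exact fun a b _ _ ha hb => ⟨ha.1.add_left hb.1, by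
        rw [star_add]; exact ha.2.add_left hb.2⟩
    · exact fun a b _ _ ha hb => ⟨ha.1.mul_left hb.1, by
        rw [star_mul]; exact hb.2.mul_left ha.2⟩
    · exact fun a _ ha => ⟨ha.2, by rw [star_star]; exact ha.1⟩
  exact (key a ha).1

theorem exists_finset_mem_localAlg {a : Op D d} {X : Set (Site D)} (ha : a ∈ localAlg X) :
    ∃ Y : Finset (Site D), a ∈ localAlg (Y : Set (Site D)) := by
  refine StarAlgebra.adjoin_induction
    (p := fun a _ => ∃ Y : Finset (Site D), a ∈ localAlg (Y : Set (Site D))) ?_ ?_ ?_ ?_ ?_ ha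
  · rintro _ ⟨x, -, i, j, rfl⟩
    exact ⟨{x}, matrixUnit_mem (by simp) i j⟩
  · exact fun r => ⟨∅, algebraMap_mem _ r⟩
  · rintro a b _ _ ⟨Y, hY⟩ ⟨Z, hZ⟩
    exact ⟨Y ∪ Z, add_mem (localAlg_mono (by simp) hY) (localAlg_mono (by simp) hZ)⟩
  · rintro a b _ _ ⟨Y, hY⟩ ⟨Z, hZ⟩
    exact ⟨Y ∪ Z, mul_mem (localAlg_mono (by simp) hY) (localAlg_mono (by simp) hZ)⟩
  · rintro a _ ⟨Y, hY⟩
    exact ⟨Y, star_mem hY⟩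

theorem mem_localAlg_empty {a : Op D d} (ha : a ∈ localAlg (∅ : Set (Site D))) :
    ∃ r : ℂ, a = algebraMap ℂ (Op D d) r := by
  refine StarAlgebra.adjoin_induction (p := fun a _ => ∃ r : ℂ, a = algebraMap ℂ (Op D d) r)
    ?_ ?_ ?_ ?_ ?_ ha
  · rintro _ ⟨x, hx, -⟩
    exact hx.elim
  · exact fun r => ⟨r, rfl⟩
  · rintro _ _ _ _ ⟨r, rfl⟩ ⟨s, rfl⟩
    exact ⟨r + s, (map_add _ _ _).symm⟩
  · rintro _ _ _ _ ⟨r, rfl⟩ ⟨s, rfl⟩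
    exact ⟨r * s, (map_mul _ _ _).symm⟩
  · rintro _ _ ⟨r, rfl⟩
    exact ⟨star r, (algebraMap_star_comm r).symm⟩

/-- The matrix entries of an operator with respect to the tensor factor at the site `x`: the
operators `a_{kl}` on the other factors with `a = ∑ a_{kl} e_{kl}`. -/
noncomputable def entry (x : Site D) (k l : Fin d) (a : Op D d) : Op D d :=
  ∑ m : Fin d, matrixUnit x m k * a * matrixUnit x l m

theorem entry_add (x : Site D) (k l : Fin d) (a b : Op D d) :
    entry x k l (a + b) = entry x k l a + entry x k l b := by
  simp [entry, mul_add, add_mul, Finset.sum_add_distrib]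

theorem star_entry (x : Site D) (k l : Fin d) (a : Op D d) :
    star (entry x k l a) = entry x l k (star a) := by
  simp [entry, star_matrixUnit, mul_assoc]

/-- Entries multiply like matrices. -/
theorem entry_mul (x : Site D) (k l : Fin d) (a b : Op D d) :
    entry x k l (a * b) = ∑ n, entry x k n a * entry x n l b := by
  have h : ∀ n, entry x k n a * entry x n l b
      = ∑ m, matrixUnit x m k * a * matrixUnit x n n * b * matrixUnit x l m := fun n => by
    rw [entry, entry, Finset.sum_mul]
    refine Finset.sum_congr rfl fun m _ => ?_
    rw [Finset.mul_sum, Finset.sum_eq_single m]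
    · have := matrixUnit_mul x n m m n
      rw [if_pos rfl] at this
      rw [← this]
      simp only [mul_assoc]
    · intro m' _ hm'
      have := matrixUnit_mul x n m m' n
      rw [if_neg hm'.symm] at this
      calc _ = matrixUnit x m k * a * (matrixUnit x n m * matrixUnit x m' n) * b
            * matrixUnit x l m' := by simp only [mul_assoc]
        _ = 0 := by rw [this]; simp
    · simp
  simp only [h]
  rw [Finset.sum_comm, entry]
  refine Finset.sum_congr rfl fun m _ => ?_
  rw [← Finset.sum_mul, ← Finset.sum_mul, ← Finset.mul_sum, sum_matrixUnit, mul_one, mul_assoc _ a b]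

theorem entry_of_commute {x : Site D} {a : Op D d} (ha : ∀ i j, Commute (matrixUnit x i j) a)
    (k l : Fin d) : entry x k l a = if k = l then a else 0 := by
  have h : ∀ m, matrixUnit x m k * a * matrixUnit x l m
      = if k = l then a * matrixUnit x m m else 0 := fun m => by
    rw [(ha m k).eq, mul_assoc, matrixUnit_mul]
    split_ifs <;> simp
  rw [entry, Finset.sum_congr rfl fun m _ => h m]
  split_ifs with hkl
  · rw [← Finset.mul_sum, sum_matrixUnit, mul_one]
  · simp

theorem eq_sum_entry (x : Site D) (a : Op D d) :
    a = ∑ k, ∑ l, entry x k l a * matrixUnit x k l := by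
  have h : ∀ k l, entry x k l a * matrixUnit x k l
      = matrixUnit x k k * a * matrixUnit x l l := fun k l => by
    rw [entry, Finset.sum_mul, Finset.sum_eq_single k]
    · rw [mul_assoc, matrixUnit_mul, if_pos rfl]
    · intro m _ hm
      rw [mul_assoc, matrixUnit_mul, if_neg hm, mul_zero]
    · simp
  simp only [h]
  simp only [← Finset.mul_sum, sum_matrixUnit, mul_one]
  rw [← Finset.sum_mul, sum_matrixUnit, one_mul]

theorem entry_mem {X : Set (Site D)} {a : Op D d} (ha : a ∈ localAlg X) (x : Site D) :
    ∀ k l, entry x k l a ∈ localAlg (X \ {x}) := by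
  refine StarAlgebra.adjoin_induction (p := fun a _ => ∀ k l, entry x k l a ∈ localAlg (X \ {x}))
    ?_ ?_ ?_ ?_ ?_ ha
  · rintro _ ⟨y, hy, i, j, rfl⟩ k l
    by_cases hxy : x = y
    · subst hxy
      have : ∀ m, matrixUnit x m k * matrixUnit x i j * matrixUnit x l m
          = if k = i ∧ j = l then (matrixUnit x m m : Op D d) else 0 := fun m => by
        rw [matrixUnit_mul]
        by_cases hki : k = i <;> by_cases hjl : j = l <;> simp [hki, hjl, matrixUnit_mul]
      rw [entry, Finset.sum_congr rfl fun m _ => this m]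
      split_ifs
      · rw [sum_matrixUnit]; exact one_mem _
      · simp
    · rw [entry_of_commute fun i' j' => matrixUnit_commute hxy i' j' i j]
      split_ifs
      · exact matrixUnit_mem (X := X \ {x}) ⟨hy, fun h => hxy (by simpa using h.symm)⟩ i j
      · exact zero_mem _
  · intro r k l
    rw [entry_of_commute fun i' j' => (Algebra.commutes r _).symm]
    split_ifs
    · exact algebraMap_mem _ r
    · exact zero_mem _
  · intro a b _ _ ha hb k l
    rw [entry_add]
    exact add_mem (ha k l) (hb k l)
  · intro a b _ _ ha hb k l
    rw [entry_mul]
    exact sum_mem fun n _ => mul_mem (ha k n) (hb n l)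
  · intro a _ ha k l
    rw [← star_entry]
    exact star_mem (ha l k)

/-- Taking an entry at each site of `X \ Y` fixes the observables of `Y` and maps those of `X` to
observables of `X ∩ Y`. -/
theorem mem_localAlg_inter [NeZero d] (X : Finset (Site D)) {Y : Set (Site D)} {a : Op D d}
    (hX : a ∈ localAlg (X : Set (Site D))) (hY : a ∈ localAlg Y) :
    a ∈ localAlg ((X : Set (Site D)) ∩ Y) := by
  induction hn : ((X : Set (Site D)) \ Y).ncard generalizing X with
  | zero =>
    have hsub : (X : Set (Site D)) \ Y = ∅ :=
      (Set.ncard_eq_zero (X.finite_toSet.subset Set.sdiff_subset)).1 hn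
    rwa [Set.inter_eq_left.2 (Set.sdiff_eq_empty.1 hsub)]
  | succ n ih =>
    obtain ⟨x, hxX, hxY⟩ : ((X : Set (Site D)) \ Y).Nonempty :=
      Set.nonempty_of_ncard_ne_zero (by omega)
    have h1 := entry_mem hX x 0 0
    rw [entry_of_commute (commute_matrixUnit_of_mem hY hxY), if_pos rfl] at h1
    have h2 := ih (X.erase x) (by simpa using h1) (by
      have : ((X.erase x : Finset (Site D)) : Set (Site D)) \ Y = ((X : Set (Site D)) \ Y) \ {x} := by
        ext; simp; tauto
      rw [this, Set.ncard_sdiff_singleton_of_mem (show x ∈ (X : Set (Site D)) \ Y from ⟨hxX, hxY⟩), hn]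
      rfl)
    exact localAlg_mono (Set.inter_subset_inter_left _ (by simp)) h2

/-- The support of a local observable is finite and does support it: the finite sets that support it
are closed under intersections. -/
theorem exists_supp_eq [NeZero d] {a : Op D d} {X : Set (Site D)} (ha : a ∈ localAlg X) :
    ∃ Y : Finset (Site D), supp a = Y ∧ a ∈ localAlg (Y : Set (Site D)) := by
  have hex : ∃ n, ∃ Y : Finset (Site D), Y.card = n ∧ a ∈ localAlg (Y : Set (Site D)) := by
    obtain ⟨Y, hY⟩ := exists_finset_mem_localAlg ha
    exact ⟨_, Y, rfl, hY⟩
  classical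
  obtain ⟨Y, hcard, hY⟩ := Nat.find_spec hex
  refine ⟨Y, Set.Subset.antisymm (Set.sInter_subset_of_mem ⟨Y.finite_toSet, hY⟩) ?_, hY⟩
  refine Set.subset_sInter fun Z ⟨hZ, haZ⟩ => ?_
  have h1 := mem_localAlg_inter Y hY haZ
  have h2 : ((Y.filter (· ∈ Z) : Finset (Site D)) : Set (Site D)) = (Y : Set (Site D)) ∩ Z := by
    ext; simp
  rw [← h2] at h1
  have h3 := Nat.find_min' hex ⟨_, rfl, h1⟩
  rw [← hcard] at h3
  have h4 := Finset.eq_of_subset_of_card_le (Finset.filter_subset (· ∈ Z) Y) h3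
  intro y hy
  rw [← h4] at hy
  simpa using (Finset.mem_filter.1 hy).2

theorem supp_subset {a : Op D d} {X : Finset (Site D)} (ha : a ∈ localAlg (X : Set (Site D))) :
    supp a ⊆ X :=
  Set.sInter_subset_of_mem ⟨X.finite_toSet, ha⟩

theorem size_le {a : Op D d} {X : Finset (Site D)} (ha : a ∈ localAlg (X : Set (Site D))) :
    size a ≤ X.card := by
  rw [size, ← Set.ncard_coe_finset X]
  exact Set.ncard_le_ncard (supp_subset ha) X.finite_toSet

/-- By the decomposition into entries, adding a site multiplies the dimension by at most `d ^ 2`. -/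
instance finiteDimensional_localAlg (X : Finset (Site D)) :
    FiniteDimensional ℂ (localAlg (X : Set (Site D)) : StarSubalgebra ℂ (Op D d)) := by
  induction X using Finset.induction_on with
  | empty =>
    refine FiniteDimensional.of_surjective
      (Algebra.linearMap ℂ (localAlg ((∅ : Finset (Site D)) : Set (Site D)) :
        StarSubalgebra ℂ (Op D d))) fun ⟨a, ha⟩ => ?_
    rw [Finset.coe_empty] at ha
    obtain ⟨r, hr⟩ := mem_localAlg_empty ha
    exact ⟨r, Subtype.ext hr.symm⟩
  | insert x X hx ih =>
    let f : (Fin d → Fin d → (localAlg (X : Set (Site D)) : StarSubalgebra ℂ (Op D d))) →ₗ[ℂ]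
        (localAlg ((insert x X : Finset (Site D)) : Set (Site D)) : StarSubalgebra ℂ (Op D d)) :=
      { toFun := fun b => ∑ k, ∑ l, ⟨b k l * matrixUnit x k l,
          mul_mem (localAlg_mono (by simp) (b k l).2) (matrixUnit_mem (by simp) k l)⟩
        map_add' := fun b c => by
          simp only [← Finset.sum_add_distrib]
          refine Finset.sum_congr rfl fun k _ => Finset.sum_congr rfl fun l _ => ?_
          ext1
          exact add_mul _ _ _
        map_smul' := fun r b => by
          simp only [Finset.smul_sum]
          refine Finset.sum_congr rfl fun k _ => Finset.sum_congr rfl fun l _ => ?_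
          ext1
          exact smul_mul_assoc _ _ _ }
    refine FiniteDimensional.of_surjective f fun ⟨a, ha⟩ => ?_
    refine ⟨fun k l => ⟨entry x k l a, localAlg_mono ?_ (entry_mem ha x k l)⟩,
      Subtype.ext (Eq.trans ?_ (eq_sum_entry x a).symm)⟩
    · intro y hy
      have h1 : y ∈ insert x X := hy.1
      exact (Finset.mem_insert.1 h1).resolve_left hy.2
    · simp only [f, LinearMap.coe_mk, AddHom.coe_mk]
      rw [AddSubmonoidClass.coe_finsetSum]
      simp only [AddSubmonoidClass.coe_finsetSum]

end MatrixUnits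

/-! ### The normalized trace -/

section Trace

variable {D d : ℕ}


open Classical in
/-- The basis vector of a configuration. -/
noncomputable def basisVec (σ : Config D d) : Hilb D d := lp.single 2 σ (1 : ℂ)

open Classical in
theorem basisVec_apply (σ ρ : Config D d) : basisVec σ ρ = if ρ = σ then (1 : ℂ) else 0 := by
  unfold basisVec
  rw [lp.single_apply]
  by_cases h : ρ = σ
  · subst h; simp
  · simp [h]

theorem norm_basisVec (σ : Config D d) : ‖basisVec σ‖ = 1 := by
  classical
  unfold basisVec
  rw [lp.norm_single (by norm_num)]
  simp

theorem inner_basisVec (σ : Config D d) (ψ : Hilb D d) : inner ℂ (basisVec σ) ψ = ψ σ := by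
  classical
  unfold basisVec
  rw [lp.inner_single_left]
  simp

theorem matrixUnit_basisVec (x : Site D) (i j : Fin d) (σ : Config D d) :
    matrixUnit x i j (basisVec σ) = if σ x = j then basisVec (Function.update σ x i) else 0 := by
  classical
  ext ρ
  rw [matrixUnit_apply, basisVec_apply]
  have h : ∀ h : σ x = j, ((if σ x = j then basisVec (Function.update σ x i) else 0 : Hilb D d) : Config D d → ℂ) ρ
      = if ρ = Function.update σ x i then 1 else 0 := fun h => by
    rw [if_pos h, basisVec_apply]
  by_cases hσ : σ x = j
  · rw [h hσ]
    by_cases hρ : ρ = Function.update σ x i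
    · subst hρ
      simp [← hσ]
    · rw [if_neg hρ]
      split_ifs with h1 h2
      · exact (hρ (by rw [← h2, Function.update_idem, ← h1, Function.update_eq_self])).elim
      · rfl
      · rfl
  · rw [if_neg hσ]
    split_ifs with h1 h2
    · exact (hσ (by rw [← h2, Function.update_self])).elim
    · rfl
    · rfl

theorem star_mul_apply_basisVec (a b : Op D d) (σ : Config D d) :
    (star a * b) (basisVec σ) σ = inner ℂ (a (basisVec σ)) (b (basisVec σ)) := by
  rw [← inner_basisVec]
  change inner ℂ (basisVec σ) (star a (b (basisVec σ))) = _
  rw [ContinuousLinearMap.star_eq_adjoint, ContinuousLinearMap.adjoint_inner_right]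

variable [NeZero d]

/-- The configuration that is `s` on `Λ` and vanishes elsewhere. -/
noncomputable def extend (Λ : Finset (Site D)) (s : Λ → Fin d) : Config D d :=
  fun x => if hx : x ∈ Λ then s ⟨x, hx⟩ else 0

/-- The average of the diagonal entries over the configurations that vanish off `Λ`. -/
noncomputable def finTrace (Λ : Finset (Site D)) (a : Op D d) : ℂ :=
  ((d : ℂ) ^ Λ.card)⁻¹ * ∑ s : Λ → Fin d, a (basisVec (extend Λ s)) (extend Λ s)

theorem trace_eq_limUnder (a : Op D d) :
    trace a = limUnder (atTop : Filter (Finset (Site D))) (fun Λ => finTrace Λ a) := by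
  unfold trace finTrace basisVec extend
  congr!

theorem update_extend (Λ : Finset (Site D)) (s : Λ → Fin d) {x : Site D} (hx : x ∈ Λ) (i : Fin d) :
    Function.update (extend Λ s) x i = extend Λ (Function.update s ⟨x, hx⟩ i) := by
  funext y
  by_cases hy : y = x
  · subst hy; simp [extend, hx]
  · by_cases hyΛ : y ∈ Λ
    · have : (⟨y, hyΛ⟩ : Λ) ≠ ⟨x, hx⟩ := fun h => hy (congrArg Subtype.val h)
      simp [extend, hy, hyΛ]
    · simp [extend, hy, hyΛ]

theorem finTrace_add (Λ : Finset (Site D)) (a b : Op D d) :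
    finTrace Λ (a + b) = finTrace Λ a + finTrace Λ b := by
  simp [finTrace, Finset.sum_add_distrib, mul_add]

theorem finTrace_smul (Λ : Finset (Site D)) (r : ℂ) (a : Op D d) :
    finTrace Λ (r • a) = r * finTrace Λ a := by
  simp only [finTrace, smul_apply, lp.coeFn_smul, Pi.smul_apply, smul_eq_mul, ← Finset.mul_sum]
  ring

/-- `finTrace` as a linear map. -/
noncomputable def finTraceₗ (Λ : Finset (Site D)) : Op D d →ₗ[ℂ] ℂ where
  toFun := finTrace Λ
  map_add' := finTrace_add Λ
  map_smul' := finTrace_smul Λ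

theorem finTrace_sum {ι : Type*} (Λ : Finset (Site D)) (s : Finset ι) (a : ι → Op D d) :
    finTrace Λ (∑ i ∈ s, a i) = ∑ i ∈ s, finTrace Λ (a i) :=
  map_sum (finTraceₗ Λ) a s

theorem finTrace_sub (Λ : Finset (Site D)) (a b : Op D d) :
    finTrace Λ (a - b) = finTrace Λ a - finTrace Λ b :=
  map_sub (finTraceₗ Λ) a b

theorem finTrace_one (Λ : Finset (Site D)) : finTrace Λ (1 : Op D d) = 1 := by
  have : (d : ℂ) ≠ 0 := by exact_mod_cast NeZero.ne d
  classical
  simp [finTrace, basisVec_apply, this]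

theorem norm_finTrace_le (Λ : Finset (Site D)) (a : Op D d) : ‖finTrace Λ a‖ ≤ ‖a‖ := by
  have hd : (0 : ℝ) < d := by exact_mod_cast Nat.pos_of_ne_zero (NeZero.ne d)
  have h : ∀ σ : Config D d, ‖a (basisVec σ) σ‖ ≤ ‖a‖ := fun σ =>
    (lp.norm_apply_le_norm (by norm_num) _ _).trans
      ((a.le_opNorm _).trans (by rw [norm_basisVec, mul_one]))
  rw [finTrace, norm_mul, norm_inv, norm_pow, Complex.norm_natCast, inv_mul_le_iff₀ (by positivity)]
  refine (norm_sum_le _ _).trans ((Finset.sum_le_card_nsmul _ _ _ fun s _ => h _).trans ?_)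
  simp

theorem finTrace_star (Λ : Finset (Site D)) (a : Op D d) :
    finTrace Λ (star a) = conj (finTrace Λ a) := by
  simp only [finTrace, map_mul, map_inv₀, map_pow, Complex.conj_natCast, map_sum]
  congr 1
  refine Finset.sum_congr rfl fun s _ => ?_
  have := star_mul_apply_basisVec a 1 (extend Λ s)
  rw [mul_one] at this
  rw [this, ← inner_basisVec, inner_conj_symm]
  rfl

theorem finTrace_star_mul_self (Λ : Finset (Site D)) (a : Op D d) :
    finTrace Λ (star a * a)
      = (((d : ℝ) ^ Λ.card)⁻¹ * ∑ s : Λ → Fin d, ‖a (basisVec (extend Λ s))‖ ^ 2 : ℝ) := by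
  simp only [finTrace, star_mul_apply_basisVec, inner_self_eq_norm_sq_to_K]
  push_cast
  rfl

theorem re_finTrace_star_mul_self_nonneg (Λ : Finset (Site D)) (a : Op D d) :
    0 ≤ (finTrace Λ (star a * a)).re := by
  rw [finTrace_star_mul_self, Complex.ofReal_re]
  positivity

theorem re_finTrace_mul_le (Λ : Finset (Site D)) (a b : Op D d) :
    (finTrace Λ (star (a * b) * (a * b))).re ≤ ‖a‖ ^ 2 * (finTrace Λ (star b * b)).re := by
  rw [finTrace_star_mul_self, finTrace_star_mul_self, Complex.ofReal_re, Complex.ofReal_re]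
  calc _ ≤ ((d : ℝ) ^ Λ.card)⁻¹ * ∑ s : Λ → Fin d, ‖a‖ ^ 2 * ‖b (basisVec (extend Λ s))‖ ^ 2 := by
        refine mul_le_mul_of_nonneg_left (Finset.sum_le_sum fun s _ => ?_) (by positivity)
        rw [← mul_pow]
        exact pow_le_pow_left₀ (norm_nonneg _) (a.le_opNorm _) 2
    _ = _ := by rw [← Finset.mul_sum]; ring

/-- Tracial property for matrix units, by exchanging the values `i` and `j` at the site `x` in the
sum over configurations. -/
theorem finTrace_matrixUnit_mul (Λ : Finset (Site D)) {x : Site D} (hx : x ∈ Λ) (i j : Fin d)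
    (b : Op D d) : finTrace Λ (matrixUnit x i j * b) = finTrace Λ (b * matrixUnit x i j) := by
  simp only [finTrace]
  congr 1
  rw [← (swapAt (⟨x, hx⟩ : Λ) i j).sum_comp fun s =>
    (b * matrixUnit x i j) (basisVec (extend Λ s)) (extend Λ s)]
  refine Finset.sum_congr rfl fun s _ => ?_
  change matrixUnit x i j (b (basisVec (extend Λ s))) (extend Λ s)
    = b (matrixUnit x i j (basisVec (extend Λ (swapAt (⟨x, hx⟩ : Λ) i j s)))) _
  have hex : ∀ s : Λ → Fin d, extend Λ s x = s ⟨x, hx⟩ := fun s => by simp [extend, hx]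
  rw [matrixUnit_apply, matrixUnit_basisVec, hex, hex]
  by_cases h : s ⟨x, hx⟩ = i
  · rw [if_pos h, if_pos ((swapAt_apply_eq _ _ _ _).2 h), swapAt_of_eq j h, update_extend Λ _ hx,
      update_extend Λ _ hx, Function.update_idem, ← h, Function.update_eq_self]
  · rw [if_neg h, if_neg (mt (swapAt_apply_eq _ _ _ _).1 h), map_zero]
    rfl

theorem finTrace_mul_comm {Λ : Finset (Site D)} {a : Op D d}
    (ha : a ∈ localAlg (Λ : Set (Site D))) (b : Op D d) :
    finTrace Λ (a * b) = finTrace Λ (b * a) := by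
  revert b
  refine StarAlgebra.adjoin_induction
    (p := fun a _ => ∀ b, finTrace Λ (a * b) = finTrace Λ (b * a)) ?_ ?_ ?_ ?_ ?_ ha
  · rintro _ ⟨x, hx, i, j, rfl⟩ b
    exact finTrace_matrixUnit_mul Λ hx i j b
  · intro r b
    rw [Algebra.commutes]
  · intro a a' _ _ ha ha' b
    rw [add_mul, mul_add, finTrace_add, finTrace_add, ha, ha']
  · intro a a' _ _ ha ha' b
    rw [mul_assoc, ha, mul_assoc, ha', mul_assoc]
  · intro a _ ha b
    have := ha (star b)
    rw [← star_star (star a * b), ← star_star (b * star a), finTrace_star, finTrace_star (a := star _),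
      star_mul, star_mul, star_star, this]

/-- Taking the trace over one tensor factor first. -/
theorem sum_finTrace_entry {Λ : Finset (Site D)} {x : Site D} (hx : x ∈ Λ) (a : Op D d) :
    ∑ k, finTrace Λ (entry x k k a) = d * finTrace Λ a := by
  have h : ∀ k : Fin d, finTrace Λ (entry x k k a) = d * finTrace Λ (a * matrixUnit x k k) := by
    intro k
    rw [entry, finTrace_sum]
    have : ∀ m : Fin d, finTrace Λ (matrixUnit x m k * a * matrixUnit x k m)
        = finTrace Λ (a * matrixUnit x k k) := fun m => by
      rw [mul_assoc, finTrace_matrixUnit_mul Λ hx, mul_assoc, matrixUnit_mul, if_pos rfl]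
    simp [this]
  simp only [h]
  rw [← Finset.mul_sum, ← finTrace_sum, ← Finset.mul_sum, sum_matrixUnit, mul_one]

/-- On the observables of `X` the averages over volumes containing `X` agree. -/
theorem exists_finTrace_eq (X : Finset (Site D)) :
    ∀ a ∈ localAlg (X : Set (Site D)), ∃ c : ℂ, ∀ Λ, X ⊆ Λ → finTrace Λ (a : Op D d) = c := by
  have hd : (d : ℂ) ≠ 0 := by exact_mod_cast NeZero.ne d
  induction X using Finset.induction_on with
  | empty =>
    intro a ha
    rw [Finset.coe_empty] at ha
    obtain ⟨r, rfl⟩ := mem_localAlg_empty ha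
    exact ⟨r, fun Λ _ => by
      rw [Algebra.algebraMap_eq_smul_one, finTrace_smul, finTrace_one, mul_one]⟩
  | insert x X hx ih =>
    intro a ha
    have h1 : ∀ k, entry x k k a ∈ localAlg (X : Set (Site D)) := fun k =>
      localAlg_mono (fun y hy => by
        have h1 : y ∈ insert x X := hy.1
        exact (Finset.mem_insert.1 h1).resolve_left hy.2) (entry_mem ha x k k)
    choose c hc using fun k => ih _ (h1 k)
    refine ⟨(d : ℂ)⁻¹ * ∑ k, c k, fun Λ hΛ => ?_⟩
    rw [eq_inv_mul_iff_mul_eq₀ hd, ← sum_finTrace_entry (hΛ (Finset.mem_insert_self x X))]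
    exact Finset.sum_congr rfl fun k _ => hc k Λ ((Finset.subset_insert x X).trans hΛ)

/-- On the observables of a finite set the Hilbert–Schmidt norm is equivalent to the operator
norm. -/
theorem exists_norm_sq_le_finTrace (X : Finset (Site D)) :
    ∃ C : ℝ, ∀ a ∈ localAlg (X : Set (Site D)), ∀ Λ, X ⊆ Λ →
      ‖(a : Op D d)‖ ^ 2 ≤ C * (finTrace Λ (star a * a)).re := by
  induction X using Finset.induction_on with
  | empty =>
    refine ⟨1, fun a ha Λ _ => ?_⟩
    rw [Finset.coe_empty] at ha
    obtain ⟨r, rfl⟩ := mem_localAlg_empty ha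
    rw [← algebraMap_star_comm, ← map_mul, Algebra.algebraMap_eq_smul_one,
      Algebra.algebraMap_eq_smul_one, finTrace_smul, finTrace_one, norm_smul, mul_one, one_mul]
    have h1 : ‖(1 : Op D d)‖ ≤ 1 := ContinuousLinearMap.norm_id_le
    have h2 : (star r * r).re = ‖r‖ ^ 2 := by
      rw [Complex.star_def, mul_comm, Complex.mul_conj, Complex.ofReal_re, Complex.normSq_eq_norm_sq]
    rw [h2]
    gcongr
    exact mul_le_of_le_one_right (norm_nonneg _) h1
  | insert x X hx ih =>
    obtain ⟨C, hC⟩ := ih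
    refine ⟨d ^ 3 * C, fun a ha Λ hΛ => ?_⟩
    have h1 : ∀ k l, entry x k l a ∈ localAlg (X : Set (Site D)) := fun k l =>
      localAlg_mono (fun y hy => by
        have h1 : y ∈ insert x X := hy.1
        exact (Finset.mem_insert.1 h1).resolve_left hy.2) (entry_mem ha x k l)
    have hX : X ⊆ Λ := (Finset.subset_insert x X).trans hΛ
    have hn : ‖a‖ ≤ ∑ p : Fin d × Fin d, ‖entry x p.1 p.2 a‖ := by
      conv_lhs => rw [eq_sum_entry x a, ← Fintype.sum_prod_type']
      refine norm_sum_le_of_le _ fun p _ => (norm_mul_le _ _).trans ?_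
      exact mul_le_of_le_one_right (norm_nonneg _) (norm_matrixUnit_le _ _ _)
    calc ‖a‖ ^ 2 ≤ (∑ p : Fin d × Fin d, ‖entry x p.1 p.2 a‖) ^ 2 := by gcongr
      _ ≤ (d ^ 2 : ℝ) * ∑ p : Fin d × Fin d, ‖entry x p.1 p.2 a‖ ^ 2 := by
          refine sq_sum_le_card_mul_sum_sq.trans (le_of_eq ?_)
          simp [sq]
      _ ≤ (d ^ 2 : ℝ) * ∑ p : Fin d × Fin d,
            C * (finTrace Λ (star (entry x p.1 p.2 a) * entry x p.1 p.2 a)).re := by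
          gcongr with p
          exact hC _ (h1 _ _) Λ hX
      _ = (d ^ 2 : ℝ) * (C * (∑ l, finTrace Λ (entry x l l (star a * a))).re) := by
          rw [← Finset.mul_sum, Fintype.sum_prod_type_right, Complex.re_sum]
          simp only [entry_mul, finTrace_sum, star_entry, Complex.re_sum]
      _ = _ := by
          rw [sum_finTrace_entry (hΛ (Finset.mem_insert_self x X))]
          simp
          ring

/-- The limit defining the trace exists on the closure of the local observables. -/
theorem tendsto_finTrace {a : Op D d}
    (ha : a ∈ (localAlg Set.univ : StarSubalgebra ℂ (Op D d)).topologicalClosure) :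
    Tendsto (fun Λ => finTrace Λ a) atTop (𝓝 (trace a)) := by
  rw [trace_eq_limUnder]
  refine CauchySeq.tendsto_limUnder ?_
  rw [Metric.cauchySeq_iff']
  intro ε hε
  obtain ⟨b, hb, hab⟩ := Metric.mem_closure_iff.1 ha (ε / 2) (by positivity)
  obtain ⟨X, hX⟩ := exists_finset_mem_localAlg hb
  obtain ⟨c, hc⟩ := exists_finTrace_eq X b hX
  refine ⟨X, fun Λ hΛ => ?_⟩
  have h : ∀ Λ, X ⊆ Λ → dist (finTrace Λ a) c < ε / 2 := fun Λ hΛ => by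
    rw [dist_eq_norm, ← hc Λ hΛ, ← finTrace_sub]
    exact (norm_finTrace_le _ _).trans_lt (by rwa [← dist_eq_norm])
  calc _ ≤ dist (finTrace Λ a) c + dist (finTrace X a) c := dist_triangle_right _ _ _
    _ < ε := by linarith [h Λ hΛ, h X subset_rfl]

end Trace

/-! ### Translations -/

section Translations

variable {D d : ℕ}

theorem translationUnitary_apply (x : Site D) (ψ : Hilb D d) (σ : Config D d) :
    translationUnitary x ψ σ = ψ fun y => σ (y + x) := rfl

theorem translationUnitary_mul (x y : Site D) :
    (translationUnitary x * translationUnitary y : Op D d) = translationUnitary (x + y) := by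
  ext ψ σ
  change translationUnitary x (translationUnitary y ψ) σ = _
  simp only [translationUnitary_apply]
  refine congrArg (ψ : Config D d → ℂ) (funext fun z => ?_)
  rw [add_assoc, add_comm y x]

theorem translationUnitary_zero : (translationUnitary 0 : Op D d) = 1 := by
  ext ψ σ
  rw [translationUnitary_apply]
  simp

theorem translationUnitary_mul_neg (x : Site D) :
    (translationUnitary x * translationUnitary (-x) : Op D d) = 1 := by
  rw [translationUnitary_mul, add_neg_cancel, translationUnitary_zero]

theorem translationUnitary_neg_mul (x : Site D) :
    (translationUnitary (-x) * translationUnitary x : Op D d) = 1 := by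
  rw [translationUnitary_mul, neg_add_cancel, translationUnitary_zero]

theorem star_translationUnitary (x : Site D) :
    star (translationUnitary x : Op D d) = translationUnitary (-x) := by
  rw [ContinuousLinearMap.star_eq_adjoint]
  symm
  rw [ContinuousLinearMap.eq_adjoint_iff]
  intro ψ φ
  rw [lp.inner_eq_tsum, lp.inner_eq_tsum]
  rw [← (Equiv.arrowCongr (Equiv.subRight x) (Equiv.refl (Fin d))).tsum_eq]
  refine tsum_congr fun σ => ?_
  simp only [translationUnitary_apply]
  refine congrArg (fun c : ℂ => inner ℂ c _) (congrArg (ψ : Config D d → ℂ) (funext fun y => ?_))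
  simp [← sub_eq_add_neg]

theorem translate_zero (a : Op D d) : translate 0 a = a := by
  simp [translate, translationUnitary_zero]

theorem translate_translate (x y : Site D) (a : Op D d) :
    translate x (translate y a) = translate (x + y) a := by
  unfold translate
  rw [neg_add_rev, ← translationUnitary_mul, ← translationUnitary_mul]
  simp only [mul_assoc]

theorem translate_mul (x : Site D) (a b : Op D d) :
    translate x (a * b) = translate x a * translate x b := by
  unfold translate
  calc translationUnitary x * (a * b) * translationUnitary (-x)
      = translationUnitary x * a * 1 * b * translationUnitary (-x) := by
        simp only [mul_assoc, one_mul]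
    _ = _ := by rw [← translationUnitary_neg_mul x]; simp only [mul_assoc]

theorem translate_add (x : Site D) (a b : Op D d) :
    translate x (a + b) = translate x a + translate x b := by
  simp [translate, mul_add, add_mul]

theorem translate_smul (x : Site D) (r : ℂ) (a : Op D d) :
    translate x (r • a) = r • translate x a := by
  simp [translate]

theorem translate_one (x : Site D) : translate x (1 : Op D d) = 1 := by
  rw [translate, mul_one, translationUnitary_mul_neg]

theorem translate_star (x : Site D) (a : Op D d) :
    translate x (star a) = star (translate x a) := by
  simp [translate, star_translationUnitary, mul_assoc]

theorem norm_translate (x : Site D) (a : Op D d) : ‖translate x a‖ = ‖a‖ := by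
  have h : ∀ x : Site D, (translationUnitary x : Op D d) ∈ unitary (Op D d) := fun x => by
    rw [Unitary.mem_iff, star_translationUnitary]
    exact ⟨translationUnitary_neg_mul x, translationUnitary_mul_neg x⟩
  rw [translate, CStarRing.norm_mul_mem_unitary _ (h _), CStarRing.norm_mem_unitary_mul _ (h _)]

theorem translate_matrixUnit (x z : Site D) (i j : Fin d) :
    translate x (matrixUnit z i j : Op D d) = matrixUnit (z + x) i j := by
  ext ψ σ
  change translationUnitary x (matrixUnit z i j (translationUnitary (-x) ψ)) σ = _
  rw [translationUnitary_apply, matrixUnit_apply, matrixUnit_apply, translationUnitary_apply]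
  refine congrArg (fun c : ℂ => if σ (z + x) = i then c else 0)
    (congrArg (ψ : Config D d → ℂ) (funext fun y => ?_))
  by_cases h : y = z + x
  · subst h; simp
  · have h' : y + -x ≠ z := fun e => h (by rw [← e]; abel)
    simp [h, h']

theorem translate_mem {X : Set (Site D)} {a : Op D d} (ha : a ∈ localAlg X) (x : Site D) :
    translate x a ∈ localAlg ((· + x) '' X) := by
  refine StarAlgebra.adjoin_induction (p := fun a _ => translate x a ∈ localAlg ((· + x) '' X))
    ?_ ?_ ?_ ?_ ?_ ha
  · rintro _ ⟨y, hy, i, j, rfl⟩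
    rw [translate_matrixUnit]
    exact matrixUnit_mem (X := (· + x) '' X) ⟨y, hy, rfl⟩ i j
  · intro r
    rw [Algebra.algebraMap_eq_smul_one, translate_smul, translate_one]
    exact SMulMemClass.smul_mem r (one_mem _)
  · intro a b _ _ ha hb
    rw [translate_add]
    exact add_mem ha hb
  · intro a b _ _ ha hb
    rw [translate_mul]
    exact mul_mem ha hb
  · intro a _ ha
    rw [translate_star]
    exact star_mem ha

theorem translate_mem_finset {X : Finset (Site D)} {a : Op D d}
    (ha : a ∈ localAlg (X : Set (Site D))) (x : Site D) :
    translate x a ∈ localAlg ((X.image (· + x) : Finset (Site D)) : Set (Site D)) := by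
  rw [Finset.coe_image]
  exact translate_mem ha x

theorem supp_translate_subset [NeZero d] {a : Op D d} {X : Set (Site D)} (ha : a ∈ localAlg X)
    (x : Site D) : supp (translate x a) ⊆ (· + x) '' supp a := by
  obtain ⟨Y, hY, haY⟩ := exists_supp_eq ha
  rw [hY, ← Finset.coe_image]
  exact supp_subset (translate_mem_finset haY x)

theorem supp_translate [NeZero d] {a : Op D d} {X : Set (Site D)} (ha : a ∈ localAlg X)
    (x : Site D) : supp (translate x a) = (· + x) '' supp a := by
  refine Set.Subset.antisymm (supp_translate_subset ha x) ?_
  have h := supp_translate_subset (translate_mem ha x) (-x)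
  rw [translate_translate, neg_add_cancel, translate_zero] at h
  rintro _ ⟨y, hy, rfl⟩
  obtain ⟨z, hz, rfl⟩ := h hy
  simpa using hz

theorem neighbourhood_eq [NeZero d] {a : Op D d} {X : Set (Site D)} (ha : a ∈ localAlg X)
    {Y : Finset (Site D)} (hY : supp a = Y) (n : ℕ) : neighbourhood a n = nbhd n Y := by
  ext v
  simp only [neighbourhood, Set.mem_iUnion, Set.mem_ofPred_eq, supp_translate ha, hY,
    Finset.mem_coe, mem_nbhd, Set.mem_image, exists_prop]
  constructor
  · rintro ⟨x, hx, y, hy, rfl⟩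
    exact ⟨y, hy, by rwa [add_comm, siteDist_add_left]⟩
  · rintro ⟨y, hy, h⟩
    exact ⟨v - y, by rwa [siteDist_sub_zero], y, hy, by abel⟩

end Translations

/-- The quasi-local algebra is closed in the operators, hence a `C⋆`-algebra. The instance is local
to keep instance resolution on `𝒪.Quasi` unchanged elsewhere. -/
@[reducible] noncomputable def LocalObservables.quasiCStarAlgebra {D d : ℕ}
    (𝒪 : LocalObservables D d) : CStarAlgebra 𝒪.Quasi :=
  have : IsClosed (𝒪.alg.topologicalClosure : Set (Op D d)) :=
    StarSubalgebra.isClosed_topologicalClosure _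
  StarSubalgebra.cstarAlgebra _

attribute [local instance] LocalObservables.quasiCStarAlgebra

namespace LocalObservables

variable {D d : ℕ} (𝒪 : LocalObservables D d)

theorem coe_toQuasi (A : 𝒪.Loc) : ((𝒪.toQuasi A : 𝒪.Quasi) : Op D d) = A := rfl

theorem toQuasi_mul (A B : 𝒪.Loc) : 𝒪.toQuasi (A * B) = 𝒪.toQuasi A * 𝒪.toQuasi B := rfl

theorem toQuasi_add (A B : 𝒪.Loc) : 𝒪.toQuasi (A + B) = 𝒪.toQuasi A + 𝒪.toQuasi B := rfl

theorem toQuasi_sub (A B : 𝒪.Loc) : 𝒪.toQuasi (A - B) = 𝒪.toQuasi A - 𝒪.toQuasi B := rfl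

theorem toQuasi_smul (r : ℂ) (A : 𝒪.Loc) : 𝒪.toQuasi (r • A) = r • 𝒪.toQuasi A := rfl

theorem toQuasi_star (A : 𝒪.Loc) : 𝒪.toQuasi (star A) = star (𝒪.toQuasi A) := rfl

theorem norm_toQuasi (A : 𝒪.Loc) : ‖𝒪.toQuasi A‖ = ‖A‖ := rfl

/-- Translations as automorphisms of the quasi-local algebra. -/
noncomputable def shiftL (x : Site D) : 𝒪.Quasi →L[ℂ] 𝒪.Quasi :=
  LinearMap.mkContinuous
    { toFun := 𝒪.shiftQuasi x
      map_add' := fun a b => Subtype.ext (translate_add x (a : Op D d) (b : Op D d))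
      map_smul' := fun r a => Subtype.ext (translate_smul x r (a : Op D d)) } 1 fun a => by
    rw [one_mul]
    exact (norm_translate x (a : Op D d)).le

theorem shiftL_apply (x : Site D) (a : 𝒪.Quasi) : 𝒪.shiftL x a = 𝒪.shiftQuasi x a := rfl

theorem shiftQuasi_mul (x : Site D) (a b : 𝒪.Quasi) :
    𝒪.shiftQuasi x (a * b) = 𝒪.shiftQuasi x a * 𝒪.shiftQuasi x b :=
  Subtype.ext (translate_mul x (a : Op D d) (b : Op D d))

theorem shiftQuasi_star (x : Site D) (a : 𝒪.Quasi) :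
    𝒪.shiftQuasi x (star a) = star (𝒪.shiftQuasi x a) :=
  Subtype.ext (translate_star x (a : Op D d))

theorem shiftQuasi_shiftQuasi (x y : Site D) (a : 𝒪.Quasi) :
    𝒪.shiftQuasi x (𝒪.shiftQuasi y a) = 𝒪.shiftQuasi (x + y) a :=
  Subtype.ext (translate_translate x y (a : Op D d))

theorem shiftQuasi_zero (a : 𝒪.Quasi) : 𝒪.shiftQuasi 0 a = a :=
  Subtype.ext (translate_zero (a : Op D d))

theorem shiftQuasi_toQuasi (x : Site D) (A : 𝒪.Loc) :
    𝒪.shiftQuasi x (𝒪.toQuasi A) = 𝒪.toQuasi (𝒪.shift x A) := rfl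

theorem shift_mul (x : Site D) (A B : 𝒪.Loc) :
    𝒪.shift x (A * B) = 𝒪.shift x A * 𝒪.shift x B := Subtype.ext (translate_mul x (A : Op D d) (B : Op D d))

theorem shift_add (x : Site D) (A B : 𝒪.Loc) :
    𝒪.shift x (A + B) = 𝒪.shift x A + 𝒪.shift x B := Subtype.ext (translate_add x (A : Op D d) (B : Op D d))

theorem shift_star (x : Site D) (A : 𝒪.Loc) :
    𝒪.shift x (star A) = star (𝒪.shift x A) := Subtype.ext (translate_star x (A : Op D d))

theorem shift_shift (x y : Site D) (A : 𝒪.Loc) :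
    𝒪.shift x (𝒪.shift y A) = 𝒪.shift (x + y) A := Subtype.ext (translate_translate x y (A : Op D d))

theorem shift_zero (A : 𝒪.Loc) : 𝒪.shift 0 A = A := Subtype.ext (translate_zero (A : Op D d))

theorem norm_shift (x : Site D) (A : 𝒪.Loc) : ‖𝒪.shift x A‖ = ‖A‖ := norm_translate x (A : Op D d)

theorem dense_toQuasi (a : 𝒪.Quasi) {ε : ℝ} (hε : 0 < ε) :
    ∃ A : 𝒪.Loc, ‖a - 𝒪.toQuasi A‖ < ε := by
  obtain ⟨b, hb, hab⟩ := Metric.mem_closure_iff.1 a.2 ε hε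
  exact ⟨⟨b, hb⟩, by rw [dist_eq_norm] at hab; exact hab⟩

theorem denseRange_toQuasi : DenseRange 𝒪.toQuasi := fun a =>
  Metric.mem_closure_iff.2 fun ε hε => by
    obtain ⟨A, hA⟩ := 𝒪.dense_toQuasi a hε
    exact ⟨_, ⟨A, rfl⟩, by rwa [dist_eq_norm]⟩

theorem exists_mem_localAlg (A : 𝒪.Loc) :
    ∃ X : Finset (Site D), (A : Op D d) ∈ localAlg (X : Set (Site D)) :=
  exists_finset_mem_localAlg (𝒪.le_localAlg A.2)

/-- The elements of `𝒪` supported in `X`, inside the quasi-local algebra. -/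
noncomputable def locIn (X : Set (Site D)) : StarSubalgebra ℂ 𝒪.Quasi :=
  (𝒪.alg ⊓ localAlg X).comap 𝒪.alg.topologicalClosure.subtype

theorem mem_locIn {X : Set (Site D)} {a : 𝒪.Quasi} :
    a ∈ 𝒪.locIn X ↔ ∃ A : 𝒪.Loc, 𝒪.toQuasi A = a ∧ (A : Op D d) ∈ localAlg X :=
  ⟨fun h => ⟨⟨a, h.1⟩, rfl, h.2⟩, by rintro ⟨A, rfl, h⟩; exact ⟨A.2, h⟩⟩

/-- The net of the local algebras of `𝒪`. -/
noncomputable def net : LocalNet D 𝒪.Quasi where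
  loc := 𝒪.locIn
  mono h _ ha := ⟨ha.1, localAlg_mono h ha.2⟩
  commute h a ha b hb := Subtype.ext (localAlg_commute h ha.2 hb.2)
  closed X := by
    let S : Submodule ℂ (Op D d) :=
      Subalgebra.toSubmodule (𝒪.alg ⊓ localAlg (X : Set (Site D))).toSubalgebra
    have hle : S ≤ Subalgebra.toSubmodule
        (localAlg (X : Set (Site D)) : StarSubalgebra ℂ (Op D d)).toSubalgebra := fun a ha => ha.2
    have : FiniteDimensional ℂ (Subalgebra.toSubmodule
        (localAlg (X : Set (Site D)) : StarSubalgebra ℂ (Op D d)).toSubalgebra) :=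
      finiteDimensional_localAlg X
    have : FiniteDimensional ℂ S := Submodule.finiteDimensional_of_le hle
    exact (Submodule.closed_of_finiteDimensional S).preimage continuous_subtype_val
  dense a ε hε := by
    obtain ⟨A, hA⟩ := 𝒪.dense_toQuasi a hε
    obtain ⟨X, hX⟩ := 𝒪.exists_mem_localAlg A
    exact ⟨X, 𝒪.toQuasi A, 𝒪.mem_locIn.2 ⟨A, rfl, hX⟩, hA⟩

end LocalObservables

namespace LocalObservables

/-! ### Existence and uniqueness of the time evolution -/

section Evolution

variable {D d : ℕ} {𝒪 : LocalObservables D d}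

/-- The interaction whose term at `x` is the translate by `x` of the density `h`. -/
noncomputable def interaction (h : 𝒪.Loc) (hh : star h = h) : Interaction 𝒪.net where
  term x := 𝒪.toQuasi (𝒪.shift x h)
  shape := (𝒪.exists_mem_localAlg h).choose
  range := (𝒪.exists_mem_localAlg h).choose.sup fun z => siteDist z 0
  bound := ‖h‖
  mem_loc x := 𝒪.mem_locIn.2 ⟨_, rfl,
    translate_mem_finset (𝒪.exists_mem_localAlg h).choose_spec x⟩
  shape_le _ hz := Finset.le_sup (f := fun z => siteDist z 0) hz
  selfAdjoint x := by
    rw [IsSelfAdjoint, ← toQuasi_star, ← shift_star, hh]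
  norm_le x := by rw [norm_toQuasi, norm_shift]

/-- On a local observable the commutator with the Hamiltonian of a large volume is the derivation. -/
theorem eventually_bracket_ham (h : 𝒪.Loc) (hh : star h = h) (A : 𝒪.Loc) :
    ∀ᶠ Λ : Finset (Site D) in atTop,
      bracket ((interaction h hh).ham Λ) (𝒪.toQuasi A) = 𝒪.toQuasi (lieAction h A) := by
  obtain ⟨Y, hY⟩ := 𝒪.exists_mem_localAlg A
  have hA : 𝒪.toQuasi A ∈ 𝒪.net.loc Y := 𝒪.mem_locIn.2 ⟨A, rfl, hY⟩
  filter_upwards [eventually_ge_atTop ((interaction h hh).touch Y)] with Λ hΛ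
  rw [(interaction h hh).bracket_ham hA, Finset.inter_eq_right.2 hΛ, lieAction,
    finsum_eq_sum_of_support_subset (s := (interaction h hh).touch Y)]
  · have : ∀ s : Finset (Site D), 𝒪.toQuasi (∑ x ∈ s, (𝒪.shift x h * A - A * 𝒪.shift x h))
        = ∑ x ∈ s, bracket ((interaction h hh).term x) (𝒪.toQuasi A) := fun s => by
      induction s using Finset.induction_on with
      | empty => rfl
      | insert x s hx ih => rw [Finset.sum_insert hx, Finset.sum_insert hx, toQuasi_add, ih]; rfl
    exact (this _).symm
  · intro x hx
    by_contra hx'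
    have := bracket_eq_zero ((interaction h hh).commute_of_notMem_touch hA hx')
    exact hx (Subtype.ext (congrArg (fun b : 𝒪.Quasi => (b : Op D d)) this))

theorem eventually_iterate_bracket_ham (h : 𝒪.Loc) (hh : star h = h) (n : ℕ) (A : 𝒪.Loc) :
    ∀ᶠ Λ : Finset (Site D) in atTop,
      (bracket ((interaction h hh).ham Λ))^[n] (𝒪.toQuasi A) = 𝒪.toQuasi ((lieAction h)^[n] A) := by
  induction n generalizing A with
  | zero => exact .of_forall fun _ => rfl
  | succ n ih =>
    filter_upwards [eventually_bracket_ham h hh A, ih (lieAction h A)] with Λ h1 h2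
    rw [Function.iterate_succ_apply, Function.iterate_succ_apply, h1, h2]

theorem isTimeEvolution_of_limit {h : 𝒪.Loc} {hh : star h = h} {τ : ℝ → 𝒪.Quasi →L[ℂ] 𝒪.Quasi}
    (hτ : (interaction h hh).IsThermodynamicLimit τ) : IsTimeEvolution h τ where
  zero := ContinuousLinearMap.ext fun a => hτ.apply_zero a
  add s t := ContinuousLinearMap.ext fun a => hτ.apply_add s t a
  continuous a := hτ.continuous_apply a
  series := by
    refine ⟨_, (interaction h hh).time_pos, fun t ht A => ?_⟩
    obtain ⟨Y, hY⟩ := 𝒪.exists_mem_localAlg A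
    exact hτ.hasSum_apply ht.le (Y := Y) (𝒪.mem_locIn.2 ⟨A, rfl, hY⟩)
      fun n => eventually_iterate_bracket_ham h hh n A

/-- The power series determines the evolution for small times on a dense set, and the group
property determines it for all times. -/
theorem IsTimeEvolution.unique {h : 𝒪.Loc} {τ τ' : ℝ → 𝒪.Quasi →L[ℂ] 𝒪.Quasi}
    (hτ : IsTimeEvolution h τ) (hτ' : IsTimeEvolution h τ') : τ = τ' := by
  obtain ⟨r, hr, hs⟩ := hτ.series
  obtain ⟨r', hr', hs'⟩ := hτ'.series
  have hr0 : 0 < min r r' / 2 := by positivity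
  funext t
  refine forall_of_doubling (P := fun t => τ t = τ' t) hr0 (fun t ht => ?_) (fun t ih => ?_) t
  · have h1 : |t| < min r r' := ht.trans_lt (half_lt_self (by positivity))
    refine DFunLike.coe_injective (DenseRange.equalizer 𝒪.denseRange_toQuasi (τ t).continuous
      (τ' t).continuous (funext fun A => ?_))
    exact (hs t (h1.trans_le (min_le_left _ _)) A).unique (hs' t (h1.trans_le (min_le_right _ _)) A)
  · rw [hτ.add, hτ'.add, ih]

theorem IsTimeEvolution.isThermodynamicLimit {h : 𝒪.Loc} (hh : star h = h)
    {τ : ℝ → 𝒪.Quasi →L[ℂ] 𝒪.Quasi} (hτ : IsTimeEvolution h τ) :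
    (interaction h hh).IsThermodynamicLimit τ := by
  obtain ⟨τ', hτ'⟩ := (interaction h hh).exists_isThermodynamicLimit
  rwa [hτ.unique (isTimeEvolution_of_limit hτ')]

theorem existsUnique_isTimeEvolution {h : 𝒪.Loc} (hh : star h = h) :
    ∃! τ : ℝ → 𝒪.Quasi →L[ℂ] 𝒪.Quasi, IsTimeEvolution h τ := by
  obtain ⟨τ, hτ⟩ := (interaction h hh).exists_isThermodynamicLimit
  exact ⟨τ, isTimeEvolution_of_limit hτ, fun τ' h' => h'.unique (isTimeEvolution_of_limit hτ)⟩

theorem lieAction_shift (h A : 𝒪.Loc) (x : Site D) :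
    lieAction h (𝒪.shift x A) = 𝒪.shift x (lieAction h A) := by
  let f : 𝒪.Loc ≃+ 𝒪.Loc :=
    { toFun := 𝒪.shift x
      invFun := 𝒪.shift (-x)
      left_inv := fun A => by rw [shift_shift, neg_add_cancel, shift_zero]
      right_inv := fun A => by rw [shift_shift, add_neg_cancel, shift_zero]
      map_add' := 𝒪.shift_add x }
  change _ = f _
  rw [lieAction, lieAction, AddEquiv.map_finsum, ← finsum_comp_equiv (Equiv.addLeft x)]
  refine finsum_congr fun y => ?_
  rw [map_sub]
  change _ = 𝒪.shift x _ - 𝒪.shift x _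
  rw [shift_mul, shift_mul, shift_shift]
  rfl

/-- The evolution commutes with translations, by uniqueness. -/
theorem IsTimeEvolution.apply_shiftQuasi {h : 𝒪.Loc} {τ : ℝ → 𝒪.Quasi →L[ℂ] 𝒪.Quasi}
    (hτ : IsTimeEvolution h τ) (t : ℝ) (x : Site D) (a : 𝒪.Quasi) :
    τ t (𝒪.shiftQuasi x a) = 𝒪.shiftQuasi x (τ t a) := by
  have hlie : ∀ n (A : 𝒪.Loc), (lieAction h)^[n] (𝒪.shift x A) = 𝒪.shift x ((lieAction h)^[n] A) := by
    intro n
    induction n with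
    | zero => exact fun _ => rfl
    | succ n ih =>
      intro A
      rw [Function.iterate_succ_apply, lieAction_shift, ih, Function.iterate_succ_apply]
  have hneg : ∀ a : 𝒪.Quasi, 𝒪.shiftQuasi (-x) (𝒪.shiftQuasi x a) = a := fun a => by
    rw [shiftQuasi_shiftQuasi, neg_add_cancel, shiftQuasi_zero]
  have hconj : IsTimeEvolution h fun t => (𝒪.shiftL (-x)).comp ((τ t).comp (𝒪.shiftL x)) :=
    { zero := by
        ext1 a
        rw [hτ.zero]
        exact hneg a
      add := fun s t => by
        ext1 a
        change 𝒪.shiftQuasi (-x) (τ (s + t) (𝒪.shiftQuasi x a)) = 𝒪.shiftQuasi (-x)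
          (τ s (𝒪.shiftQuasi x (𝒪.shiftQuasi (-x) (τ t (𝒪.shiftQuasi x a)))))
        rw [shiftQuasi_shiftQuasi _ x, add_neg_cancel, shiftQuasi_zero, hτ.add]
        rfl
      continuous := fun a => (𝒪.shiftL (-x)).continuous.comp (hτ.continuous _)
      series := by
        obtain ⟨r, hr, hs⟩ := hτ.series
        refine ⟨r, hr, fun t ht A => ?_⟩
        have h1 := (hs t ht (𝒪.shift x A)).mapL (𝒪.shiftL (-x))
        simp only [map_smul, hlie, shiftL_apply, shiftQuasi_toQuasi, shift_shift, neg_add_cancel,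
          shift_zero] at h1
        exact h1 }
  have h2 := congrFun (hconj.unique hτ) t
  have h3 : 𝒪.shiftQuasi (-x) (τ t (𝒪.shiftQuasi x a)) = τ t a := DFunLike.congr_fun h2 a
  rw [← h3, shiftQuasi_shiftQuasi, add_neg_cancel, shiftQuasi_zero]

end Evolution

end LocalObservables

namespace LocalObservables

/-! ### The trace-orthogonal projections -/

section Projection

variable {D d : ℕ} [NeZero d] (𝒪 : LocalObservables D d)

theorem tendsto_finTrace_quasi (a : 𝒪.Quasi) :
    Tendsto (fun Λ => finTrace Λ (a : Op D d)) atTop (𝓝 (trace (a : Op D d))) :=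
  tendsto_finTrace (StarSubalgebra.topologicalClosure_mono 𝒪.le_localAlg a.2)

/-- The normalized trace on the quasi-local algebra. -/
noncomputable def tr : 𝒪.Quasi →ₗ[ℂ] ℂ where
  toFun a := trace (a : Op D d)
  map_add' a b := tendsto_nhds_unique (𝒪.tendsto_finTrace_quasi (a + b)) (by
    have h := (𝒪.tendsto_finTrace_quasi a).add (𝒪.tendsto_finTrace_quasi b)
    simp only [← finTrace_add] at h
    exact h)
  map_smul' r a := tendsto_nhds_unique (𝒪.tendsto_finTrace_quasi (r • a)) (by
    have h := (𝒪.tendsto_finTrace_quasi a).const_mul r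
    simp only [← finTrace_smul] at h
    exact h)

theorem tr_star (a : 𝒪.Quasi) : 𝒪.tr (star a) = conj (𝒪.tr a) := by
  refine tendsto_nhds_unique (𝒪.tendsto_finTrace_quasi (star a)) ?_
  have h := (Complex.continuous_conj.tendsto _).comp (𝒪.tendsto_finTrace_quasi a)
  refine h.congr fun Λ => ?_
  exact (finTrace_star Λ (a : Op D d)).symm

theorem tr_mul_comm {X : Finset (Site D)} {a : 𝒪.Quasi} (ha : a ∈ 𝒪.locIn X) (b : 𝒪.Quasi) :
    𝒪.tr (a * b) = 𝒪.tr (b * a) := by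
  refine tendsto_nhds_unique (𝒪.tendsto_finTrace_quasi (a * b)) ?_
  refine (𝒪.tendsto_finTrace_quasi (b * a)).congr' ?_
  filter_upwards [eventually_ge_atTop X] with Λ hΛ
  exact (finTrace_mul_comm (localAlg_mono (by exact_mod_cast hΛ) ha.2) (b : Op D d)).symm

/-- The squared Hilbert–Schmidt norm. -/
noncomputable def hs (a : 𝒪.Quasi) : ℝ := (𝒪.tr (star a * a)).re

theorem tendsto_hs (a : 𝒪.Quasi) :
    Tendsto (fun Λ => (finTrace Λ (star (a : Op D d) * (a : Op D d))).re) atTop (𝓝 (𝒪.hs a)) :=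
  (Complex.continuous_re.tendsto _).comp (𝒪.tendsto_finTrace_quasi (star a * a))

theorem hs_nonneg (a : 𝒪.Quasi) : 0 ≤ 𝒪.hs a :=
  ge_of_tendsto' (𝒪.tendsto_hs a) fun Λ => re_finTrace_star_mul_self_nonneg Λ _

theorem hs_mul_le (a b : 𝒪.Quasi) : 𝒪.hs (a * b) ≤ ‖a‖ ^ 2 * 𝒪.hs b :=
  le_of_tendsto_of_tendsto' (𝒪.tendsto_hs (a * b)) ((𝒪.tendsto_hs b).const_mul _)
    fun Λ => re_finTrace_mul_le Λ (a : Op D d) (b : Op D d)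

theorem hs_one : 𝒪.hs 1 = 1 := by
  refine tendsto_nhds_unique (𝒪.tendsto_hs 1) (tendsto_const_nhds.congr fun Λ => ?_)
  change (1 : ℝ) = (finTrace Λ (star (1 : Op D d) * (1 : Op D d))).re
  rw [star_one, mul_one, finTrace_one, Complex.one_re]

theorem exists_norm_sq_le_hs (X : Finset (Site D)) :
    ∃ C : ℝ, ∀ a ∈ 𝒪.locIn X, ‖a‖ ^ 2 ≤ C * 𝒪.hs a := by
  obtain ⟨C, hC⟩ := exists_norm_sq_le_finTrace (d := d) X
  refine ⟨C, fun a ha => ge_of_tendsto ((𝒪.tendsto_hs a).const_mul C) ?_⟩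
  filter_upwards [eventually_ge_atTop X] with Λ hΛ
  exact hC _ ha.2 Λ hΛ

theorem le_of_pow_two_pow_le {x y C : ℝ} (hy : 0 ≤ y)
    (h : ∀ j : ℕ, x ^ 2 ^ j ≤ C * y ^ 2 ^ j) : x ≤ y := by
  by_contra! hlt
  rcases hy.eq_or_lt with rfl | hy
  · have := h 0
    simp at this
    linarith
  · have h1 : 1 < x / y := (one_lt_div hy).2 hlt
    obtain ⟨n, hn⟩ := pow_unbounded_of_one_lt C h1
    have h2 : (x / y) ^ n ≤ (x / y) ^ 2 ^ n := pow_le_pow_right₀ h1.le (Nat.lt_two_pow_self).le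
    rw [div_pow, div_pow] at h2
    rw [div_pow] at hn
    have h3 : x ^ 2 ^ n / y ^ 2 ^ n ≤ C := (div_le_iff₀ (by positivity)).2 (h n)
    linarith

/-- `b` has the same Hilbert–Schmidt products as `a` with all observables of `X`. -/
def SameProducts (X : Finset (Site D)) (a b : 𝒪.Quasi) : Prop :=
  ∀ c ∈ 𝒪.locIn X, 𝒪.tr (c * b) = 𝒪.tr (c * a)

variable {𝒪}

theorem SameProducts.adjoint {X : Finset (Site D)} {a b : 𝒪.Quasi}
    (h : 𝒪.SameProducts X a b) : 𝒪.SameProducts X (star a) (star b) := by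
  intro c hc
  have h1 : ∀ x : 𝒪.Quasi, 𝒪.tr (c * star x) = conj (𝒪.tr (star c * x)) := fun x => by
    rw [tr_mul_comm 𝒪 hc, ← tr_star, star_mul, star_star]
  rw [h1, h1, h _ (star_mem hc)]

/-- `b f` is the Hilbert–Schmidt projection of `a f` onto the observables of `X`. -/
theorem SameProducts.hs_mul_le {X : Finset (Site D)} {a b f : 𝒪.Quasi} (hb : b ∈ 𝒪.locIn X)
    (h : 𝒪.SameProducts X a b) (hf : f ∈ 𝒪.locIn X) : 𝒪.hs (b * f) ≤ ‖a‖ ^ 2 * 𝒪.hs f := by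
  refine le_trans ?_ (𝒪.hs_mul_le a f)
  have hc := h (f * (star f * star b)) (mul_mem hf (mul_mem (star_mem hf) (star_mem hb)))
  have h1 : ∀ x : 𝒪.Quasi, 𝒪.tr (f * (star f * star b) * x)
      = 𝒪.tr (star (b * f) * (x * f)) := fun x => by
    rw [mul_assoc, tr_mul_comm 𝒪 hf, star_mul]
    simp only [mul_assoc]
  rw [h1, h1] at hc
  have h2 : 𝒪.tr (star (a * f) * (b * f)) = conj (𝒪.tr (star (b * f) * (a * f))) := by
    rw [← tr_star, star_mul (star (b * f)), star_star]
  have h3 := 𝒪.hs_nonneg (b * f - a * f)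
  have h4 : 𝒪.hs (b * f - a * f) = 𝒪.hs (a * f) - 𝒪.hs (b * f) := by
    simp only [hs]
    rw [star_sub, sub_mul, mul_sub, mul_sub, map_sub, map_sub, map_sub, h2, ← hc]
    simp only [Complex.sub_re, Complex.conj_re]
    ring
  linarith

/-- Contractivity: left multiplication by `b` on the observables of `X` is bounded by `‖a‖` in
the Hilbert–Schmidt norm; applied to high powers of `b⋆ b` this bounds the operator norm,
since the two norms are equivalent. -/
theorem SameProducts.norm_le {X : Finset (Site D)} {a b : 𝒪.Quasi} (hb : b ∈ 𝒪.locIn X)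
    (h : 𝒪.SameProducts X a b) : ‖b‖ ≤ ‖a‖ := by
  obtain ⟨C, hC⟩ := 𝒪.exists_norm_sq_le_hs X
  set k : 𝒪.Quasi := star b * b with hk
  have hkX : k ∈ 𝒪.locIn X := mul_mem (star_mem hb) hb
  have hpow : ∀ n : ℕ, 𝒪.hs (k ^ n) ≤ (‖a‖ ^ 4) ^ n := by
    intro n
    induction n with
    | zero => simp [hs_one]
    | succ n ih =>
      have h1 := h.hs_mul_le hb (pow_mem hkX n)
      have h2 := h.adjoint.hs_mul_le (star_mem hb) (mul_mem hb (pow_mem hkX n))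
      rw [norm_star, ← mul_assoc, ← hk, ← pow_succ'] at h2
      calc 𝒪.hs (k ^ (n + 1)) ≤ ‖a‖ ^ 2 * (‖a‖ ^ 2 * (‖a‖ ^ 4) ^ n) :=
            h2.trans (mul_le_mul_of_nonneg_left
              (h1.trans (mul_le_mul_of_nonneg_left ih (by positivity))) (by positivity))
        _ = _ := by ring
  have hC0 : 0 ≤ C := by
    have := hC 1 (one_mem _)
    rw [hs_one, mul_one] at this
    exact (sq_nonneg _).trans this
  have hsa : IsSelfAdjoint k := IsSelfAdjoint.star_mul_self b
  have h4 : ‖b‖ ^ 4 ≤ ‖a‖ ^ 4 := by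
    refine le_of_pow_two_pow_le (C := C) (by positivity) fun j => ?_
    have h1 : ‖k ^ 2 ^ j‖ = ‖k‖ ^ 2 ^ j := by
      have := hsa.nnnorm_pow_two_pow j
      exact congrArg NNReal.toReal this
    have h2 : ‖k‖ = ‖b‖ ^ 2 := by rw [hk, CStarRing.norm_star_mul_self, sq]
    have h3 := hC (k ^ 2 ^ j) (pow_mem hkX _)
    rw [h1, h2] at h3
    calc (‖b‖ ^ 4) ^ 2 ^ j = ((‖b‖ ^ 2) ^ 2 ^ j) ^ 2 := by ring
      _ ≤ C * 𝒪.hs (k ^ 2 ^ j) := h3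
      _ ≤ _ := mul_le_mul_of_nonneg_left (hpow _) hC0
  exact le_of_pow_le_pow_left₀ (by norm_num) (norm_nonneg _) h4

variable (𝒪)

instance finiteDimensional_locIn (X : Finset (Site D)) : FiniteDimensional ℂ (𝒪.locIn X) := by
  let f : 𝒪.locIn X →ₗ[ℂ] (localAlg (X : Set (Site D)) : StarSubalgebra ℂ (Op D d)) :=
    { toFun := fun a => ⟨((a : 𝒪.Quasi) : Op D d), a.2.2⟩
      map_add' := fun _ _ => rfl
      map_smul' := fun _ _ => rfl }
  exact FiniteDimensional.of_injective f fun a b hab => by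
    have := congrArg (fun c : (localAlg (X : Set (Site D)) : StarSubalgebra ℂ (Op D d)) =>
      (c : Op D d)) hab
    exact Subtype.ext (Subtype.ext this)

/-- The Hilbert–Schmidt form is nondegenerate on the finite-dimensional algebra of `X`. -/
theorem exists_sameProducts (X : Finset (Site D)) (a : 𝒪.Quasi) :
    ∃ b ∈ 𝒪.locIn X, 𝒪.SameProducts X a b := by
  let ev : 𝒪.Quasi →ₗ[ℂ] Module.Dual ℂ (𝒪.locIn X) :=
    { toFun := fun b =>
        { toFun := fun c => 𝒪.tr ((c : 𝒪.Quasi) * b)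
          map_add' := fun c c' => by
            rw [AddMemClass.coe_add, add_mul, map_add]
          map_smul' := fun r c => by
            rw [SetLike.val_smul, smul_mul_assoc, map_smul]; rfl }
      map_add' := fun b b' => by
        ext c
        change 𝒪.tr (_ * (b + b')) = 𝒪.tr _ + 𝒪.tr _
        rw [mul_add, map_add]
      map_smul' := fun r b => by
        ext c
        change 𝒪.tr (_ * (r • b)) = r • 𝒪.tr _
        rw [mul_smul_comm, map_smul] }
  let T : 𝒪.locIn X →ₗ[ℂ] Module.Dual ℂ (𝒪.locIn X) :=
    ev ∘ₗ (Subalgebra.toSubmodule (𝒪.locIn X).toSubalgebra).subtype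
  have hinj : Function.Injective T := by
    refine (injective_iff_map_eq_zero T).2 fun b hb => ?_
    obtain ⟨C, hC⟩ := 𝒪.exists_norm_sq_le_hs X
    have h1 : 𝒪.tr (star (b : 𝒪.Quasi) * b) = 0 :=
      DFunLike.congr_fun hb (⟨star (b : 𝒪.Quasi), star_mem b.2⟩ : 𝒪.locIn X)
    have h2 := hC b b.2
    rw [hs, h1, Complex.zero_re, mul_zero] at h2
    have h3 : ‖(b : 𝒪.Quasi)‖ = 0 := pow_eq_zero_iff two_ne_zero |>.1 (le_antisymm h2 (sq_nonneg _))
    exact Subtype.ext (norm_eq_zero.1 h3)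
  have hsurj : Function.Surjective T :=
    (LinearMap.injective_iff_surjective_of_finrank_eq_finrank Subspace.dual_finrank_eq.symm).1 hinj
  obtain ⟨b, hb⟩ := hsurj (ev a)
  exact ⟨b, b.2, fun c hc => DFunLike.congr_fun hb (⟨c, hc⟩ : 𝒪.locIn X)⟩

/-- The defining property of the projection, which holds since the projection exists. -/
theorem proj_spec (X : Finset (Site D)) (a : 𝒪.Quasi) :
    𝒪.toQuasi (𝒪.proj X a) ∈ 𝒪.locIn X ∧ 𝒪.SameProducts X a (𝒪.toQuasi (𝒪.proj X a)) := by
  have hex : ∃ b : 𝒪.Loc, (b : Op D d) ∈ localAlg (X : Set (Site D)) ∧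
      ∀ c : 𝒪.Loc, (c : Op D d) ∈ localAlg (X : Set (Site D)) →
        trace (star (c : Op D d) * (b : Op D d)) = trace (star (c : Op D d) * (a : Op D d)) := by
    obtain ⟨b, hb, h⟩ := 𝒪.exists_sameProducts X a
    refine ⟨⟨b, hb.1⟩, hb.2, fun c hc => ?_⟩
    exact h (star (𝒪.toQuasi c)) (star_mem (𝒪.mem_locIn.2 ⟨c, rfl, hc⟩))
  have h := Classical.epsilon_spec hex
  refine ⟨𝒪.mem_locIn.2 ⟨_, rfl, h.1⟩, fun c hc => ?_⟩
  have h2 := h.2 ⟨star (c : Op D d), star_mem hc.1⟩ (star_mem hc.2)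
  rw [star_star] at h2
  exact h2

/-- The projection of `a` is almost as good an approximation of `a` as any local `b`: `proj a - b`
is the projection of `a - b`, and projections are contractive. -/
theorem norm_proj_sub_le (X : Finset (Site D)) (a : 𝒪.Quasi) {b : 𝒪.Quasi} (hb : b ∈ 𝒪.locIn X) :
    ‖𝒪.toQuasi (𝒪.proj X a) - b‖ ≤ ‖a - b‖ := by
  obtain ⟨h1, h2⟩ := 𝒪.proj_spec X a
  refine SameProducts.norm_le (sub_mem h1 hb) fun c hc => ?_
  rw [mul_sub, mul_sub, map_sub, map_sub, h2 c hc]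

end Projection

end LocalObservables

/-! ### States -/

section States

variable {𝔸 : Type*} [CStarAlgebra 𝔸] {ω : 𝔸 →ₗ[ℂ] ℂ}

/-- Positive functionals are hermitian: `ω((a + c)⋆ (a + c))` is real for `c = 1, i`. -/
theorem map_star_of_positive (h1 : ω 1 = 1)
    (hpos : ∀ a : 𝔸, 0 ≤ (ω (star a * a)).re ∧ (ω (star a * a)).im = 0) (a : 𝔸) :
    ω (star a) = conj (ω a) := by
  have h2 := (hpos (a + 1)).2
  have h3 := (hpos (a + Complex.I • 1)).2
  have h0 := (hpos a).2
  simp only [star_add, star_one, add_mul, mul_add, map_add, mul_one, one_mul, h1, star_smul,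
    smul_mul_assoc, mul_smul_comm, map_smul, smul_eq_mul, Complex.star_def, Complex.conj_I,
    Complex.add_im, Complex.mul_im, Complex.neg_re, Complex.neg_im, Complex.I_re, Complex.I_im,
    Complex.one_im, smul_add] at h2 h3
  apply Complex.ext
  · rw [Complex.conj_re]; linarith
  · rw [Complex.conj_im]; linarith

/-- The Cauchy–Schwarz inequality `|ω(a)|² ≤ ω(a⋆ a)`, from positivity on `a - ω(a)`. -/
theorem norm_sq_le_of_positive (h1 : ω 1 = 1)
    (hpos : ∀ a : 𝔸, 0 ≤ (ω (star a * a)).re ∧ (ω (star a * a)).im = 0) (a : 𝔸) :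
    ‖ω a‖ ^ 2 ≤ (ω (star a * a)).re := by
  have h := (hpos (a - ω a • 1)).1
  simp only [star_sub, star_one, sub_mul, mul_sub, map_sub, mul_one, one_mul, h1, star_smul,
    smul_mul_assoc, mul_smul_comm, map_smul, smul_eq_mul, Complex.star_def,
    map_star_of_positive h1 hpos a, Complex.mul_conj, Complex.sub_re, Complex.ofReal_re, smul_sub,
    Complex.normSq_eq_norm_sq, mul_comm (conj (ω a))] at h
  linarith

open scoped ComplexOrder in
theorem norm_le_of_positive (h1 : ω 1 = 1)
    (hpos : ∀ a : 𝔸, 0 ≤ (ω (star a * a)).re ∧ (ω (star a * a)).im = 0) (a : 𝔸) :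
    ‖ω a‖ ≤ ‖a‖ := by
  let _ : PartialOrder 𝔸 := CStarAlgebra.spectralOrder 𝔸
  have : StarOrderedRing 𝔸 := CStarAlgebra.spectralOrderedRing 𝔸
  have h := CStarAlgebra.star_mul_le_algebraMap_norm_sq (a := a)
  obtain ⟨c, hc⟩ := CStarAlgebra.nonneg_iff_eq_star_mul_self.1 (sub_nonneg.2 h)
  have h2 := (hpos c).1
  rw [← hc, map_sub, Algebra.algebraMap_eq_smul_one, ← Complex.coe_smul, map_smul, h1] at h2
  have h3 := norm_sq_le_of_positive h1 hpos a
  refine le_of_pow_le_pow_left₀ two_ne_zero (norm_nonneg _) ?_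
  simp only [smul_eq_mul, mul_one, Complex.sub_re, Complex.ofReal_re] at h2
  linarith

end States

namespace LocalObservables

section Covariance

variable {D d : ℕ} {𝒪 : LocalObservables D d} {ω : 𝒪.Functional}

theorem IsState.map_star (hω : IsState ω) (a : 𝒪.Quasi) : ω (star a) = conj (ω a) :=
  map_star_of_positive hω.1 hω.2 a

theorem IsState.norm_sq_le (hω : IsState ω) (a : 𝒪.Quasi) : ‖ω a‖ ^ 2 ≤ (ω (star a * a)).re :=
  norm_sq_le_of_positive hω.1 hω.2 a

theorem IsState.norm_le (hω : IsState ω) (a : 𝒪.Quasi) : ‖ω a‖ ≤ ‖a‖ :=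
  norm_le_of_positive hω.1 hω.2 a

theorem IsState.continuous (hω : IsState ω) : Continuous ω :=
  (LinearMap.mkContinuous ω 1 fun a => by rw [one_mul]; exact hω.norm_le a).continuous

/-- The truncated correlation of two observables. -/
noncomputable def cov (ω : 𝒪.Functional) (a b : 𝒪.Quasi) : ℂ := ω (a * b) - ω a * ω b

theorem cov_sub_left (a a' b : 𝒪.Quasi) : cov ω (a - a') b = cov ω a b - cov ω a' b := by
  simp only [cov, sub_mul, map_sub]; ring

theorem cov_sub_right (a b b' : 𝒪.Quasi) : cov ω a (b - b') = cov ω a b - cov ω a b' := by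
  simp only [cov, mul_sub, map_sub]; ring

theorem cov_add_left (a a' b : 𝒪.Quasi) : cov ω (a + a') b = cov ω a b + cov ω a' b := by
  simp only [cov, add_mul, map_add]; ring

theorem cov_smul_left (r : ℂ) (a b : 𝒪.Quasi) : cov ω (r • a) b = r * cov ω a b := by
  simp only [cov, smul_mul_assoc, map_smul, smul_eq_mul]; ring

theorem cov_smul_right (r : ℂ) (a b : 𝒪.Quasi) : cov ω a (r • b) = r * cov ω a b := by
  simp only [cov, mul_smul_comm, map_smul, smul_eq_mul]; ring

theorem cov_add_right (a b b' : 𝒪.Quasi) : cov ω a (b + b') = cov ω a b + cov ω a b' := by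
  simp only [cov, mul_add, map_add]; ring

theorem IsState.norm_cov_le (hω : IsState ω) (a b : 𝒪.Quasi) : ‖cov ω a b‖ ≤ 2 * ‖a‖ * ‖b‖ := by
  calc ‖cov ω a b‖ ≤ ‖ω (a * b)‖ + ‖ω a * ω b‖ := norm_sub_le _ _
    _ ≤ ‖a‖ * ‖b‖ + ‖a‖ * ‖b‖ := by
        refine add_le_add ((hω.norm_le _).trans (norm_mul_le _ _)) ?_
        rw [norm_mul]
        exact mul_le_mul (hω.norm_le _) (hω.norm_le _) (norm_nonneg _) (norm_nonneg _)
    _ = _ := by ring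

theorem IsState.norm_cov_sub_cov_le (hω : IsState ω) (a a' b b' : 𝒪.Quasi) :
    ‖cov ω a b - cov ω a' b'‖ ≤ 2 * ‖a - a'‖ * ‖b‖ + 2 * ‖a'‖ * ‖b - b'‖ := by
  have : cov ω a b - cov ω a' b' = cov ω (a - a') b + cov ω a' (b - b') := by
    rw [cov_sub_left, cov_sub_right]; ring
  rw [this]
  exact (norm_add_le _ _).trans (add_le_add (hω.norm_cov_le _ _) (hω.norm_cov_le _ _))

theorem IsState.conj_cov (hω : IsState ω) (a b : 𝒪.Quasi) :
    conj (cov ω a b) = cov ω (star b) (star a) := by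
  rw [cov, cov, ← star_mul, hω.map_star, hω.map_star, hω.map_star, map_sub,
    map_mul (starRingEnd ℂ), mul_comm (conj (ω b))]

theorem IsState.cov_star_self_nonneg (hω : IsState ω) (a : 𝒪.Quasi) :
    0 ≤ (cov ω (star a) a).re := by
  have h := hω.norm_sq_le a
  rw [cov, hω.map_star, mul_comm, Complex.mul_conj, Complex.sub_re, Complex.ofReal_re,
    Complex.normSq_eq_norm_sq]
  linarith

theorem cov_shift (hT : IsTranslationInvariant ω) (x : Site D) (a b : 𝒪.Quasi) :
    cov ω (𝒪.shiftQuasi x a) (𝒪.shiftQuasi x b) = cov ω a b := by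
  rw [cov, ← shiftQuasi_mul, hT, hT, hT]; rfl

theorem IsState.cov_eq_zero_of_supp_eq_empty [NeZero d] (hω : IsState ω) {A : 𝒪.Loc}
    (hA : supp (A : Op D d) = ∅) (b : 𝒪.Quasi) :
    cov ω (𝒪.toQuasi A) b = 0 ∧ cov ω b (𝒪.toQuasi A) = 0 := by
  obtain ⟨Y, hY, hAY⟩ := exists_supp_eq (𝒪.le_localAlg A.2)
  rw [hA] at hY
  rw [← hY] at hAY
  obtain ⟨r, hr⟩ := mem_localAlg_empty hAY
  have h : 𝒪.toQuasi A = r • (1 : 𝒪.Quasi) := Subtype.ext (by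
    rw [coe_toQuasi, hr, Algebra.algebraMap_eq_smul_one]; rfl)
  rw [h, cov_smul_left, cov_smul_right]
  simp [cov, hω.1]

/-- The clustering bound for observables of given finite sets at distance at least `m > 0`. -/
theorem ClusteringBound.norm_cov_le [NeZero d] {p ν a : ℝ} (hω : IsState ω)
    (hc : ClusteringBound p ν a ω) (hp : 0 ≤ p) (hν : 0 ≤ ν) {A B : 𝒪.Loc} {X Y : Finset (Site D)}
    (hA : (A : Op D d) ∈ localAlg (X : Set (Site D)))
    (hB : (B : Op D d) ∈ localAlg (Y : Set (Site D))) {ℓ : ℕ} (hX : X.card < ℓ) (hY : Y.card < ℓ)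
    {m : ℝ} (hm : 0 < m) (hXY : ∀ x ∈ X, ∀ y ∈ Y, m ≤ siteDist x y) :
    ‖cov ω (𝒪.toQuasi A) (𝒪.toQuasi B)‖ ≤ ν * (ℓ : ℝ) ^ a * ‖A‖ * ‖B‖ * m ^ (-p) := by
  have h0 : 0 ≤ ν * (ℓ : ℝ) ^ a * ‖A‖ * ‖B‖ := by positivity
  rcases (supp (A : Op D d)).eq_empty_or_nonempty with hA0 | hA0
  · rw [(hω.cov_eq_zero_of_supp_eq_empty hA0 _).1, norm_zero]; positivity
  rcases (supp (B : Op D d)).eq_empty_or_nonempty with hB0 | hB0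
  · rw [(hω.cov_eq_zero_of_supp_eq_empty hB0 _).2, norm_zero]; positivity
  obtain ⟨f, hf0, hf, h⟩ := hc
  refine (h ℓ A B ((size_le hA).trans_lt hX) ((size_le hB).trans_lt hY) hA0 hB0).trans ?_
  have hne : {n | ∃ x ∈ supp (A : Op D d), ∃ y ∈ supp (B : Op D d), n = siteDist x y}.Nonempty := by
    obtain ⟨x, hx⟩ := hA0
    obtain ⟨y, hy⟩ := hB0
    exact ⟨_, x, hx, y, hy, rfl⟩
  obtain ⟨x, hx, y, hy, hxy⟩ := Nat.sInf_mem hne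
  have hd : m ≤ obsDist (A : Op D d) (B : Op D d) := by
    rw [obsDist, hxy]
    exact hXY x (supp_subset hA hx) y (supp_subset hB hy)
  have hd0 : 0 < obsDist (A : Op D d) (B : Op D d) := by
    have := hm.trans_le hd
    exact_mod_cast this
  exact mul_le_mul_of_nonneg_left ((hf _ hd0).trans
    (Real.rpow_le_rpow_of_nonpos hm hd (by linarith))) h0

end Covariance

/-! ### Clustering of evolved states -/

section Clustering

/-- A radius `n` that grows like a small power of the distance `k`: the size of balls of radius `n`
costs at most a factor `k ^ δ`, and errors exponentially small in `n` are smaller than any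
power of `k`. -/
theorem exists_radius {μ δ : ℝ} (hμ : 0 < μ) (hδ : 0 < δ) (q : ℝ) {b : ℝ} (hb : 0 ≤ b) :
    ∃ K : ℝ, 0 ≤ K ∧ ∀ k : ℕ, 0 < k → ∃ n : ℕ, 4 * n ≤ k ∧
      (2 * (n : ℝ) + 1) ^ b ≤ K * (k : ℝ) ^ δ ∧ Real.exp (-(μ * n)) ≤ K * (k : ℝ) ^ (-q) := by
  -- `n ≈ k ^ θ / 4`, so that `n ^ b` is at most of the order `k ^ (θ b)`
  set θ : ℝ := min 1 (δ / (b + 1)) with hθ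
  have hθ0 : 0 < θ := lt_min one_pos (by positivity)
  have hθ1 : θ ≤ 1 := min_le_left _ _
  have hθb : θ * b ≤ δ := by
    have h1 : θ ≤ δ / (b + 1) := min_le_right _ _
    rw [le_div_iff₀ (by positivity)] at h1
    linarith
  obtain ⟨K, hK0, hK⟩ := exists_rpow_mul_exp_le (|q| / θ) hμ
  refine ⟨max (2 ^ b) (K * 4 ^ (|q| / θ)), by positivity, fun k hk => ?_⟩
  have hk1 : (1 : ℝ) ≤ k := by exact_mod_cast hk
  have hk0 : (0 : ℝ) < k := by positivity
  have hkθ1 : 1 ≤ (k : ℝ) ^ θ := Real.one_le_rpow hk1 hθ0.le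
  have hkθ : (k : ℝ) ^ θ ≤ k := by
    simpa using Real.rpow_le_rpow_of_exponent_le hk1 hθ1
  set n := ⌊(k : ℝ) ^ θ / 4⌋₊ with hn
  have hn1 : (n : ℝ) ≤ (k : ℝ) ^ θ / 4 := Nat.floor_le (by positivity)
  have hn2 : (k : ℝ) ^ θ / 4 < n + 1 := Nat.lt_floor_add_one _
  refine ⟨n, ?_, ?_, ?_⟩
  · have : (4 * n : ℝ) ≤ k := by linarith
    exact_mod_cast this
  · calc (2 * (n : ℝ) + 1) ^ b ≤ (2 * (k : ℝ) ^ θ) ^ b := by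
          gcongr; linarith
      _ = 2 ^ b * (k : ℝ) ^ (θ * b) := by
          rw [Real.mul_rpow (by norm_num) (by positivity), ← Real.rpow_mul hk0.le]
      _ ≤ _ := by
          gcongr
          exact le_max_left _ _
  · have h1 : (k : ℝ) ^ |q| ≤ 4 ^ (|q| / θ) * (1 + (n : ℝ)) ^ (|q| / θ) := by
      rw [← Real.mul_rpow (by norm_num) (by positivity)]
      calc (k : ℝ) ^ |q| = ((k : ℝ) ^ θ) ^ (|q| / θ) := by
            rw [← Real.rpow_mul hk0.le]; congr 1; field_simp
        _ ≤ _ := by gcongr; linarith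
    have h2 : Real.exp (-(μ * n)) ≤ K * 4 ^ (|q| / θ) * (k : ℝ) ^ (-|q|) := by
      rw [Real.rpow_neg hk0.le, ← div_eq_mul_inv, le_div_iff₀ (by positivity)]
      calc Real.exp (-(μ * n)) * (k : ℝ) ^ |q|
          ≤ Real.exp (-(μ * n)) * (4 ^ (|q| / θ) * (1 + (n : ℝ)) ^ (|q| / θ)) := by gcongr
        _ = 4 ^ (|q| / θ) * ((1 + (n : ℝ)) ^ (|q| / θ) * Real.exp (-(μ * n))) := by ring
        _ ≤ 4 ^ (|q| / θ) * K := by gcongr; exact hK n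
        _ = _ := by ring
    refine h2.trans ?_
    gcongr
    · exact le_max_right _ _
    · exact le_abs_self q

variable {D d : ℕ} {𝒪 : LocalObservables D d} {h : 𝒪.Loc}
  {τ : ℝ → 𝒪.Quasi →L[ℂ] 𝒪.Quasi}

theorem evolve_apply (ω : 𝒪.Functional) (t : ℝ) (a : 𝒪.Quasi) : evolve ω τ t a = ω (τ t a) := rfl

theorem IsState.evolve (hh : star h = h) (hτ : IsTimeEvolution h τ) {ω : 𝒪.Functional}
    (hω : IsState ω) (t : ℝ) : IsState (evolve ω τ t) := by
  have hl := hτ.isThermodynamicLimit hh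
  refine ⟨by rw [evolve_apply, hl.map_one, hω.1], fun a => ?_⟩
  rw [evolve_apply, hl.map_mul, hl.map_star]
  exact hω.2 _

theorem IsTranslationInvariant.evolve (hτ : IsTimeEvolution h τ) {ω : 𝒪.Functional}
    (hω : IsTranslationInvariant ω) (t : ℝ) : IsTranslationInvariant (evolve ω τ t) := fun x a => by
  rw [evolve_apply, evolve_apply, hτ.apply_shiftQuasi, hω]

/-- Evolved local observables are exponentially well approximated by observables of `𝒪` in the
neighbourhoods of their supports. -/
theorem exists_loc_approx (hh : star h = h) (hτ : IsTimeEvolution h τ) (T : ℝ) :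
    ∃ (C μ : ℝ) (c : ℕ), 0 ≤ C ∧ 0 < μ ∧ ∀ t, |t| ≤ |T| → ∀ (A : 𝒪.Loc) (Y : Finset (Site D)),
      (A : Op D d) ∈ localAlg (Y : Set (Site D)) → ∀ n : ℕ, ∃ A' : 𝒪.Loc,
        (A' : Op D d) ∈ localAlg (nbhd n Y : Set (Site D)) ∧ ‖A'‖ ≤ ‖A‖ ∧
        ‖τ t (𝒪.toQuasi A) - 𝒪.toQuasi A'‖
          ≤ C * ((Y.card : ℝ) + 1) ^ c * ‖A‖ * Real.exp (-(μ * n)) := by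
  obtain ⟨C, μ, c, hC, hμ, hap⟩ := (hτ.isThermodynamicLimit hh).exists_approx T
  refine ⟨C, μ, c, hC, hμ, fun t ht A Y hA n => ?_⟩
  obtain ⟨a', h1, h2, h3⟩ := hap t ht Y (𝒪.toQuasi A) (𝒪.mem_locIn.2 ⟨A, rfl, hA⟩) n
  obtain ⟨A', rfl, h4⟩ := 𝒪.mem_locIn.1 h1
  exact ⟨A', h4, h2, h3⟩

/-- Evolved states are clustering: both observables are replaced by local approximations in the
neighbourhoods of a radius that is a small power of their distance. -/
theorem exists_clusteringBound_evolve [NeZero d] (hh : star h = h) (hτ : IsTimeEvolution h τ) (T : ℝ)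
    {p q ν a : ℝ} (hp : 0 ≤ p) (hq : q < p) (hν : 0 < ν) (ha : 0 < a) :
    ∃ ν' a' : ℝ, 0 < ν' ∧ 0 < a' ∧ ∀ ω : 𝒪.Functional, IsState ω → ClusteringBound p ν a ω →
      ∀ t, |t| ≤ |T| → ClusteringBound q ν' a' (evolve ω τ t) := by
  have hl := hτ.isThermodynamicLimit hh
  obtain ⟨C, μ, c, hC, hμ, hap⟩ := exists_loc_approx hh hτ T
  obtain ⟨K, hK0, hK⟩ := exists_radius hμ (sub_pos.2 hq) q (b := D * a) (by positivity)
  refine ⟨ν * K * 2 ^ p + 4 * C * K + 2, a + c, by positivity, by positivity,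
    fun ω hω hcl t ht => ?_⟩
  -- the clustering function has to be finite at distance `0`, where only the trivial bound holds
  refine ⟨fun k => if k = 0 then 1 else (k : ℝ) ^ (-q), fun k => ?_, fun k hk => ?_, ?_⟩
  · beta_reduce
    split_ifs <;> positivity
  · beta_reduce
    rw [if_neg hk.ne']
  intro ℓ A B hA hB hA0 hB0
  have hℓ1 : (1 : ℝ) ≤ ℓ := by exact_mod_cast (Nat.zero_le _).trans_lt hA
  have hcov : evolve ω τ t (𝒪.toQuasi (A * B))
      - evolve ω τ t (𝒪.toQuasi A) * evolve ω τ t (𝒪.toQuasi B)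
      = cov ω (τ t (𝒪.toQuasi A)) (τ t (𝒪.toQuasi B)) := by
    rw [evolve_apply, evolve_apply, evolve_apply, toQuasi_mul, hl.map_mul]; rfl
  rw [hcov]
  obtain ⟨α, hα⟩ : ∃ α, ‖A‖ = α := ⟨_, rfl⟩
  obtain ⟨β, hβ⟩ : ∃ β, ‖B‖ = β := ⟨_, rfl⟩
  have hα0 : 0 ≤ α := hα ▸ norm_nonneg A
  have hβ0 : 0 ≤ β := hβ ▸ norm_nonneg B
  have hnA : ‖τ t (𝒪.toQuasi A)‖ = α := (hl.norm_apply t _).trans hα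
  have hnB : ‖τ t (𝒪.toQuasi B)‖ = β := (hl.norm_apply t _).trans hβ
  rw [hα, hβ]
  have hℓa : (ℓ : ℝ) ^ a ≤ (ℓ : ℝ) ^ (a + c) :=
    Real.rpow_le_rpow_of_exponent_le hℓ1 (by simp)
  have hℓc : (ℓ : ℝ) ^ c ≤ (ℓ : ℝ) ^ (a + c) := by
    rw [← Real.rpow_natCast]
    exact Real.rpow_le_rpow_of_exponent_le hℓ1 (by linarith)
  set k := obsDist (A : Op D d) (B : Op D d) with hk
  beta_reduce
  by_cases hk0 : k = 0
  · rw [if_pos hk0, mul_one]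
    have h1 : (2 : ℝ) ≤ (ν * K * 2 ^ p + 4 * C * K + 2) * (ℓ : ℝ) ^ (a + c) := by
      have h2 : (1 : ℝ) ≤ (ℓ : ℝ) ^ (a + c) := Real.one_le_rpow hℓ1 (by positivity)
      have h3 : (0 : ℝ) ≤ ν * K * 2 ^ p + 4 * C * K := by positivity
      nlinarith
    calc _ ≤ 2 * α * β := by
          refine (hω.norm_cov_le _ _).trans ?_
          rw [hnA, hnB]
      _ ≤ _ := by gcongr
  rw [if_neg hk0]
  obtain ⟨YA, hsA, hYA⟩ := exists_supp_eq (𝒪.le_localAlg A.2)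
  obtain ⟨YB, hsB, hYB⟩ := exists_supp_eq (𝒪.le_localAlg B.2)
  have hcA : YA.card < ℓ := by rwa [size, hsA, Set.ncard_coe_finset] at hA
  have hcB : YB.card < ℓ := by rwa [size, hsB, Set.ncard_coe_finset] at hB
  obtain ⟨n, hn1, hn2, hn3⟩ := hK k (Nat.pos_of_ne_zero hk0)
  obtain ⟨A', hA1, hA2, hA3⟩ := hap t ht A YA hYA n
  obtain ⟨B', hB1, hB2, hB3⟩ := hap t ht B YB hYB n
  rw [hα] at hA2 hA3
  rw [hβ] at hB2 hB3
  have hkpos : (0 : ℝ) < k := by exact_mod_cast Nat.pos_of_ne_zero hk0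
  -- the correlation of the local approximations
  have hloc : ‖cov ω (𝒪.toQuasi A') (𝒪.toQuasi B')‖
      ≤ ν * K * 2 ^ p * (ℓ : ℝ) ^ a * α * β * (k : ℝ) ^ (-q) := by
    have hcard : ∀ Y : Finset (Site D), Y.card < ℓ → (nbhd n Y).card < ℓ * (2 * n + 1) ^ D :=
      fun Y hY => (card_nbhd_le n Y).trans_lt (Nat.mul_lt_mul_of_pos_right hY (by positivity))
    have hdist : ∀ x ∈ nbhd n YA, ∀ y ∈ nbhd n YB, (k : ℝ) / 2 ≤ siteDist x y := by
      intro x hx y hy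
      obtain ⟨x', hx', hxx⟩ := mem_nbhd.1 hx
      obtain ⟨y', hy', hyy⟩ := mem_nbhd.1 hy
      have h1 : k ≤ siteDist x' y' := Nat.sInf_le ⟨x', by rw [hsA]; exact hx', y',
        by rw [hsB]; exact hy', rfl⟩
      have h2 := siteDist_triangle x' x y'
      have h3 := siteDist_triangle x y y'
      rw [siteDist_comm x' x] at h2
      have h4 : k ≤ 2 * siteDist x y := by omega
      have h5 : (k : ℝ) ≤ 2 * siteDist x y := by exact_mod_cast h4
      linarith
    refine (hcl.norm_cov_le hω hp hν.le hA1 hB1 (hcard _ hcA) (hcard _ hcB) (half_pos hkpos)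
      hdist).trans ?_
    have h1 : ((ℓ * (2 * n + 1) ^ D : ℕ) : ℝ) ^ a = (ℓ : ℝ) ^ a * (2 * (n : ℝ) + 1) ^ (D * a) := by
      push_cast
      rw [Real.mul_rpow (by positivity) (by positivity), ← Real.rpow_natCast,
        ← Real.rpow_mul (by positivity)]
    have h2 : ((k : ℝ) / 2) ^ (-p) = 2 ^ p * (k : ℝ) ^ (-p) := by
      rw [Real.div_rpow hkpos.le (by norm_num), Real.rpow_neg (by norm_num : (0 : ℝ) ≤ 2)]
      field_simp
    rw [h1, h2]
    calc _ ≤ ν * ((ℓ : ℝ) ^ a * (K * (k : ℝ) ^ (p - q))) * α * β * (2 ^ p * (k : ℝ) ^ (-p)) := by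
          gcongr
      _ = ν * K * 2 ^ p * (ℓ : ℝ) ^ a * α * β * ((k : ℝ) ^ (p - q) * (k : ℝ) ^ (-p)) := by ring
      _ = _ := by
          rw [← Real.rpow_add hkpos]
          congr 2
          ring
  -- the error of the approximations
  have herr : ∀ (m : ℕ) (e δ : ℝ), 0 ≤ e → m < ℓ →
      δ ≤ C * ((m : ℝ) + 1) ^ c * e * Real.exp (-(μ * n)) →
      δ ≤ C * K * (ℓ : ℝ) ^ c * e * (k : ℝ) ^ (-q) := by
    intro m e δ he hm hδ
    have h1 : (m : ℝ) + 1 ≤ ℓ := by exact_mod_cast hm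
    calc δ ≤ C * ((m : ℝ) + 1) ^ c * e * Real.exp (-(μ * n)) := hδ
      _ ≤ C * (ℓ : ℝ) ^ c * e * (K * (k : ℝ) ^ (-q)) := by gcongr
      _ = _ := by ring
  have hdiff : ‖cov ω (τ t (𝒪.toQuasi A)) (τ t (𝒪.toQuasi B))
      - cov ω (𝒪.toQuasi A') (𝒪.toQuasi B')‖
      ≤ 4 * C * K * (ℓ : ℝ) ^ c * α * β * (k : ℝ) ^ (-q) := by
    refine (hω.norm_cov_sub_cov_le _ _ _ _).trans ?_
    rw [hnB, norm_toQuasi]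
    calc _ ≤ 2 * (C * K * (ℓ : ℝ) ^ c * α * (k : ℝ) ^ (-q)) * β
          + 2 * α * (C * K * (ℓ : ℝ) ^ c * β * (k : ℝ) ^ (-q)) := by
          gcongr
          · exact herr _ _ _ hα0 hcA hA3
          · exact herr _ _ _ hβ0 hcB hB3
      _ = _ := by ring
  calc ‖cov ω (τ t (𝒪.toQuasi A)) (τ t (𝒪.toQuasi B))‖
      ≤ 4 * C * K * (ℓ : ℝ) ^ c * α * β * (k : ℝ) ^ (-q)
        + ν * K * 2 ^ p * (ℓ : ℝ) ^ a * α * β * (k : ℝ) ^ (-q) := by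
        refine (norm_le_norm_sub_add _ (cov ω (𝒪.toQuasi A') (𝒪.toQuasi B'))).trans ?_
        exact add_le_add hdiff hloc
    _ ≤ 4 * C * K * (ℓ : ℝ) ^ (a + c) * α * β * (k : ℝ) ^ (-q)
        + ν * K * 2 ^ p * (ℓ : ℝ) ^ (a + c) * α * β * (k : ℝ) ^ (-q)
        + 2 * (ℓ : ℝ) ^ (a + c) * α * β * (k : ℝ) ^ (-q) := by
        have : 0 ≤ 2 * (ℓ : ℝ) ^ (a + c) * α * β * (k : ℝ) ^ (-q) := by positivity
        refine le_add_of_le_of_nonneg ?_ this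
        gcongr
    _ = _ := by ring

/-- The constants are uniform over bounded sets of times. -/
theorem UniformlySizablyClustering.evolve [NeZero d] (hh : star h = h) (hτ : IsTimeEvolution h τ) {p q : ℝ}
    (hp : 0 ≤ p) (hq : q < p) {S : Set 𝒪.Functional} (hS : UniformlySizablyClustering p S)
    {K : Set ℝ} (hK : Bornology.IsBounded K) :
    UniformlySizablyClustering q {ω' | ∃ ω ∈ S, ∃ t ∈ K, ω' = evolve ω τ t} := by
  obtain ⟨ν, a, hν, ha, hS⟩ := hS
  obtain ⟨T, hT⟩ := hK.exists_norm_le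
  obtain ⟨ν', a', hν', ha', hcl⟩ := exists_clusteringBound_evolve hh hτ T hp hq hν ha
  refine ⟨ν', a', hν', ha', ?_⟩
  rintro _ ⟨ω, hω, t, ht, rfl⟩
  obtain ⟨h1, h2, h3⟩ := hS ω hω
  exact ⟨h1.evolve hh hτ t, h2.evolve hτ t, hcl ω h1 h3 t ((hT t ht).trans (le_abs_self T))⟩

theorem SizablyClustering.evolve [NeZero d] (hh : star h = h) (hτ : IsTimeEvolution h τ) {p q : ℝ}
    (hp : 0 ≤ p) (hq : q < p) {ω : 𝒪.Functional} (hω : SizablyClustering p ω) (t : ℝ) :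
    SizablyClustering q (evolve ω τ t) := by
  have h := UniformlySizablyClustering.evolve hh hτ hp hq hω (Bornology.isBounded_singleton (x := t))
  obtain ⟨ν, a, hν, ha, hS⟩ := h
  refine ⟨ν, a, hν, ha, ?_⟩
  rintro _ rfl
  exact hS _ ⟨ω, rfl, t, rfl, rfl⟩

end Clustering

end LocalObservables

/-! ### Averages over boxes -/

section Boxes

variable {D : ℕ}

/-- The box `{0, …, N - 1} ^ D`. -/
noncomputable def box (D N : ℕ) : Finset (Site D) := Fintype.piFinset fun _ => Finset.Ico (0 : ℤ) N

theorem card_box (N : ℕ) : (box D N).card = N ^ D := by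
  simp [box]

theorem card_box_inter (N : ℕ) (z : Site D) :
    ((box D N).filter fun x => x - z ∈ box D N).card = ∏ i, (N - |z i|).toNat := by
  have : ((box D N).filter fun x => x - z ∈ box D N)
      = Fintype.piFinset fun i => Finset.Ico (max 0 (z i)) (min N (N + z i)) := by
    ext x
    simp only [box, Finset.mem_filter, Fintype.mem_piFinset, Finset.mem_Ico, Pi.sub_apply,
      ← forall_and]
    refine forall_congr' fun i => ?_
    omega
  rw [this, Fintype.card_piFinset]
  refine Finset.prod_congr rfl fun i _ => ?_
  rw [Int.card_Ico]
  congr 1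
  rcases abs_cases (z i) with ⟨h, _⟩ | ⟨h, _⟩ <;> omega

/-- Boxes are asymptotically invariant under translations. -/
theorem tendsto_card_box_inter_div (z : Site D) :
    Tendsto (fun N : ℕ => (((box D N).filter fun x => x - z ∈ box D N).card : ℝ)
      / (box D N).card) atTop (𝓝 1) := by
  have h : ∀ i, Tendsto (fun N : ℕ => (((N - |z i|).toNat : ℕ) : ℝ) / N) atTop (𝓝 1) := by
    intro i
    have h1 : Tendsto (fun N : ℕ => 1 - ((|z i| : ℤ) : ℝ) / N) atTop (𝓝 (1 - 0)) :=
      tendsto_const_nhds.sub (tendsto_const_div_atTop_nhds_zero_nat _)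
    rw [sub_zero] at h1
    refine h1.congr' ?_
    filter_upwards [eventually_ge_atTop (|z i|.toNat + 1)] with N hN
    have h2 : (((N - |z i|).toNat : ℕ) : ℤ) = N - |z i| := Int.toNat_of_nonneg (by omega)
    have h3 : (((N - |z i|).toNat : ℕ) : ℝ) = N - ((|z i| : ℤ) : ℝ) := by
      exact_mod_cast congrArg (Int.cast : ℤ → ℝ) h2
    have h4 : (N : ℝ) ≠ 0 := by
      have : N ≠ 0 := by omega
      exact_mod_cast this
    rw [h3, sub_div, div_self h4]
  have h5 := tendsto_finsetProd (Finset.univ : Finset (Fin D)) fun i _ => h i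
  rw [Finset.prod_const_one] at h5
  refine h5.congr fun N => ?_
  rw [card_box_inter, card_box, Finset.prod_div_distrib]
  simp

/-- A summable function of positive type on the lattice has a nonnegative sum: the sum is the limit
of its averages over boxes. -/
theorem re_tsum_nonneg_of_positive_type {g : Site D → ℂ} (hg : Summable fun z => ‖g z‖)
    (hpos : ∀ Λ : Finset (Site D), 0 ≤ (∑ x ∈ Λ, ∑ y ∈ Λ, g (x - y)).re) :
    0 ≤ (∑' z, g z).re := by
  classical
  have hsum : ∀ Λ : Finset (Site D), ∑ x ∈ Λ, ∑ y ∈ Λ, g (x - y)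
      = ∑' z, ((Λ.filter fun x => x - z ∈ Λ).card : ℂ) * g z := by
    intro Λ
    have h1 : ∀ x, HasSum (fun z => if x - z ∈ Λ then g z else 0) (∑ y ∈ Λ, g (x - y)) := by
      intro x
      rw [← (Equiv.subLeft x).hasSum_iff]
      have h2 : (∑ y ∈ Λ, g (x - y)) = ∑ y ∈ Λ, if y ∈ Λ then g (x - y) else 0 :=
        Finset.sum_congr rfl fun y hy => by rw [if_pos hy]
      rw [h2]
      have h3 : (fun z => if x - z ∈ Λ then g z else 0) ∘ (Equiv.subLeft x)
          = fun y => if y ∈ Λ then g (x - y) else 0 := by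
        funext y
        simp
      rw [h3]
      exact hasSum_sum_of_ne_finset_zero fun y hy => if_neg hy
    have h2 := (hasSum_sum fun x (_ : x ∈ Λ) => h1 x).tsum_eq
    rw [← h2]
    refine tsum_congr fun z => ?_
    rw [Finset.sum_ite, Finset.sum_const_zero, add_zero, Finset.sum_const, nsmul_eq_mul]
  have hlim : Tendsto (fun N : ℕ => ∑' z, ((((box D N).filter fun x => x - z ∈ box D N).card
      / (box D N).card : ℝ) : ℂ) * g z) atTop (𝓝 (∑' z, ((1 : ℝ) : ℂ) * g z)) := by
    refine tendsto_tsum_of_dominated_convergence hg (fun z => ?_) (Eventually.of_forall fun N z => ?_)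
    · exact ((Complex.continuous_ofReal.tendsto _).comp (tendsto_card_box_inter_div z)).mul_const _
    · rw [norm_mul, Complex.norm_real, Real.norm_of_nonneg (by positivity)]
      refine mul_le_of_le_one_left (norm_nonneg _) (div_le_one_of_le₀ ?_ (by positivity))
      exact_mod_cast Finset.card_filter_le _ _
  simp only [Complex.ofReal_one, one_mul] at hlim
  refine ge_of_tendsto' ((Complex.continuous_re.tendsto _).comp hlim) fun N => ?_
  have h1 : (∑' z, ((((box D N).filter fun x => x - z ∈ box D N).card / (box D N).card : ℝ) : ℂ)
      * g z) = (((box D N).card : ℝ)⁻¹ : ℝ) * ∑ x ∈ box D N, ∑ y ∈ box D N, g (x - y) := by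
    rw [hsum, ← tsum_mul_left]
    refine tsum_congr fun z => ?_
    push_cast
    ring
  rw [Function.comp_apply, h1, Complex.re_ofReal_mul]
  exact mul_nonneg (by positivity) (hpos _)

end Boxes

namespace LocalObservables

/-! ### The forms of a clustering state -/

section Forms

variable {D d : ℕ} {𝒪 : LocalObservables D d} {ω : 𝒪.Functional}

theorem form_eq_tsum (hT : IsTranslationInvariant ω) (A B : 𝒪.Loc) :
    form ω A B = ∑' x, cov ω (star (𝒪.shiftQuasi x (𝒪.toQuasi A))) (𝒪.toQuasi B) := by
  refine tsum_congr fun x => ?_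
  rw [cov, ← shiftQuasi_star, hT, shiftQuasi_star]
  rfl

/-- Hermitian symmetry of the form, by translation invariance and the reflection `x ↦ -x`. -/
theorem IsState.conj_form (hω : IsState ω) (hT : IsTranslationInvariant ω) (A B : 𝒪.Loc) :
    conj (form ω B A) = form ω A B := by
  rw [form_eq_tsum hT, form_eq_tsum hT, Complex.conj_tsum, ← (Equiv.neg (Site D)).tsum_eq]
  refine tsum_congr fun x => ?_
  rw [Equiv.neg_apply, hω.conj_cov, star_star, ← cov_shift hT x, shiftQuasi_shiftQuasi,
    add_neg_cancel, shiftQuasi_zero, shiftQuasi_star]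

theorem inner_coset (h : IsPosSemidefForm (symForm ω)) (A B : 𝒪.Loc) :
    inner ℂ (coset ω A) (coset ω B) = symForm ω A B :=
  (UniformSpace.Completion.inner_coe _ _).trans (if_pos h)

theorem coset_sub (A B : 𝒪.Loc) : coset ω (A - B) = coset ω A - coset ω B :=
  UniformSpace.Completion.coe_sub _ _

theorem norm_star_loc (A : 𝒪.Loc) : ‖star A‖ = ‖A‖ := norm_star (A : Op D d)

theorem exists_mem_ball [NeZero d] (A : 𝒪.Loc) :
    ∃ m₀ : ℕ, ∀ m, m₀ ≤ m → (A : Op D d) ∈ localAlg (ball D m : Set (Site D)) := by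
  obtain ⟨Y, -, hY⟩ := exists_supp_eq (𝒪.le_localAlg A.2)
  refine ⟨Y.sup fun x => siteDist x 0, fun m hm => localAlg_mono (fun x hx => ?_) hY⟩
  exact mem_ball.2 ((Finset.le_sup (f := fun x => siteDist x 0) hx).trans hm)

/-- The terms of the form decay like `|x| ^ (-p)`, at the cost of a power of the radius `m` of the
supports, uniformly in the state. For `|x| ≤ 4 m` the trivial bound is of this form; otherwise the
supports have distance at least `|x| / 2`. -/
theorem exists_norm_cov_shift_le [NeZero d] {p ν a : ℝ} (hp : 0 ≤ p) (hν : 0 < ν) (ha : 0 < a) :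
    ∃ G s : ℝ, 0 ≤ G ∧ ∀ ω : 𝒪.Functional, IsState ω → ClusteringBound p ν a ω →
      ∀ (m : ℕ) (A B : 𝒪.Loc), (A : Op D d) ∈ localAlg (ball D m : Set (Site D)) →
      (B : Op D d) ∈ localAlg (ball D m : Set (Site D)) → ∀ x,
      ‖cov ω (star (𝒪.shiftQuasi x (𝒪.toQuasi A))) (𝒪.toQuasi B)‖
        ≤ G * (1 + m) ^ s * ‖A‖ * ‖B‖ * (1 + (siteDist x 0 : ℝ)) ^ (-p) := by
  refine ⟨ν * (2 ^ (D + 1)) ^ a * 4 ^ p + 2 * 4 ^ p, D * a + p, by positivity,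
    fun ω hω hc m A B hA hB x => ?_⟩
  have hm1 : (1 : ℝ) ≤ 1 + m := by simp
  have hm0 : (0 : ℝ) < 1 + m := by positivity
  have hx0 : (0 : ℝ) < 1 + (siteDist x 0 : ℝ) := by positivity
  have hs1 : (1 + m : ℝ) ^ (D * a) ≤ (1 + m : ℝ) ^ (D * a + p) :=
    Real.rpow_le_rpow_of_exponent_le hm1 (by linarith)
  have hs2 : (1 + m : ℝ) ^ p ≤ (1 + m : ℝ) ^ (D * a + p) :=
    Real.rpow_le_rpow_of_exponent_le hm1 (le_add_of_nonneg_left (by positivity))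
  obtain ⟨α, hα⟩ : ∃ α, ‖A‖ = α := ⟨_, rfl⟩
  obtain ⟨β, hβ⟩ : ∃ β, ‖B‖ = β := ⟨_, rfl⟩
  have hα0 : 0 ≤ α := hα ▸ norm_nonneg A
  have hβ0 : 0 ≤ β := hβ ▸ norm_nonneg B
  have hnA : ‖star (𝒪.shift x A)‖ = α := by rw [norm_star_loc, norm_shift, hα]
  rw [shiftQuasi_toQuasi, ← toQuasi_star, hα, hβ]
  rcases le_or_gt (siteDist x 0) (4 * m) with hx | hx
  · have h1 : (1 : ℝ) ≤ 4 ^ p * (1 + m) ^ p * (1 + (siteDist x 0 : ℝ)) ^ (-p) := by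
      rw [Real.rpow_neg hx0.le, ← div_eq_mul_inv, le_div_iff₀ (by positivity), one_mul,
        ← Real.mul_rpow (by norm_num) hm0.le]
      have h2 : (siteDist x 0 : ℝ) ≤ 4 * m := by exact_mod_cast hx
      exact Real.rpow_le_rpow hx0.le (by linarith) hp
    have h2 : (0 : ℝ) ≤ ν * (2 ^ (D + 1)) ^ a * 4 ^ p := by positivity
    refine (hω.norm_cov_le _ _).trans ?_
    rw [norm_toQuasi, norm_toQuasi, hnA, hβ]
    calc 2 * α * β = 2 * α * β * 1 := (mul_one _).symm
      _ ≤ 2 * α * β * (4 ^ p * (1 + m) ^ p * (1 + (siteDist x 0 : ℝ)) ^ (-p)) := by gcongr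
      _ ≤ 2 * α * β * (4 ^ p * (1 + m) ^ (D * a + p) * (1 + (siteDist x 0 : ℝ)) ^ (-p)) := by gcongr
      _ = (0 + 2 * 4 ^ p) * (1 + m) ^ (D * a + p) * α * β * (1 + (siteDist x 0 : ℝ)) ^ (-p) := by ring
      _ ≤ _ := by gcongr
  · have hA' : ((star (𝒪.shift x A) : 𝒪.Loc) : Op D d)
        ∈ localAlg (((ball D m).image (· + x) : Finset (Site D)) : Set (Site D)) :=
      star_mem (translate_mem_finset hA x)
    have hdist : ∀ y ∈ (ball D m).image (· + x), ∀ z ∈ ball D m,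
        (1 + (siteDist x 0 : ℝ)) / 4 ≤ siteDist y z := by
      intro y hy z hz
      obtain ⟨w, hw, rfl⟩ := Finset.mem_image.1 hy
      have h1 := mem_ball.1 hw
      have h2 := mem_ball.1 hz
      have h3 := siteDist_triangle x (w + x) 0
      have h4 := siteDist_triangle (w + x) z 0
      rw [siteDist_comm x (w + x), siteDist_add_left] at h3
      have h5 : 1 + siteDist x 0 ≤ 4 * siteDist (w + x) z := by omega
      have h6 : (1 + siteDist x 0 : ℝ) ≤ 4 * siteDist (w + x) z := by exact_mod_cast h5
      linarith
    have hcard : (ball D m).card < (2 * m + 1) ^ D + 1 := Nat.lt_succ_of_le (card_ball_le m)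
    refine (hc.norm_cov_le hω hp hν.le hA' hB (Finset.card_image_le.trans_lt hcard) hcard
      (by positivity) hdist).trans ?_
    rw [hnA, hβ]
    have h1 : (((2 * m + 1) ^ D + 1 : ℕ) : ℝ) ^ a ≤ (2 ^ (D + 1)) ^ a * (1 + m) ^ (D * a) := by
      rw [Real.rpow_mul hm0.le, Real.rpow_natCast, ← Real.mul_rpow (by positivity) (by positivity)]
      refine Real.rpow_le_rpow (by positivity) ?_ ha.le
      have h2 : (2 * (m : ℝ) + 1) ^ D ≤ 2 ^ D * (1 + m) ^ D := by
        rw [← mul_pow]; gcongr; linarith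
      have h3 : (1 : ℝ) ≤ 2 ^ D * (1 + m) ^ D :=
        one_le_mul_of_one_le_of_one_le (one_le_pow₀ (by norm_num)) (one_le_pow₀ hm1)
      push_cast
      rw [pow_succ]
      linarith
    have h2 : ((1 + (siteDist x 0 : ℝ)) / 4) ^ (-p) = 4 ^ p * (1 + (siteDist x 0 : ℝ)) ^ (-p) := by
      rw [Real.div_rpow hx0.le (by norm_num), Real.rpow_neg (by norm_num : (0 : ℝ) ≤ 4)]
      field_simp
    rw [h2]
    calc _ ≤ ν * ((2 ^ (D + 1)) ^ a * (1 + m) ^ (D * a + p)) * α * β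
          * (4 ^ p * (1 + (siteDist x 0 : ℝ)) ^ (-p)) := by
          gcongr
          exact h1.trans (by gcongr)
      _ = (ν * (2 ^ (D + 1)) ^ a * 4 ^ p + 0) * (1 + m) ^ (D * a + p) * α * β
          * (1 + (siteDist x 0 : ℝ)) ^ (-p) := by ring
      _ ≤ _ := by gcongr; positivity

variable [NeZero d] {p ν a : ℝ}

theorem summable_cov_shift (hp : (D : ℝ) < p) (hν : 0 < ν) (ha : 0 < a) (hω : IsState ω)
    (hc : ClusteringBound p ν a ω) (A B : 𝒪.Loc) :
    Summable fun x => ‖cov ω (star (𝒪.shiftQuasi x (𝒪.toQuasi A))) (𝒪.toQuasi B)‖ := by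
  obtain ⟨G, s, -, h⟩ := exists_norm_cov_shift_le (𝒪 := 𝒪) (D.cast_nonneg.trans hp.le) hν ha
  obtain ⟨m₁, h₁⟩ := exists_mem_ball A
  obtain ⟨m₂, h₂⟩ := exists_mem_ball B
  exact Summable.of_nonneg_of_le (fun _ => norm_nonneg _)
    (h ω hω hc (max m₁ m₂) A B (h₁ _ (le_max_left _ _)) (h₂ _ (le_max_right _ _)))
    ((summable_siteDist_rpow hp).mul_left _)

theorem re_form_self_nonneg (hp : (D : ℝ) < p) (hν : 0 < ν) (ha : 0 < a) (hω : IsState ω)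
    (hT : IsTranslationInvariant ω) (hc : ClusteringBound p ν a ω) (A : 𝒪.Loc) :
    0 ≤ (form ω A A).re := by
  rw [form_eq_tsum hT]
  refine re_tsum_nonneg_of_positive_type (summable_cov_shift hp hν ha hω hc A A) fun Λ => ?_
  -- the double sum is the variance of the sum of the translates of `A`
  have h1 : ∀ x y : Site D, cov ω (star (𝒪.shiftQuasi (x - y) (𝒪.toQuasi A))) (𝒪.toQuasi A)
      = cov ω (star (𝒪.shiftQuasi x (𝒪.toQuasi A))) (𝒪.shiftQuasi y (𝒪.toQuasi A)) := by
    intro x y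
    rw [← cov_shift hT y, shiftQuasi_star, shiftQuasi_shiftQuasi, add_sub_cancel]
  have h2 : ∑ x ∈ Λ, ∑ y ∈ Λ, cov ω (star (𝒪.shiftQuasi (x - y) (𝒪.toQuasi A))) (𝒪.toQuasi A)
      = cov ω (star (∑ x ∈ Λ, 𝒪.shiftQuasi x (𝒪.toQuasi A)))
        (∑ x ∈ Λ, 𝒪.shiftQuasi x (𝒪.toQuasi A)) := by
    simp only [h1]
    simp only [cov, star_sum, Finset.sum_mul_sum, map_sum, Finset.sum_sub_distrib]
  rw [h2]
  exact hω.cov_star_self_nonneg _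

theorem isPosSemidefForm_symForm (hp : (D : ℝ) < p) (hν : 0 < ν) (ha : 0 < a) (hω : IsState ω)
    (hT : IsTranslationInvariant ω) (hc : ClusteringBound p ν a ω) :
    IsPosSemidefForm (symForm ω) := by
  have hs := fun A B : 𝒪.Loc => (summable_cov_shift hp hν ha hω hc A B).of_norm
  refine ⟨fun A B => ?_, fun A => ?_, fun A B C => ?_, fun A B r => ?_⟩
  · rw [symForm, symForm, map_div₀, map_add, hω.conj_form hT, hω.conj_form hT, map_ofNat]
  · have h1 := re_form_self_nonneg hp hν ha hω hT hc A
    have h2 := re_form_self_nonneg hp hν ha hω hT hc (star A)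
    have h3 : (symForm ω A A).re = ((form ω A A).re + (form ω (star A) (star A)).re) / 2 := by
      rw [symForm, ← Complex.add_re]
      exact Complex.div_ofNat_re _ 2
    rw [h3]
    positivity
  · have h1 : form ω (A + B) C = form ω A C + form ω B C := by
      rw [form_eq_tsum hT, form_eq_tsum hT, form_eq_tsum hT, ← (hs A C).tsum_add (hs B C)]
      refine tsum_congr fun x => ?_
      rw [toQuasi_add, ← shiftL_apply, map_add, star_add, cov_add_left]
      rfl
    have h2 : form ω (star C) (star (A + B)) = form ω (star C) (star A) + form ω (star C) (star B) := by
      rw [form_eq_tsum hT, form_eq_tsum hT, form_eq_tsum hT,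
        ← (hs (star C) (star A)).tsum_add (hs (star C) (star B))]
      refine tsum_congr fun x => ?_
      rw [star_add, toQuasi_add, cov_add_right]
    rw [symForm, symForm, symForm, h1, h2]
    ring
  · have h1 : form ω (r • A) B = conj r * form ω A B := by
      rw [form_eq_tsum hT, form_eq_tsum hT, ← tsum_mul_left]
      refine tsum_congr fun x => ?_
      rw [toQuasi_smul, ← shiftL_apply, map_smul, star_smul, cov_smul_left]
      rfl
    have h2 : form ω (star B) (star (r • A)) = conj r * form ω (star B) (star A) := by
      rw [form_eq_tsum hT, form_eq_tsum hT, ← tsum_mul_left]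
      refine tsum_congr fun x => ?_
      rw [star_smul, toQuasi_smul, cov_smul_right]
      rfl
    rw [symForm, symForm, h1, h2]
    ring

/-- The norm of `Ĥ_ω` is controlled by the operator norm and a power of the size of the support,
uniformly in the state. -/
theorem exists_norm_coset_le (hp : (D : ℝ) < p) (hν : 0 < ν) (ha : 0 < a) :
    ∃ G s : ℝ, 0 ≤ G ∧ ∀ ω : 𝒪.Functional, IsState ω → IsTranslationInvariant ω →
      ClusteringBound p ν a ω → ∀ (m : ℕ) (A : 𝒪.Loc),
      (A : Op D d) ∈ localAlg (ball D m : Set (Site D)) → ‖coset ω A‖ ≤ G * (1 + m) ^ s * ‖A‖ := by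
  obtain ⟨G, s, hG, h⟩ := exists_norm_cov_shift_le (𝒪 := 𝒪) (D.cast_nonneg.trans hp.le) hν ha
  set W : ℝ := ∑' x : Site D, (1 + (siteDist x 0 : ℝ)) ^ (-p) with hW
  have hW0 : 0 ≤ W := tsum_nonneg fun x => by positivity
  refine ⟨√(G * W), s / 2, by positivity, fun ω hω hT hc m A hA => ?_⟩
  have hform : ∀ A : 𝒪.Loc, (A : Op D d) ∈ localAlg (ball D m : Set (Site D)) →
      ‖form ω A A‖ ≤ G * (1 + m) ^ s * ‖A‖ * ‖A‖ * W := by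
    intro A hA
    rw [form_eq_tsum hT, hW, ← tsum_mul_left]
    exact tsum_of_norm_bounded ((summable_siteDist_rpow hp).mul_left _).hasSum
      (h ω hω hc m A A hA hA)
  have h1 : ‖coset ω A‖ ^ 2 ≤ G * (1 + m) ^ s * ‖A‖ * ‖A‖ * W := by
    rw [← inner_self_eq_norm_sq (𝕜 := ℂ), inner_coset (isPosSemidefForm_symForm hp hν ha hω hT hc)]
    refine (Complex.re_le_norm _).trans ?_
    have h2 := hform A hA
    have h3 := hform (star A) (star_mem hA)
    rw [norm_star_loc] at h3
    rw [symForm, norm_div, Complex.norm_ofNat]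
    have h4 := norm_add_le (form ω A A) (form ω (star A) (star A))
    linarith
  have h2 : √(G * W) * (1 + (m : ℝ)) ^ (s / 2) * ‖A‖ = √(G * (1 + m) ^ s * ‖A‖ * ‖A‖ * W) := by
    have h3 : √((1 + (m : ℝ)) ^ s) = (1 + (m : ℝ)) ^ (s / 2) := by
      rw [Real.sqrt_eq_rpow, ← Real.rpow_mul (by positivity), mul_one_div]
    rw [show G * (1 + (m : ℝ)) ^ s * ‖A‖ * ‖A‖ * W = (G * W) * (1 + (m : ℝ)) ^ s * (‖A‖ * ‖A‖) by ring,
      Real.sqrt_mul (x := G * W * (1 + (m : ℝ)) ^ s) (by positivity),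
      Real.sqrt_mul (x := G * W) (by positivity), Real.sqrt_mul_self (norm_nonneg _), h3]
  rw [h2]
  exact Real.le_sqrt_of_sq_le h1

end Forms

end LocalObservables

/-! ### Convergence of the truncations -/

/-- Exponential decay beats polynomial growth, in geometric form. -/
theorem exists_rpow_mul_exp_le_geometric (s : ℝ) {μ : ℝ} (hμ : 0 < μ) (m : ℕ) :
    ∃ K r : ℝ, 0 ≤ K ∧ 0 ≤ r ∧ r < 1 ∧ ∀ n : ℕ,
      (1 + ((m + (n + 1) : ℕ) : ℝ)) ^ s * Real.exp (-(μ * n)) ≤ K * r ^ n := by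
  obtain ⟨K, hK0, hK⟩ := exists_rpow_mul_exp_le s (half_pos hμ)
  refine ⟨K * Real.exp (μ / 2 * (m + 1)), Real.exp (-(μ / 2)), by positivity, by positivity,
    (Real.exp_lt_exp.2 (by linarith : -(μ / 2) < 0)).trans_eq Real.exp_zero, fun n => ?_⟩
  have h1 : Real.exp (-(μ * n)) = Real.exp (-(μ / 2 * ((m + (n + 1) : ℕ) : ℝ)))
      * (Real.exp (μ / 2 * (m + 1)) * Real.exp (-(μ / 2)) ^ n) := by
    rw [← Real.exp_nat_mul, ← Real.exp_add, ← Real.exp_add]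
    congr 1
    push_cast
    ring
  rw [h1, ← mul_assoc, mul_assoc K]
  exact mul_le_mul_of_nonneg_right (hK _) (by positivity)

theorem norm_le_of_norm_sub_le_geometric {E : Type*} [SeminormedAddCommGroup E] {f : ℕ → E}
    {K r : ℝ} (hK : 0 ≤ K) (hr0 : 0 ≤ r) (hr : r < 1) (h : ∀ n, ‖f (n + 1) - f n‖ ≤ K * r ^ n)
    (n : ℕ) : ‖f n‖ ≤ ‖f 0‖ + K * (1 - r)⁻¹ := by
  have h1 : dist (f 0) (f n) ≤ ∑ i ∈ Finset.range n, K * r ^ i :=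
    dist_le_range_sum_of_dist_le n fun {k} _ => by rw [dist_comm, dist_eq_norm]; exact h k
  have h2 : ∑ i ∈ Finset.range n, K * r ^ i ≤ K * (1 - r)⁻¹ := by
    rw [← Finset.mul_sum, ← tsum_geometric_of_lt_one hr0 hr]
    exact mul_le_mul_of_nonneg_left ((summable_geometric_of_lt_one hr0 hr).sum_le_tsum _
      fun i _ => by positivity) hK
  have h3 := norm_le_norm_add_norm_sub (f 0) (f n)
  rw [dist_eq_norm] at h1
  linarith

namespace LocalObservables

variable {D d : ℕ} {𝒪 : LocalObservables D d} {h : 𝒪.Loc} {τ : ℝ → 𝒪.Quasi →L[ℂ] 𝒪.Quasi}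
  {ω : 𝒪.Functional}

/-- Local observables `U n`, supported in balls of radius `m + n`, that converge exponentially fast
to the quasi-local observable `u`. -/
structure ExpApprox (C μ : ℝ) (m : ℕ) (U : ℕ → 𝒪.Loc) (u : 𝒪.Quasi) : Prop where
  mem : ∀ n, (U n : Op D d) ∈ localAlg (ball D (m + n) : Set (Site D))
  norm_le : ∀ n, ‖u - 𝒪.toQuasi (U n)‖ ≤ C * Real.exp (-(μ * n))

namespace ExpApprox

variable {C μ : ℝ} {m : ℕ} {U V : ℕ → 𝒪.Loc} {u v : 𝒪.Quasi}

theorem star (hU : ExpApprox C μ m U u) :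
    ExpApprox C μ m (fun n => Star.star (U n)) (Star.star u) where
  mem n := star_mem (hU.mem n)
  norm_le n := by
    rw [toQuasi_star, ← star_sub, norm_star]
    exact hU.norm_le n

theorem mono {C' μ' : ℝ} {m' : ℕ} (hU : ExpApprox C μ m U u) (hC : C ≤ C') (hC0 : 0 ≤ C)
    (hμ : μ' ≤ μ) (hm : m ≤ m') : ExpApprox C' μ' m' U u where
  mem n := localAlg_mono (fun x hx => mem_ball.2 ((mem_ball.1 hx).trans (by omega))) (hU.mem n)
  norm_le n := (hU.norm_le n).trans (by
    have := hC0.trans hC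
    gcongr)

theorem sub_mem (hU : ExpApprox C μ m U u) (n : ℕ) :
    ((U (n + 1) - U n : 𝒪.Loc) : Op D d) ∈ localAlg (ball D (m + (n + 1)) : Set (Site D)) := by
  refine _root_.sub_mem (hU.mem (n + 1)) (localAlg_mono (fun x hx => ?_) (hU.mem n))
  exact mem_ball.2 ((mem_ball.1 hx).trans (by omega))

theorem mem_succ (hU : ExpApprox C μ m U u) (n : ℕ) :
    (U n : Op D d) ∈ localAlg (ball D (m + (n + 1)) : Set (Site D)) :=
  localAlg_mono (fun x hx => mem_ball.2 ((mem_ball.1 hx).trans (by omega))) (hU.mem n)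

theorem norm_succ_sub_le (hU : ExpApprox C μ m U u) (hC : 0 ≤ C) (hμ : 0 < μ) (n : ℕ) :
    ‖U (n + 1) - U n‖ ≤ 2 * C * Real.exp (-(μ * n)) := by
  have h1 := hU.norm_le n
  have h2 := hU.norm_le (n + 1)
  have h3 : C * Real.exp (-(μ * ((n + 1 : ℕ) : ℝ))) ≤ C * Real.exp (-(μ * n)) := by
    gcongr
    exact n.le_succ
  have h4 : 𝒪.toQuasi (U (n + 1) - U n)
      = (u - 𝒪.toQuasi (U n)) - (u - 𝒪.toQuasi (U (n + 1))) := by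
    rw [toQuasi_sub]; abel
  rw [← norm_toQuasi, h4]
  have h5 := norm_sub_le (u - 𝒪.toQuasi (U n)) (u - 𝒪.toQuasi (U (n + 1)))
  linarith

theorem norm_le_add (hU : ExpApprox C μ m U u) (hC : 0 ≤ C) (hμ : 0 < μ) (n : ℕ) :
    ‖U n‖ ≤ ‖u‖ + C := by
  have h1 : C * Real.exp (-(μ * n)) ≤ C :=
    mul_le_of_le_one_right hC (Real.exp_le_one_iff.2 (by
      have : 0 ≤ μ * n := by positivity
      linarith))
  have h2 := norm_le_norm_add_norm_sub u (𝒪.toQuasi (U n))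
  have h3 := hU.norm_le n
  rw [norm_toQuasi] at h2
  linarith

theorem tendsto (hU : ExpApprox C μ m U u) (hμ : 0 < μ) :
    Tendsto (fun n => 𝒪.toQuasi (U n)) atTop (𝓝 u) := by
  rw [tendsto_iff_norm_sub_tendsto_zero]
  have h1 : Tendsto (fun n : ℕ => C * Real.exp (-(μ * n))) atTop (𝓝 (C * 0)) :=
    (Real.tendsto_exp_neg_atTop_nhds_zero.comp
      (tendsto_natCast_atTop_atTop.const_mul_atTop hμ)).const_mul C
  rw [mul_zero] at h1
  exact squeeze_zero (fun _ => norm_nonneg _)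
    (fun n => (norm_sub_rev _ _).trans_le (hU.norm_le n)) h1

variable [NeZero d] {p ν a : ℝ}

/-- The cosets of exponentially fast approximations form Cauchy sequences, uniformly in the
state. -/
theorem exists_norm_coset_sub_le (hp : (D : ℝ) < p) (hν : 0 < ν) (ha : 0 < a) (C : ℝ) (hC : 0 ≤ C)
    {μ : ℝ} (hμ : 0 < μ) (m : ℕ) (M : ℝ) :
    ∃ K r : ℝ, 0 ≤ K ∧ 0 ≤ r ∧ r < 1 ∧ ∀ ω : 𝒪.Functional, IsState ω → IsTranslationInvariant ω →
      ClusteringBound p ν a ω → ∀ (U : ℕ → 𝒪.Loc) (u : 𝒪.Quasi), ExpApprox C μ m U u → ‖u‖ ≤ M →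
      ‖coset ω (U 0)‖ ≤ K ∧ ∀ n, ‖coset ω (U (n + 1)) - coset ω (U n)‖ ≤ K * r ^ n := by
  obtain ⟨G, s, hG, hle⟩ := exists_norm_coset_le (𝒪 := 𝒪) hp hν ha
  obtain ⟨K, r, hK, hr0, hr1, hKr⟩ := exists_rpow_mul_exp_le_geometric s hμ m
  refine ⟨max (G * (1 + m) ^ s * (M + C)) (G * (2 * C) * K), r, le_max_of_le_right (by positivity),
    hr0, hr1, fun ω hω hT hc U u hU hu => ⟨?_, fun n => ?_⟩⟩
  · refine (hle ω hω hT hc m (U 0) (hU.mem 0)).trans (le_max_of_le_left ?_)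
    exact mul_le_mul_of_nonneg_left ((hU.norm_le_add hC hμ 0).trans (by linarith)) (by positivity)
  · rw [← coset_sub]
    calc ‖coset ω (U (n + 1) - U n)‖
        ≤ G * (1 + ((m + (n + 1) : ℕ) : ℝ)) ^ s * ‖U (n + 1) - U n‖ :=
          hle ω hω hT hc _ _ (hU.sub_mem n)
      _ ≤ G * (1 + ((m + (n + 1) : ℕ) : ℝ)) ^ s * (2 * C * Real.exp (-(μ * n))) :=
          mul_le_mul_of_nonneg_left (hU.norm_succ_sub_le hC hμ n) (by positivity)
      _ = G * (2 * C) * ((1 + ((m + (n + 1) : ℕ) : ℝ)) ^ s * Real.exp (-(μ * n))) := by ring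
      _ ≤ G * (2 * C) * (K * r ^ n) := mul_le_mul_of_nonneg_left (hKr n) (by positivity)
      _ = G * (2 * C) * K * r ^ n := by ring
      _ ≤ _ := mul_le_mul_of_nonneg_right (le_max_right _ _) (by positivity)

/-- The form is continuous along exponentially fast approximations. The sums over the lattice
converge by domination: the increments of their terms in `n` are geometrically small, compared with
a fixed summable function of the translation. -/
theorem tendsto_form (hp : (D : ℝ) < p) (hν : 0 < ν) (ha : 0 < a) (hω : IsState ω)
    (hT : IsTranslationInvariant ω) (hc : ClusteringBound p ν a ω) (hC : 0 ≤ C) (hμ : 0 < μ)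
    (hU : ExpApprox C μ m U u) (hV : ExpApprox C μ m V v) :
    Tendsto (fun n => form ω (U n) (V n)) atTop
      (𝓝 (∑' x, cov ω (Star.star (𝒪.shiftQuasi x u)) v)) := by
  obtain ⟨G, s, hG, hle⟩ := exists_norm_cov_shift_le (𝒪 := 𝒪) (D.cast_nonneg.trans hp.le) hν ha
  obtain ⟨K, r, hK, hr0, hr1, hKr⟩ := exists_rpow_mul_exp_le_geometric s hμ m
  set M := max (‖u‖ + C) (‖v‖ + C) with hM
  have hM0 : 0 ≤ M := le_max_of_le_left (by positivity)
  have hUM : ∀ n, ‖U n‖ ≤ M := fun n => (hU.norm_le_add hC hμ n).trans (le_max_left _ _)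
  have hVM : ∀ n, ‖V n‖ ≤ M := fun n => (hV.norm_le_add hC hμ n).trans (le_max_right _ _)
  set w : Site D → ℝ := fun x => (1 + (siteDist x 0 : ℝ)) ^ (-p) with hw
  have hw0 : ∀ x, 0 ≤ w x := fun x => by rw [hw]; positivity
  set f : ℕ → Site D → ℂ := fun n x =>
    cov ω (Star.star (𝒪.shiftQuasi x (𝒪.toQuasi (U n)))) (𝒪.toQuasi (V n)) with hf
  have hstep : ∀ x n, ‖f (n + 1) x - f n x‖ ≤ G * (4 * C * M) * K * w x * r ^ n := by
    intro x n
    have h1 : f (n + 1) x - f n x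
        = cov ω (Star.star (𝒪.shiftQuasi x (𝒪.toQuasi (U (n + 1) - U n)))) (𝒪.toQuasi (V (n + 1)))
          + cov ω (Star.star (𝒪.shiftQuasi x (𝒪.toQuasi (U n)))) (𝒪.toQuasi (V (n + 1) - V n)) := by
      rw [toQuasi_sub, toQuasi_sub, ← shiftL_apply, ← shiftL_apply, map_sub, star_sub,
        cov_sub_left, cov_sub_right, shiftL_apply, shiftL_apply]
      ring
    rw [h1]
    have h2 := hle ω hω hc _ _ _ (hU.sub_mem n) (hV.mem (n + 1)) x
    have h3 := hle ω hω hc _ _ _ (hU.mem_succ n) (hV.sub_mem n) x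
    have h4 : ‖U (n + 1) - U n‖ * ‖V (n + 1)‖ ≤ 2 * C * Real.exp (-(μ * n)) * M :=
      mul_le_mul (hU.norm_succ_sub_le hC hμ n) (hVM _) (norm_nonneg _) (by positivity)
    have h5 : ‖U n‖ * ‖V (n + 1) - V n‖ ≤ M * (2 * C * Real.exp (-(μ * n))) :=
      mul_le_mul (hUM _) (hV.norm_succ_sub_le hC hμ n) (norm_nonneg _) hM0
    set b := (1 + ((m + (n + 1) : ℕ) : ℝ)) ^ s with hb
    have hb0 : 0 ≤ b := by positivity
    refine (norm_add_le _ _).trans ((add_le_add h2 h3).trans ?_)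
    calc _ = G * b * w x * (‖U (n + 1) - U n‖ * ‖V (n + 1)‖ + ‖U n‖ * ‖V (n + 1) - V n‖) := by
          rw [hw]; ring
      _ ≤ G * b * w x * (2 * C * Real.exp (-(μ * n)) * M + M * (2 * C * Real.exp (-(μ * n)))) :=
          mul_le_mul_of_nonneg_left (add_le_add h4 h5)
            (mul_nonneg (mul_nonneg hG hb0) (hw0 x))
      _ = G * (4 * C * M) * w x * (b * Real.exp (-(μ * n))) := by ring
      _ ≤ G * (4 * C * M) * w x * (K * r ^ n) :=
          mul_le_mul_of_nonneg_left (hKr n) (mul_nonneg (by positivity) (hw0 x))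
      _ = _ := by ring
  have hbound : ∀ n x, ‖f n x‖
      ≤ (G * (1 + m) ^ s * ‖U 0‖ * ‖V 0‖ + G * (4 * C * M) * K * (1 - r)⁻¹) * w x := by
    intro n x
    have h1 := norm_le_of_norm_sub_le_geometric (f := fun n => f n x)
      (mul_nonneg (by positivity) (hw0 x)) hr0 hr1 (hstep x) n
    have h2 := hle ω hω hc m _ _ (hU.mem 0) (hV.mem 0) x
    refine h1.trans ((add_le_add_left h2 _).trans_eq ?_)
    rw [hw]; ring
  have hform : (fun n => form ω (U n) (V n)) = fun n => ∑' x, f n x :=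
    funext fun n => form_eq_tsum hT _ _
  rw [hform]
  refine tendsto_tsum_of_dominated_convergence ((summable_siteDist_rpow hp).mul_left _) (fun x => ?_)
    (Eventually.of_forall hbound)
  have h1 : Tendsto (fun n => Star.star (𝒪.shiftQuasi x (𝒪.toQuasi (U n)))) atTop
      (𝓝 (Star.star (𝒪.shiftQuasi x u))) :=
    (((𝒪.shiftL x).continuous.tendsto u).comp (hU.tendsto hμ)).star
  exact ((hω.continuous.tendsto _).comp (h1.mul (hV.tendsto hμ))).sub
    (((hω.continuous.tendsto _).comp h1).mul ((hω.continuous.tendsto _).comp (hV.tendsto hμ)))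

end ExpApprox

section Truncation

theorem cov_evolve (hh : star h = h) (hτ : IsTimeEvolution h τ) (t : ℝ) (b c : 𝒪.Quasi) :
    cov (evolve ω τ t) b c = cov ω (τ t b) (τ t c) := by
  rw [cov, cov, ← (hτ.isThermodynamicLimit hh).map_mul]
  rfl

theorem form_evolve (hh : star h = h) (hτ : IsTimeEvolution h τ) (hT : IsTranslationInvariant ω)
    (t : ℝ) (A B : 𝒪.Loc) : form (evolve ω τ t) A B
      = ∑' x, cov ω (star (𝒪.shiftQuasi x (τ t (𝒪.toQuasi A)))) (τ t (𝒪.toQuasi B)) := by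
  rw [form_eq_tsum (hT.evolve hτ t)]
  refine tsum_congr fun x => ?_
  rw [cov_evolve hh hτ, (hτ.isThermodynamicLimit hh).map_star, hτ.apply_shiftQuasi]

variable [NeZero d] {p ν a : ℝ}

/-- The truncations approximate the evolved observable exponentially well, by the Lieb–Robinson bound
and the contractivity of the projections. -/
theorem exists_expApprox_truncation (hh : star h = h) (hτ : IsTimeEvolution h τ) (T : ℝ)
    (A : 𝒪.Loc) : ∃ (C μ : ℝ) (m : ℕ), 0 ≤ C ∧ 0 < μ ∧ ∀ t, |t| ≤ |T| →
      ExpApprox C μ m (truncation τ t A) (τ t (𝒪.toQuasi A)) := by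
  obtain ⟨Y, hsY, hY⟩ := exists_supp_eq (𝒪.le_localAlg A.2)
  obtain ⟨C, μ, c, hC, hμ, hap⟩ := exists_loc_approx hh hτ T
  refine ⟨2 * (C * ((Y.card : ℝ) + 1) ^ c * ‖A‖), μ, Y.sup fun x => siteDist x 0, by positivity, hμ,
    fun t ht => ⟨fun n => ?_, fun n => ?_⟩⟩
  · obtain ⟨B, hB, hB'⟩ := 𝒪.mem_locIn.1 (𝒪.proj_spec (nbhd n Y) (τ t (𝒪.toQuasi A))).1
    have h1 : B = 𝒪.proj (nbhd n Y : Set (Site D)) (τ t (𝒪.toQuasi A)) :=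
      Subtype.ext (congrArg (fun a : 𝒪.Quasi => (a : Op D d)) hB)
    rw [h1] at hB'
    rw [truncation, neighbourhood_eq hY hsY]
    refine localAlg_mono (fun x hx => ?_) hB'
    obtain ⟨y, hy, hyx⟩ := mem_nbhd.1 hx
    have h2 : siteDist y 0 ≤ Y.sup fun x => siteDist x 0 :=
      Finset.le_sup (f := fun x => siteDist x 0) hy
    have h3 := siteDist_triangle x y 0
    refine mem_ball.2 ?_
    omega
  · obtain ⟨A', hA1, -, hA3⟩ := hap t ht A Y hY n
    rw [truncation, neighbourhood_eq hY hsY]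
    have h1 := 𝒪.norm_proj_sub_le (nbhd n Y) (τ t (𝒪.toQuasi A)) (𝒪.mem_locIn.2 ⟨A', rfl, hA1⟩)
    have h2 := norm_sub_le_norm_sub_add_norm_sub (τ t (𝒪.toQuasi A)) (𝒪.toQuasi A')
      (𝒪.toQuasi (𝒪.proj (nbhd n Y : Set (Site D)) (τ t (𝒪.toQuasi A))))
    rw [norm_sub_rev (𝒪.toQuasi A')] at h2
    linarith

/-- The truncations of an evolved observable converge in `Ĥ_ω` geometrically fast, uniformly in the
state and in bounded times. -/
theorem exists_dist_evolvedVector_le (hh : star h = h) (hτ : IsTimeEvolution h τ)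
    (hp : (D : ℝ) < p) (hν : 0 < ν) (ha : 0 < a) (T : ℝ) (A : 𝒪.Loc) :
    ∃ K r : ℝ, 0 ≤ r ∧ r < 1 ∧ ∀ ω : 𝒪.Functional, IsState ω → IsTranslationInvariant ω →
      ClusteringBound p ν a ω → ∀ t, |t| ≤ |T| →
      CauchySeq (fun n => coset ω (truncation τ t A n)) ∧
      Tendsto (fun n => coset ω (truncation τ t A n)) atTop (𝓝 (evolvedVector ω τ t A)) ∧
      ‖evolvedVector ω τ t A‖ ≤ K ∧
      ∀ n, ‖coset ω (truncation τ t A n) - evolvedVector ω τ t A‖ ≤ K * r ^ n := by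
  obtain ⟨C, μ, m, hC, hμ, hap⟩ := exists_expApprox_truncation hh hτ T A
  obtain ⟨K, r, hK, hr0, hr1, hle⟩ :=
    ExpApprox.exists_norm_coset_sub_le (𝒪 := 𝒪) hp hν ha C hC hμ m ‖A‖
  have hr : 0 < 1 - r := sub_pos.2 hr1
  refine ⟨K + K / (1 - r), r, hr0, hr1, fun ω hω hT hc t ht => ?_⟩
  obtain ⟨h0, hs⟩ := hle ω hω hT hc _ _ (hap t ht)
    (((hτ.isThermodynamicLimit hh).norm_apply t _).trans_le le_rfl)
  have hd : ∀ n, dist (coset ω (truncation τ t A n)) (coset ω (truncation τ t A (n + 1)))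
      ≤ K * r ^ n := fun n => by rw [dist_comm, dist_eq_norm]; exact hs n
  have hcau := cauchySeq_of_le_geometric r K hr1 hd
  have hlim : Tendsto (fun n => coset ω (truncation τ t A n)) atTop (𝓝 (evolvedVector ω τ t A)) :=
    hcau.tendsto_limUnder
  have hdist := dist_le_of_le_geometric_of_tendsto r K hr1 hd hlim
  have hK1 : 0 ≤ K / (1 - r) := by positivity
  refine ⟨hcau, hlim, ?_, fun n => ?_⟩
  · have h1 := hdist 0
    rw [pow_zero, mul_one, dist_eq_norm] at h1
    have h2 := norm_le_norm_add_norm_sub (coset ω (truncation τ t A 0)) (evolvedVector ω τ t A)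
    linarith
  · rw [← dist_eq_norm]
    refine (hdist n).trans ?_
    rw [mul_div_right_comm]
    exact mul_le_mul_of_nonneg_right (by linarith) (by positivity)

/-- The forms of the truncations converge to the form of the evolved observables, whose terms are
those of the evolved state. -/
theorem inner_evolvedVector (hh : star h = h) (hτ : IsTimeEvolution h τ) (hp : (D : ℝ) < p)
    (hν : 0 < ν) (ha : 0 < a) (hω : IsState ω) (hT : IsTranslationInvariant ω)
    (hc : ClusteringBound p ν a ω) (t : ℝ) (A B : 𝒪.Loc) :
    inner ℂ (evolvedVector ω τ t A) (evolvedVector ω τ t B) = symForm (evolve ω τ t) A B := by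
  have hl := hτ.isThermodynamicLimit hh
  obtain ⟨C₁, μ₁, m₁, hC₁, hμ₁, hA⟩ := exists_expApprox_truncation hh hτ t A
  obtain ⟨C₂, μ₂, m₂, hC₂, hμ₂, hB⟩ := exists_expApprox_truncation hh hτ t B
  have hA := (hA t le_rfl).mono (le_max_left C₁ C₂) hC₁ (min_le_left μ₁ μ₂) (le_max_left m₁ m₂)
  have hB := (hB t le_rfl).mono (le_max_right C₁ C₂) hC₂ (min_le_right μ₁ μ₂) (le_max_right m₁ m₂)
  have hC : 0 ≤ max C₁ C₂ := le_max_of_le_left hC₁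
  have hμ : 0 < min μ₁ μ₂ := lt_min hμ₁ hμ₂
  obtain ⟨_, _, _, _, hlA⟩ := exists_dist_evolvedVector_le hh hτ hp hν ha t A
  obtain ⟨_, _, _, _, hlB⟩ := exists_dist_evolvedVector_le hh hτ hp hν ha t B
  have hin := (hlA ω hω hT hc t le_rfl).2.1.inner (𝕜 := ℂ) (hlB ω hω hT hc t le_rfl).2.1
  refine tendsto_nhds_unique hin ?_
  simp only [inner_coset (isPosSemidefForm_symForm hp hν ha hω hT hc), symForm]
  refine Tendsto.div_const (Tendsto.add ?_ ?_) _
  · rw [form_evolve hh hτ hT]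
    exact ExpApprox.tendsto_form hp hν ha hω hT hc hC hμ hA hB
  · rw [form_evolve hh hτ hT, toQuasi_star, toQuasi_star, hl.map_star, hl.map_star]
    exact ExpApprox.tendsto_form hp hν ha hω hT hc hC hμ hB.star hA.star

end Truncation

end LocalObservables

end QuantumLattice

theorem mainTheorem7 {D d : ℕ} [NeZero d] (𝒪 : LocalObservables D d)
    (h : 𝒪.Loc) (hh : star h = h) :
    -- the time evolution exists and is unique
    (∃! τ : ℝ → 𝒪.Quasi →L[ℂ] 𝒪.Quasi, IsTimeEvolution h τ) ∧
    ∀ τ : ℝ → 𝒪.Quasi →L[ℂ] 𝒪.Quasi, IsTimeEvolution h τ → ∀ p : ℝ, (D : ℝ) < p →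
      -- (i) for a single state
      (∀ ω : 𝒪.Functional, SizablyClustering p ω → ∀ q < p, ∀ t : ℝ,
        SizablyClustering q (evolve ω τ t)) ∧
      -- (i) uniformly
      (∀ (S : Set 𝒪.Functional) (K : Set ℝ), UniformlySizablyClustering p S → IsCompact K →
        ∀ q < p, UniformlySizablyClustering q {ω' | ∃ ω ∈ S, ∃ t ∈ K, ω' = evolve ω τ t}) ∧
      -- (ii) convergence of the local truncations, and the form
      (∀ ω : 𝒪.Functional, SizablyClustering p ω → ∀ t : ℝ,
        (∀ A : 𝒪.Loc,
          CauchySeq (fun n => coset ω (truncation τ t A n)) ∧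
          Tendsto (fun n => coset ω (truncation τ t A n)) atTop (𝓝 (evolvedVector ω τ t A))) ∧
        ∀ A B : 𝒪.Loc,
          inner ℂ (evolvedVector ω τ t A) (evolvedVector ω τ t B)
            = symForm (evolve ω τ t) A B) ∧
      -- (ii) uniformity of the norms
      (∀ (S : Set 𝒪.Functional) (K : Set ℝ), UniformlySizablyClustering p S → IsCompact K →
        ∀ A : 𝒪.Loc,
          (∃ C : ℝ, ∀ ω ∈ S, ∀ t ∈ K, ‖evolvedVector ω τ t A‖ ≤ C) ∧
          ∀ ε > 0, ∃ N : ℕ, ∀ n ≥ N, ∀ ω ∈ S, ∀ t ∈ K,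
            |‖coset ω (truncation τ t A n)‖ - ‖evolvedVector ω τ t A‖| < ε) := by
  refine ⟨existsUnique_isTimeEvolution hh, fun τ hτ p hp => ?_⟩
  have hp0 : 0 ≤ p := D.cast_nonneg.trans hp.le
  refine ⟨fun ω hω q hq t => hω.evolve hh hτ hp0 hq t,
    fun S K hS hK q hq => hS.evolve hh hτ hp0 hq hK.isBounded, fun ω hω t => ?_,
    fun S K hS hK A => ?_⟩
  · obtain ⟨ν, a, hν, ha, hω⟩ := hω
    obtain ⟨h1, h2, h3⟩ := hω ω rfl
    refine ⟨fun A => ?_, fun A B => inner_evolvedVector hh hτ hp hν ha h1 h2 h3 t A B⟩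
    obtain ⟨_, _, _, _, hle⟩ := exists_dist_evolvedVector_le hh hτ hp hν ha t A
    exact ⟨(hle ω h1 h2 h3 t le_rfl).1, (hle ω h1 h2 h3 t le_rfl).2.1⟩
  · obtain ⟨ν, a, hν, ha, hS⟩ := hS
    obtain ⟨T, hT⟩ := hK.isBounded.exists_norm_le
    obtain ⟨C, r, hr0, hr1, hle⟩ := exists_dist_evolvedVector_le hh hτ hp hν ha T A
    have hT' : ∀ t ∈ K, |t| ≤ |T| := fun t ht => (hT t ht).trans (le_abs_self T)
    refine ⟨⟨C, fun ω hω t ht => ?_⟩, fun ε hε => ?_⟩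
    · obtain ⟨h1, h2, h3⟩ := hS ω hω
      exact (hle ω h1 h2 h3 t (hT' t ht)).2.2.1
    · have hlim : Tendsto (fun n => C * r ^ n) atTop (𝓝 (C * 0)) :=
        (tendsto_pow_atTop_nhds_zero_of_lt_one hr0 hr1).const_mul C
      rw [mul_zero] at hlim
      obtain ⟨N, hN⟩ := eventually_atTop.1 (hlim.eventually (gt_mem_nhds hε))
      refine ⟨N, fun n hn ω hω t ht => ?_⟩
      obtain ⟨h1, h2, h3⟩ := hS ω hω
      exact (abs_norm_sub_norm_le _ _).trans_lt
        (((hle ω h1 h2 h3 t (hT' t ht)).2.2.2 n).trans_lt (hN n hn))
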